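/- Let $H$ be a separable complex Hilbert space and let $\alpha:[0,1]\to[0,\infty)$ be of class $C^2$ with Lebesgue-null zero set; write $L^2_\alpha=L^2(H,(0,1);\alpha(t)\,dt)$. Let $D\subset H$ be a dense subspace and, for $t\in[0,1]$, let $A(t)=A_r(t)+iA_i(t)$ be closed with $D(A(t))=D(A_r(t))=D(A_i(t))=D$, where $A_r(t),A_i(t)$ are self-adjoint, $A_r(t)A_i(t)=A_i(t)A_r(t)$, and $t\mapsto A_i(t)f$ is continuously differentiable on $[0,1]$ for every $f\in D$. Suppose that $A_r(t)=\frac{\alpha'(t)}{2\alpha(t)}I+C$ for almost every $t\in(0,1)$, with a constant operator $C\ge 0$. Let $l(u)=u'+A(t)u$ and $l^+(v)=-\frac{(\alpha v)'}{\alpha}+A(t)^*v$. The minimal operators $L_0$, $L_0^+$ are the closures in $L^2_\alpha$ of $l$, $l^+$ on the finite sums $\sum_k\varphi_kf_k$ with $\varphi_k\in C_0^\infty(0,1)$, $f_k\in D$; the maximal operators are $L=(L_0^+)^*$ and $L^+=L_0^*$. Assume that $C^{1/2}[D(L)\cap D(L^+)]\subset W^1_{2,\alpha}(H,(0,1))$,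 where $u\in W^1_{2,\alpha}(H,(0,1))$ means $\sqrt{\alpha}\,u\in W^1_2(H,(0,1))$. Let $U(t,s)$, $t,s\in[0,1]$, be the evolution operators of $U_t'(t,s)f+iA_i(t)U(t,s)f=0$, $U(s,s)f=f$ for $f\in D$. For a unitary operator $W$ in $H$ with $CW=WC$, let $L_W$ be the restriction of $L$ to those $u\in D(L)\cap D(L^+)$ for which $(\sqrt{\alpha}u)(1)=U(1,0)W(\sqrt{\alpha}u)(0)$; the boundary values are those of the representative $v$ of $\sqrt\alpha u$ on $[0,1]$ for which $U(t,0)^{-1}v(t)$ is absolutely continuous and in $W^1_2(H,(0,1))$, such a representative being required to exist. For $1\le p<\infty$ let $\mathfrak S_p$ be the class of compact operators $T$ with $\sum_n s_n(T)^p<\infty$, where $s_n(T)$ are the nonzero eigenvalues of $(T^*T)^{1/2}$ counted with multiplicity. Let $W_1,W_2$ be unitary operators commuting with $C$ such that $L_{W_1}$ and $L_{W_2}$ are normal extensions of $L_0$, let $\lambda\in\rho(L_{W_1})\cap\rho(L_{W_2})$ and $R_\lambda(T)=(T-\lambda)^{-1}$. Then for every $1\le p<\infty$, $$R_\lambda(L_{W_1})-R_\lambda(L_{W_2})\in\mathfrak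 S_p(L^2_\alpha)\quad\Longleftrightarrow\quad W_1-W_2\in\mathfrak S_p(H).$$ -/

import Mathlib

open MeasureTheory Set
open scoped ENNReal ContDiff InnerProductSpace

noncomputable section

namespace NormalExt

section Abstract

variable {E : Type*} [NormedAddCommGroup E] [InnerProductSpace ℂ E]

/-- The product relations `S T` and `T S` of two (unbounded) operators coincide, domains included:
`S T = T S`. -/
def Commutes (S T : E →ₗ.[ℂ] E) : Prop :=
  ∀ x z : E, (∃ y, (x, y) ∈ T.graph ∧ (y, z) ∈ S.graph) ↔
    (∃ y, (x, y) ∈ S.graph ∧ (y, z) ∈ T.graph)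

/-- An everywhere defined bounded operator, seen as an operator with domain `⊤`. -/
def everywhere (B : E →L[ℂ] E) : E →ₗ.[ℂ] E :=
  (B : E →ₗ[ℂ] E).toPMap ⊤

/-- `⟨T x, x⟩ ≥ 0` on the domain of `T`. -/
def IsNonneg (T : E →ₗ.[ℂ] E) : Prop :=
  ∀ x : T.domain, 0 ≤ (⟪T x, (x : E)⟫_ℂ).re

/-- `λ` is in the resolvent set of `T` with resolvent `R = (T - λ)⁻¹`, an everywhere defined
bounded operator. -/
def IsResolventAt (T : E →ₗ.[ℂ] E) (lam : ℂ) (R : E →L[ℂ] E) : Prop :=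
  (∀ f : E, ∃ h : R f ∈ T.domain, T ⟨R f, h⟩ - lam • R f = f) ∧
    ∀ x : T.domain, R (T x - lam • (x : E)) = x

/-- The resolvent set `ρ(T)`. -/
def resolventSet (T : E →ₗ.[ℂ] E) : Set ℂ :=
  {lam | ∃ R : E →L[ℂ] E, IsResolventAt T lam R}

open Classical in
/-- The resolvent `R_λ(T) = (T - λ)⁻¹` for `λ ∈ ρ(T)` (and `0` for other `λ`). -/
def resolvent (T : E →ₗ.[ℂ] E) (lam : ℂ) : E →L[ℂ] E :=
  if h : lam ∈ resolventSet T then h.choose else 0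

variable [CompleteSpace E]

/-- A densely defined closed operator `N` with `D(N) = D(N*)` and `‖N u‖ = ‖N* u‖`. -/
structure IsNormalOp (N : E →ₗ.[ℂ] E) : Prop where
  dense : Dense (N.domain : Set E)
  closed : N.IsClosed
  domain_adjoint : N.adjoint.domain = N.domain
  norm_eq : ∀ (u : N.domain) (v : N.adjoint.domain), (u : E) = v → ‖N u‖ = ‖N.adjoint v‖

/-- `T` is a normal extension of `T₀`. -/
def IsNormalExtension (T₀ T : E →ₗ.[ℂ] E) : Prop :=
  T₀ ≤ T ∧ IsNormalOp T

/-- `S = C^{1/2}`: the nonnegative self-adjoint operator with `S S = C`, domains included. -/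
structure IsPosSqrt (S C : E →ₗ.[ℂ] E) : Prop where
  selfAdjoint : IsSelfAdjoint S
  nonneg : IsNonneg S
  sq : ∀ x z : E, (x, z) ∈ C.graph ↔ ∃ y, (x, y) ∈ S.graph ∧ (y, z) ∈ S.graph

/-- The Schatten–von Neumann class `𝔖_p`, for `1 ≤ p < ∞`: the compact operators `T` with
`∑ sₙ(T)^p < ∞`. The nonzero `s`-numbers are the eigenvalues `s > 0` of `|T| = (T* T)^{1/2}`
repeated according to multiplicity, so each `s` contributes `dim ker(|T| - s) · s^p`. -/
def Schatten (p : ℝ) (T : E →L[ℂ] E) : Prop :=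
  IsCompactOperator T ∧
    Summable fun s : Ioi (0 : ℝ) =>
      (Module.finrank ℂ
        (Module.End.eigenspace (CFC.abs T : E →L[ℂ] E).toLinearMap ((s : ℝ) : ℂ)) : ℝ) *
        (s : ℝ) ^ p

end Abstract

/-- The measure `α(t) dt` on `(0, 1)`. -/
def weightMeasure (α : ℝ → ℝ) : Measure ℝ :=
  (volume.restrict (Ioo 0 1)).withDensity fun t => ENNReal.ofReal (α t)

/-- The weighted Hilbert space `L²_α(H, (0, 1))`. -/
abbrev L2w (H : Type*) [NormedAddCommGroup H] (α : ℝ → ℝ) : Type _ :=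
  Lp H 2 (weightMeasure α)

/-- `α : [0, 1] → [0, ∞)` is of class `C²` and its zero set is a null set. -/
structure IsWeight (α : ℝ → ℝ) : Prop where
  contDiffOn : ContDiffOn ℝ 2 α (Icc 0 1)
  nonneg : ∀ t ∈ Icc (0 : ℝ) 1, 0 ≤ α t
  null_zeros : volume {t ∈ Icc (0 : ℝ) 1 | α t = 0} = 0

/-- `C_0^∞(0, 1)`. -/
structure IsTestFunction (φ : ℝ → ℂ) : Prop where
  contDiff : ContDiff ℝ ∞ φ
  hasCompactSupport : HasCompactSupport φ
  tsupport_subset : tsupport φ ⊆ Ioo 0 1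

variable {H : Type*} [NormedAddCommGroup H] [InnerProductSpace ℂ H]

/-- `v ∈ W_2^1(H, (0, 1))`, for the continuous representative `v` on `[0, 1]`: `v` is
the primitive of a square integrable function. -/
def IsW12 (v : ℝ → H) : Prop :=
  ∃ g : ℝ → H, MemLp g 2 (volume.restrict (Ioo 0 1)) ∧
    ∀ t ∈ Icc (0 : ℝ) 1, v t = v 0 + ∫ s in (0 : ℝ)..t, g s

/-- `v` represents `√α u`. -/
def Represents (α : ℝ → ℝ) (v : ℝ → H) (u : L2w H α) : Prop :=
  ∀ᵐ t ∂(weightMeasure α), v t = ((√(α t) : ℝ) : ℂ) • u t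

/-- `u ∈ W_{2,α}^1(H, (0, 1))`, i.e. `√α u ∈ W_2^1(H, (0, 1))`. -/
def MemW12w (α : ℝ → ℝ) (u : L2w H α) : Prop :=
  ∃ v : ℝ → H, IsW12 v ∧ Represents α v u

/-- The graph of `u ↦ δ(φ_1) f_1 + φ_1 B(t) f_1 + ⋯ + δ(φ_n) f_n + φ_n B(t) f_n` on the set of
all `u = φ_1 f_1 + ⋯ + φ_n f_n` with `φ_k ∈ C_0^∞(0, 1)`, `f_k ∈ D`. -/
def preGraph (α : ℝ → ℝ) (D : Submodule ℂ H) (δ : (ℝ → ℂ) → ℝ → ℂ) (B : ℝ → H →ₗ.[ℂ] H) :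
    Submodule ℂ (L2w H α × L2w H α) :=
  Submodule.span ℂ {q | ∃ (φ : ℝ → ℂ) (f : H) (b : ℝ → H), IsTestFunction φ ∧ f ∈ D ∧
    (∀ᵐ t ∂(volume.restrict (Ioo (0 : ℝ) 1)), (f, b t) ∈ (B t).graph) ∧
    (∀ᵐ t ∂(weightMeasure α), q.1 t = φ t • f) ∧
    (∀ᵐ t ∂(weightMeasure α), q.2 t = δ φ t • f + φ t • b t)}

/-- The minimal operator `L₀`: the closure of `u ↦ u' + A(t) u` on the span of the `φ f`. -/
def minimalOp (α : ℝ → ℝ) (D : Submodule ℂ H) (A : ℝ → H →ₗ.[ℂ] H) :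
    L2w H α →ₗ.[ℂ] L2w H α :=
  (preGraph α D (fun φ => deriv φ) A).toLinearPMap.closure

variable [CompleteSpace H]

/-- The minimal operator `L₀⁺` of the formally adjoint expression
`v ↦ -(α v)' / α + A(t)* v`. -/
def minimalOpPlus (α : ℝ → ℝ) (D : Submodule ℂ H) (A : ℝ → H →ₗ.[ℂ] H) :
    L2w H α →ₗ.[ℂ] L2w H α :=
  (preGraph α D (fun φ t => -(deriv (fun s => (α s : ℂ) * φ s) t / (α t : ℂ)))
    (fun t => (A t).adjoint)).toLinearPMap.closure

/-- The maximal operator `L = (L₀⁺)*`. -/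
def maximalOp (α : ℝ → ℝ) (D : Submodule ℂ H) (A : ℝ → H →ₗ.[ℂ] H) :
    L2w H α →ₗ.[ℂ] L2w H α :=
  (minimalOpPlus α D A).adjoint

/-- The maximal operator `L⁺ = (L₀)*`. -/
def maximalOpPlus (α : ℝ → ℝ) (D : Submodule ℂ H) (A : ℝ → H →ₗ.[ℂ] H) :
    L2w H α →ₗ.[ℂ] L2w H α :=
  (minimalOp α D A).adjoint

/-- The operator coefficient `A(t) = A_r(t) + i A_i(t)`, with domain `D` for every `t`, its
commuting self-adjoint parts `A_r(t)` and `A_i(t)`, and the constant operator `C ≥ 0` with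
`A_r(t) = (α'(t) / (2 α(t))) I + C` for almost every `t`. -/
structure IsCoefficient (α : ℝ → ℝ) (D : Submodule ℂ H) (A Ar Ai : ℝ → H →ₗ.[ℂ] H)
    (C : H →ₗ.[ℂ] H) : Prop where
  dense : Dense (D : Set H)
  closed : ∀ t ∈ Icc (0 : ℝ) 1, (A t).IsClosed
  re_domain : ∀ t ∈ Icc (0 : ℝ) 1, (Ar t).domain = D
  im_domain : ∀ t ∈ Icc (0 : ℝ) 1, (Ai t).domain = D
  eq_re_add_im : ∀ t ∈ Icc (0 : ℝ) 1, A t = Ar t + Complex.I • Ai t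
  re_selfAdjoint : ∀ t ∈ Icc (0 : ℝ) 1, IsSelfAdjoint (Ar t)
  im_selfAdjoint : ∀ t ∈ Icc (0 : ℝ) 1, IsSelfAdjoint (Ai t)
  commutes : ∀ t ∈ Icc (0 : ℝ) 1, Commutes (Ar t) (Ai t)
  im_contDiff : ∀ f ∈ D, ∃ a : ℝ → H, ContDiffOn ℝ 1 a (Icc 0 1) ∧
    ∀ t ∈ Icc (0 : ℝ) 1, (f, a t) ∈ (Ai t).graph
  nonneg : IsNonneg C
  re_eq : ∀ᵐ t ∂(volume.restrict (Ioo (0 : ℝ) 1)),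
    Ar t = ((deriv α t / (2 * α t) : ℝ) : ℂ) • everywhere (ContinuousLinearMap.id ℂ H) + C

/-- `U(t, s)` is the family of bounded evolution operators of `U_t'(t, s) f + i A_i(t) U(t, s) f = 0`,
`U(s, s) f = f` for `f ∈ D` and `t, s ∈ [0, 1]`. -/
structure IsEvolution (D : Submodule ℂ H) (Ai : ℝ → H →ₗ.[ℂ] H) (U : ℝ → ℝ → H →L[ℂ] H) :
    Prop where
  initial : ∀ s ∈ Icc (0 : ℝ) 1, U s s = ContinuousLinearMap.id ℂ H
  equation : ∀ s ∈ Icc (0 : ℝ) 1, ∀ t ∈ Icc (0 : ℝ) 1, ∀ f ∈ D, ∃ y : H,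
    (U t s f, y) ∈ (Ai t).graph ∧
      HasDerivWithinAt (fun r => U r s f) (-(Complex.I • y)) (Icc 0 1) t

/-- The `u ∈ D(L⁺)` with boundary condition `(√α u)(1) = U(1, 0) W (√α u)(0)`. The boundary values
are those of the representative `v` of `√α u` for which `t ↦ U(t, 0)⁻¹ v(t) = U(0, t) v(t)` is
the absolutely continuous representative of a function in `W_2^1(H, (0, 1))`. -/
def boundarySubmodule (α : ℝ → ℝ) (D : Submodule ℂ H) (A : ℝ → H →ₗ.[ℂ] H)
    (U : ℝ → ℝ → H →L[ℂ] H) (W : H →L[ℂ] H) : Submodule ℂ (L2w H α) where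
  carrier := {u | u ∈ (maximalOpPlus α D A).domain ∧
    ∃ v : ℝ → H, IsW12 (fun t => U 0 t (v t)) ∧ Represents α v u ∧ v 1 = U 1 0 (W (v 0))}
  zero_mem' := by
    refine ⟨Submodule.zero_mem _, fun _ => 0, ⟨fun _ => 0, by simp, by simp⟩, ?_, by simp⟩
    filter_upwards [Lp.coeFn_zero H 2 (weightMeasure α)] with t ht
    rw [ht]
    simp
  add_mem' := by
    rintro u₁ u₂ ⟨h₁, v₁, ⟨g₁, hg₁, e₁⟩, r₁, b₁⟩ ⟨h₂, v₂, ⟨g₂, hg₂, e₂⟩, r₂, b₂⟩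
    have key : ∀ {g : ℝ → H}, MemLp g 2 (volume.restrict (Ioo (0 : ℝ) 1)) →
        ∀ t ∈ Icc (0 : ℝ) 1, IntervalIntegrable g volume 0 t := by
      intro g hg t ht
      have h := hg.integrable (by norm_num)
      rw [intervalIntegrable_iff_integrableOn_Ioo_of_le ht.1]
      exact IntegrableOn.mono_set h (Ioo_subset_Ioo_right ht.2)
    refine ⟨Submodule.add_mem _ h₁ h₂, v₁ + v₂, ⟨g₁ + g₂, hg₁.add hg₂, ?_⟩, ?_, ?_⟩
    · intro t ht
      have h1 := e₁ t ht
      have h2 := e₂ t ht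
      simp only [Pi.add_apply, map_add] at h1 h2 ⊢
      rw [intervalIntegral.integral_add (key hg₁ t ht) (key hg₂ t ht), h1, h2]
      abel
    · filter_upwards [r₁, r₂, Lp.coeFn_add u₁ u₂] with t h1 h2 h3
      rw [h3]
      simp [h1, h2]
    · simp [b₁, b₂]
  smul_mem' := by
    rintro c u ⟨h, v, ⟨g, hg, e⟩, r, b⟩
    refine ⟨Submodule.smul_mem _ c h, c • v, ⟨c • g, hg.const_smul c, ?_⟩, ?_, ?_⟩
    · intro t ht
      have h1 := e t ht
      simp only [Pi.smul_apply, map_smul] at h1 ⊢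
      rw [intervalIntegral.integral_smul, h1, smul_add]
    · filter_upwards [r, Lp.coeFn_smul c u] with t h1 h2
      rw [h2, Pi.smul_apply, Pi.smul_apply, h1, smul_comm]
    · simp [b]

/-- `L_W`: the restriction of the maximal operator `L` to those `u ∈ D(L) ∩ D(L⁺)` that satisfy
`(√α u)(1) = U(1, 0) W (√α u)(0)`. -/
def extensionOp (α : ℝ → ℝ) (D : Submodule ℂ H) (A : ℝ → H →ₗ.[ℂ] H)
    (U : ℝ → ℝ → H →L[ℂ] H) (W : H →L[ℂ] H) : L2w H α →ₗ.[ℂ] L2w H α :=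
  (maximalOp α D A).domRestrict (boundarySubmodule α D A U W)

/-- `S [D(L) ∩ D(L⁺)] ⊂ W_{2,α}^1(H, (0, 1))`, where `S` acts pointwise: `(S u)(t) = S u(t)`. -/
def MapsIntoW12w (α : ℝ → ℝ) (D : Submodule ℂ H) (A : ℝ → H →ₗ.[ℂ] H) (S : H →ₗ.[ℂ] H) : Prop :=
  ∀ u ∈ (maximalOp α D A).domain ⊓ (maximalOpPlus α D A).domain,
    ∃ w : L2w H α, MemW12w α w ∧ ∀ᵐ t ∂(weightMeasure α), (u t, w t) ∈ S.graph

end NormalExt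

end

noncomputable section
namespace NormalExt

/-! ### Singular values of compositions: the Schatten ideal property. -/

section SchattenIdeal

open Module.End
open scoped ComplexOrder

variable {E F : Type*} [NormedAddCommGroup E] [InnerProductSpace ℂ E] [CompleteSpace E]
  [NormedAddCommGroup F] [InnerProductSpace ℂ F] [CompleteSpace F]

/-! The inclusion assumed for `C^{1/2}` forces all coefficients to be bounded. Banach–Steinhaus,
applied to the functionals `u ↦ ∫ ψ' ⟨C^{1/2} e, √α u⟩` on `D(L) ∩ D(L⁺)` with the joint graph norm,
bounds them uniformly over `|ψ| ≤ 1` and `‖e‖ ≤ 1`. For `ψ = e^{int} χ` and `u = e^{int} χ f` the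
functional grows like `n |⟨C^{1/2} e, f⟩|`, while the graph norm grows at most like `n ‖f‖` up to a
constant depending on `f`. As `n → ∞` this gives `|⟨C^{1/2} e, f⟩| ≤ K ‖f‖`, so `C^{1/2}` is defined
everywhere and `D = H` (`IsPosSqrt.domain_eq_top`).

Now `C` is bounded and the `A_i(t)` are everywhere defined, symmetric and commute with `C`, so the
`U(t, s)` are unitary and commute with `C`. In the variable `y(t) = U(0, t) √α u(t)` the equation
`(L_W - λ) u = q` becomes the boundary value problem `y' = P y + U(0, t) √α q`, `y(1) = W y(0)`,
with `P = λ - C` (`exists_solution_of_resolvent`).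

Put `E = e^{-P}`, `J x = α^{-1/2} U(t, 0) e^{tP} x` and `G q = ∫ e^{-tP} U(0, t) √α q dt`; then `G J
= 1`. Duhamel's formula turns the boundary condition into `(E W - 1) y(0) = G q`. Solvability for `q
= J z` makes `E W - 1` onto, and being normal it is invertible. Two solutions with the same `q`
differ by a solution of `y' = P y`, hence, with `Qⱼ = E Wⱼ - 1`, `R₁ - R₂ = J (Q₁⁻¹ - Q₂⁻¹) G = -J
Q₁⁻¹ E (W₁ - W₂) Q₂⁻¹ G`. All factors except `W₁ - W₂` can be undone by bounded operators (`G` on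
the left and `J` on the right cancel the outer ones), so each difference is a bounded two-sided
multiple of the other, and the ideal property `Schatten.comp` gives both implications
(`schatten_resolvent_sub_iff`). -/

theorem norm_cfcAbs_apply (T : E →L[ℂ] E) (x : E) : ‖(CFC.abs T : E →L[ℂ] E) x‖ = ‖T x‖ := by
  have h : (CFC.abs T : E →L[ℂ] E) * CFC.abs T = star T * T := CFC.abs_mul_abs T
  have hs : star (CFC.abs T : E →L[ℂ] E) = CFC.abs T := (CFC.abs_nonneg T).star_eq
  have h1 : ∀ S : E →L[ℂ] E, ((‖S x‖ : ℂ)) ^ 2 = ⟪(star S * S) x, x⟫_ℂ := fun S => by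
    rw [mul_apply_eq_comp, ContinuousLinearMap.star_eq_adjoint,
      ContinuousLinearMap.adjoint_inner_left, inner_self_eq_norm_sq_to_K]
    rfl
  have h2 : ((‖(CFC.abs T : E →L[ℂ] E) x‖ : ℂ)) ^ 2 = (‖T x‖ : ℂ) ^ 2 := by
    rw [h1, h1, hs, h]
  have h3 : ‖(CFC.abs T : E →L[ℂ] E) x‖ ^ 2 = ‖T x‖ ^ 2 := by exact_mod_cast h2
  exact (sq_eq_sq₀ (norm_nonneg _) (norm_nonneg _)).1 h3

omit [CompleteSpace E] in
-- If the points `T z` form a finite ε-net of the image of the unit ball under `T`, the points `S z`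
-- do the same for `S`. This passes compactness from `T` to `|T|`.
theorem isCompactOperator_of_norm_le {T : E →L[ℂ] F} (hT : IsCompactOperator T) {S : E →L[ℂ] F}
    (h : ∀ x, ‖S x‖ ≤ ‖T x‖) : IsCompactOperator S := by
  refine (isCompactOperator_iff_isCompact_closure_image_closedBall (S : E →ₗ[ℂ] F)
    zero_lt_one).2 ?_
  have hT' := (isCompactOperator_iff_isCompact_closure_image_closedBall (T : E →ₗ[ℂ] F)
    zero_lt_one).1 hT
  have ht : TotallyBounded (T '' Metric.closedBall 0 1) :=
    hT'.totallyBounded.subset subset_closure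
  refine (TotallyBounded.closure ?_).isCompact_of_isClosed isClosed_closure
  refine Metric.totallyBounded_iff.2 fun ε hε => ?_
  obtain ⟨t, ht1, ht2, ht3⟩ := Metric.finite_approx_of_totallyBounded ht ε hε
  have hr : ∀ y, ∃ z, y ∈ t → T z = y := fun y => by
    by_cases hy : y ∈ t
    · obtain ⟨z, -, hz⟩ := ht1 hy
      exact ⟨z, fun _ => hz⟩
    · exact ⟨0, fun h => absurd h hy⟩
  choose r hr2 using hr
  refine ⟨(fun y => S (r y)) '' t, ht2.image _, ?_⟩
  rintro _ ⟨x, hx, rfl⟩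
  obtain ⟨y, hy, hxy⟩ := mem_iUnion₂.1 (ht3 ⟨x, hx, rfl⟩)
  refine mem_iUnion₂.2 ⟨S (r y), ⟨y, hy, rfl⟩, ?_⟩
  rw [Metric.mem_ball, dist_eq_norm] at hxy ⊢
  refine lt_of_le_of_lt ?_ hxy
  have := h (x - r y)
  rwa [map_sub, map_sub, hr2 y hy] at this

/-- The orthogonal complement of the eigenspaces above `ρ` is invariant. The norm of the compact
positive restriction, if it exceeded `ρ`, would be an eigenvalue above `ρ`, whose eigenvectors lie
in the space and in its complement at once. -/
theorem norm_le_of_orthogonal_eigenspace {T : E →L[ℂ] E} (hT : IsCompactOperator T)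
    (hpos : T.IsPositive) {ρ : ℝ} (hρ : 0 ≤ ρ) {y : E}
    (hy : ∀ s : ℝ, ρ < s → ∀ x ∈ eigenspace T.toLinearMap (s : ℂ), ⟪x, y⟫_ℂ = 0) :
    ‖T y‖ ≤ ρ * ‖y‖ := by
  set V : Submodule ℂ E := ⨆ s : Ioi ρ, eigenspace T.toLinearMap ((s : ℝ) : ℂ) with hV
  have hyV : y ∈ Vᗮ := by
    rw [hV, ← Submodule.iInf_orthogonal, Submodule.mem_iInf]
    exact fun s x hx => hy s s.2 x hx
  have hinv : ∀ v ∈ Vᗮ, T v ∈ Vᗮ := by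
    intro v hv
    rw [hV, ← Submodule.iInf_orthogonal, Submodule.mem_iInf] at hv ⊢
    intro s x hx
    have h1 : T x = ((s : ℝ) : ℂ) • x := mem_eigenspace_iff.1 hx
    have h2 : ⟪T x, v⟫_ℂ = ⟪x, T v⟫_ℂ := hpos.isSymmetric x v
    rw [← h2, h1, inner_smul_left, hv s x hx, mul_zero]
  let S : Vᗮ →L[ℂ] Vᗮ := T.restrict hinv
  have hSc : IsCompactOperator S := hT.restrict' hinv
  have hSs : S.IsSymmetric := hpos.isSymmetric.restrict_invariant hinv
  have hS : ‖S‖ ≤ ρ := by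
    by_contra hlt
    push Not at hlt
    have hne : Nontrivial Vᗮ := by
      by_contra hn
      rw [not_nontrivial_iff_subsingleton] at hn
      have : S = 0 := by ext x; simp [Subsingleton.elim x 0]
      simp [this] at hlt
      linarith
    obtain ⟨k, hk, hkr⟩ := spectrum.exists_nnnorm_eq_spectralRadius S
    rw [S.spectralRadius_eq_nnnorm hSs.isSelfAdjoint] at hkr
    have hkn : ‖k‖ = ‖S‖ := by
      have : ‖k‖₊ = ‖S‖₊ := by exact_mod_cast hkr
      exact congrArg NNReal.toReal this
    have hk0 : k ≠ 0 := by
      rintro rfl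
      rw [norm_zero] at hkn
      linarith
    obtain ⟨z, hz1, hz2⟩ := ((hSc.hasEigenvalue_iff_mem_spectrum hk0).2 hk).exists_hasEigenvector
    have hz3 : T z = k • (z : E) := congrArg Subtype.val (mem_eigenspace_iff.1 hz1)
    have hzn : (0 : ℝ) < ‖(z : E)‖ ^ 2 := by
      have : (z : E) ≠ 0 := by simpa using hz2
      positivity
    have hki : ⟪(z : E), T z⟫_ℂ = k * (‖(z : E)‖ : ℂ) ^ 2 := inner_product_apply_eigenvector hz3
    have h0 : (0 : ℂ) ≤ ⟪(z : E), T z⟫_ℂ := hpos.inner_nonneg_right z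
    have hk1 : 0 ≤ k := by
      rw [hki] at h0
      have : (0 : ℂ) < (‖(z : E)‖ : ℂ) ^ 2 := by exact_mod_cast hzn
      have h1 := mul_nonneg h0 (inv_nonneg.2 this.le)
      rwa [mul_assoc, mul_inv_cancel₀ this.ne', mul_one] at h1
    have hk2 : k = ((‖S‖ : ℝ) : ℂ) := by
      rw [← hkn]
      exact (Complex.norm_of_nonneg' hk1).symm
    have hzV : (z : E) ∈ V := by
      refine Submodule.mem_iSup_of_mem (⟨‖S‖, hlt⟩ : Ioi ρ) ?_
      rw [mem_eigenspace_iff, ← hk2]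
      exact hz3
    have : (z : E) = 0 := inner_self_eq_zero (𝕜 := ℂ).1 (z.2 z hzV)
    exact hzn.ne' (by rw [this]; simp)
  calc ‖T y‖ = ‖S ⟨y, hyV⟩‖ := rfl
    _ ≤ ‖S‖ * ‖(⟨y, hyV⟩ : Vᗮ)‖ := S.le_opNorm _
    _ ≤ ρ * ‖y‖ := by gcongr; rfl

theorem isPositive_cfcAbs (T : E →L[ℂ] E) : (CFC.abs T : E →L[ℂ] E).IsPositive :=
  ContinuousLinearMap.nonneg_iff_isPositive _ |>.1 (CFC.abs_nonneg T)

theorem isCompactOperator_cfcAbs {T : E →L[ℂ] E} (hT : IsCompactOperator T) :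
    IsCompactOperator (CFC.abs T : E →L[ℂ] E) :=
  isCompactOperator_of_norm_le hT fun x => (norm_cfcAbs_apply T x).le

/-- A min-max comparison of counting functions. If `|K|` had more eigenvalues in `I` than `|M|` has
in `J`, some nonzero `x` in the eigenspaces of `|K|` would have `B x` orthogonal to those of `|M|`.
Then `r ‖x‖ ≤ ‖K x‖ ≤ a (r / c) ‖B‖ ‖x‖`, which contradicts `a ‖B‖ < c`. -/
theorem sum_finrank_eigenspace_le {M : F →L[ℂ] F} {K : E →L[ℂ] E} (hM : IsCompactOperator M)
    (hK : IsCompactOperator K) (B : E →L[ℂ] F) {a c r : ℝ} (ha : 0 ≤ a) (hc : a * ‖B‖ < c)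
    (hr : 0 < r) (h : ∀ x, ‖K x‖ ≤ a * ‖M (B x)‖) (I J : Finset ℝ) (hI : ∀ s ∈ I, r ≤ s)
    (hJ0 : ∀ s ∈ J, 0 < s)
    (hJ : ∀ s : ℝ, r / c < s → s ∉ J →
      eigenspace (CFC.abs M : F →L[ℂ] F).toLinearMap (s : ℂ) = ⊥) :
    ∑ s ∈ I, Module.finrank ℂ (eigenspace (CFC.abs K : E →L[ℂ] E).toLinearMap (s : ℂ)) ≤
      ∑ s ∈ J, Module.finrank ℂ (eigenspace (CFC.abs M : F →L[ℂ] F).toLinearMap (s : ℂ)) := by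
  have hc0 : 0 < c := lt_of_le_of_lt (by positivity) hc
  set VK : I → Submodule ℂ E :=
    fun s => eigenspace (CFC.abs K : E →L[ℂ] E).toLinearMap ((s : ℝ) : ℂ) with hVK
  set VM : J → Submodule ℂ F :=
    fun s => eigenspace (CFC.abs M : F →L[ℂ] F).toLinearMap ((s : ℝ) : ℂ) with hVM
  have hKf : ∀ s : I, FiniteDimensional ℂ (VK s) := fun s =>
    ContinuousLinearMap.finite_dimensional_eigenspace (isCompactOperator_cfcAbs hK) _
      (by exact_mod_cast (lt_of_lt_of_le hr (hI s s.2)).ne')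
  have hMf : ∀ s : J, FiniteDimensional ℂ (VM s) := fun s =>
    ContinuousLinearMap.finite_dimensional_eigenspace (isCompactOperator_cfcAbs hM) _
      (by exact_mod_cast (hJ0 s s.2).ne')
  rw [← Finset.sum_coe_sort I, ← Finset.sum_coe_sort J]
  change ∑ s : I, Module.finrank ℂ (VK s) ≤ ∑ s : J, Module.finrank ℂ (VM s)
  by_contra hlt
  push Not at hlt
  let e := fun s : I => stdOrthonormalBasis ℂ (VK s)
  have horth : OrthogonalFamily ℂ (fun s : I => VK s) (fun s => (VK s).subtypeₗᵢ) :=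
    (isPositive_cfcAbs K).isSymmetric.orthogonalFamily_eigenspaces.comp
      (f := fun s : I => ((s : ℝ) : ℂ))
      (fun x y hxy => Subtype.ext (Complex.ofReal_injective hxy))
  have hon := horth.orthonormal_sigma_orthonormal (fun s => (e s).orthonormal)
  let Idx := Σ s : I, Fin (Module.finrank ℂ (VK s))
  let v : Idx → E := fun i => (VK i.1).subtypeₗᵢ (e i.1 i.2)
  have hv : Orthonormal ℂ v := hon
  let Φ : (Idx → ℂ) →ₗ[ℂ] E := Fintype.linearCombination ℂ v
  let Ψ : (Idx → ℂ) →ₗ[ℂ] (∀ s : J, VM s) :=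
    LinearMap.pi fun s => ((VM s).orthogonalProjectionOnto.comp B).toLinearMap.comp Φ
  -- `Φ` sends coefficients to vectors in the eigenspaces of `|K|`, and `Ψ` projects `B (Φ z)` to
  -- those of `|M|`; the domain of `Ψ` has the larger dimension.
  have hker : ∃ z, z ≠ 0 ∧ Ψ z = 0 := by
    have h1 : Module.finrank ℂ (∀ s : J, VM s) < Module.finrank ℂ (Idx → ℂ) := by
      rw [Module.finrank_pi_fintype, Module.finrank_fintype_fun_eq_card, Fintype.card_sigma]
      simpa using hlt
    obtain ⟨z, hz, hz0⟩ := Submodule.exists_mem_ne_zero_of_ne_bot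
      (LinearMap.ker_ne_bot_of_finrank_lt (f := Ψ) h1)
    exact ⟨z, hz0, hz⟩
  obtain ⟨z, hz0, hz⟩ := hker
  have hn1 : ‖Φ z‖ ^ 2 = ∑ i, ‖z i‖ ^ 2 := by
    have := hv.inner_sum z z Finset.univ
    rw [← Fintype.linearCombination_apply ℂ v z, inner_self_eq_norm_sq_to_K] at this
    simp_rw [Complex.conj_mul'] at this
    refine Complex.ofReal_injective (Eq.trans ?_ (this.trans ?_)) <;> push_cast <;> rfl
  have hK1 : (CFC.abs K : E →L[ℂ] E) (Φ z) = ∑ i, ((((i.1 : ℝ) : ℂ)) * z i) • v i := by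
    simp only [Φ, Fintype.linearCombination_apply, map_sum, map_smul]
    refine Finset.sum_congr rfl fun i _ => ?_
    have : (CFC.abs K : E →L[ℂ] E) (v i) = ((i.1 : ℝ) : ℂ) • v i :=
      mem_eigenspace_iff.1 (e i.1 i.2).2
    rw [this, smul_smul, mul_comm]
  have hn2 : ‖(CFC.abs K : E →L[ℂ] E) (Φ z)‖ ^ 2 = ∑ i, ‖(((i.1 : ℝ) : ℂ)) * z i‖ ^ 2 := by
    have := hv.inner_sum (fun i => (((i.1 : ℝ) : ℂ)) * z i) (fun i => (((i.1 : ℝ) : ℂ)) * z i)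
      Finset.univ
    rw [← hK1, inner_self_eq_norm_sq_to_K] at this
    simp_rw [Complex.conj_mul'] at this
    refine Complex.ofReal_injective (Eq.trans ?_ (this.trans ?_)) <;> push_cast <;> rfl
  have hpos : 0 < ‖Φ z‖ := by
    have : 0 < ∑ i, ‖z i‖ ^ 2 := by
      obtain ⟨i, hi⟩ := Function.ne_iff.1 hz0
      have hi' : z i ≠ 0 := hi
      exact Finset.sum_pos' (fun _ _ => by positivity) ⟨i, Finset.mem_univ _, by positivity⟩
    rw [← hn1] at this
    exact lt_of_le_of_ne (norm_nonneg _) fun h => by simp [← h] at this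
  have hlow : r * ‖Φ z‖ ≤ ‖K (Φ z)‖ := by
    rw [← norm_cfcAbs_apply]
    refine (sq_le_sq₀ (by positivity) (norm_nonneg _)).1 ?_
    rw [mul_pow, hn1, hn2, Finset.mul_sum]
    refine Finset.sum_le_sum fun i _ => ?_
    rw [norm_mul, mul_pow, Complex.norm_real]
    have := hI i.1 i.1.2
    have h3 : r ≤ ‖((i.1 : ℝ))‖ := this.trans (le_abs_self _)
    gcongr
  have hup : ‖M (B (Φ z))‖ ≤ r / c * ‖B (Φ z)‖ := by
    rw [← norm_cfcAbs_apply]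
    refine norm_le_of_orthogonal_eigenspace (isCompactOperator_cfcAbs hM) (isPositive_cfcAbs M)
      (by positivity) fun s hs x hx => ?_
    by_cases hsJ : s ∈ J
    · have h4 : (VM ⟨s, hsJ⟩).orthogonalProjectionOnto (B (Φ z)) = 0 := congrFun hz ⟨s, hsJ⟩
      rw [Submodule.orthogonalProjectionOnto_eq_zero_iff] at h4
      exact h4 x hx
    · rw [hJ s hs hsJ, Submodule.mem_bot] at hx
      rw [hx, inner_zero_left]
  have h5 : r * ‖Φ z‖ ≤ a * (r / c * (‖B‖ * ‖Φ z‖)) :=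
    hlow.trans ((h _).trans (by gcongr; exact hup.trans (by gcongr; exact B.le_opNorm _)))
  have h6 : a * (r / c * (‖B‖ * ‖Φ z‖)) = (a * ‖B‖) / c * (r * ‖Φ z‖) := by ring
  have h7 : (a * ‖B‖) / c < 1 := (div_lt_one hc0).2 hc
  have h8 : 0 < r * ‖Φ z‖ := by positivity
  nlinarith

/-- Layer-cake integration, `s ^ p = ∫₀ˢ p r^(p-1) dr`: the inequality between counting functions is
integrated against `p r^(p-1)`. The bound `N` lets all terms share one interval. -/
theorem sum_rpow_le_of_card_le {p : ℝ} (hp : 1 ≤ p) {c : ℝ} (hc : 0 < c) (I J : Finset ℝ)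
    (m n : ℝ → ℕ) (hI : ∀ s ∈ I, 0 < s) (hJ : ∀ s ∈ J, 0 < s)
    (h : ∀ r, 0 < r → ∑ s ∈ I with r ≤ s, m s ≤ ∑ s ∈ J with r ≤ c * s, n s) :
    ∑ s ∈ I, (m s : ℝ) * s ^ p ≤ ∑ s ∈ J, (n s : ℝ) * (c * s) ^ p := by
  obtain ⟨N, hN⟩ : ∃ N : ℝ, ∀ s ∈ I ∪ J.image (c * ·), s ≤ N := (I ∪ J.image (c * ·)).exists_le
  have hp1 : Continuous fun r : ℝ => p * r ^ (p - 1) :=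
    continuous_const.mul (continuous_id.rpow_const fun _ => Or.inr (by linarith))
  have key : ∀ s, 0 < s → s ≤ N →
      s ^ p = ∫ r in (0 : ℝ)..N, indicator {r | r ≤ s} (fun r => p * r ^ (p - 1)) r := by
    intro s hs hsN
    rw [intervalIntegral.integral_indicator ⟨hs.le, hsN⟩, intervalIntegral.integral_const_mul,
      integral_rpow (Or.inl (by linarith)), sub_add_cancel, Real.zero_rpow (by linarith)]
    field_simp
    ring
  have hint : ∀ s : ℝ, IntervalIntegrable
      (indicator {r | r ≤ s} (fun r : ℝ => p * r ^ (p - 1))) volume 0 N := fun s => by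
    have := hp1.intervalIntegrable (μ := volume) 0 N
    rw [intervalIntegrable_iff] at this ⊢
    exact this.indicator measurableSet_Iic
  by_cases hN0 : N < 0
  · have hIe : I = ∅ := Finset.eq_empty_of_forall_notMem fun s hs => by
      have := hN s (Finset.mem_union_left _ hs)
      linarith [hI s hs]
    rw [hIe, Finset.sum_empty]
    exact Finset.sum_nonneg fun s hs => by have := hJ s hs; positivity
  push Not at hN0
  have e1 : ∑ s ∈ I, (m s : ℝ) * s ^ p = ∫ r in (0 : ℝ)..N,
      ∑ s ∈ I, (m s : ℝ) * indicator {r | r ≤ s} (fun r : ℝ => p * r ^ (p - 1)) r := by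
    rw [intervalIntegral.integral_finsetSum fun s _ => (hint s).const_mul _]
    refine Finset.sum_congr rfl fun s hs => ?_
    rw [intervalIntegral.integral_const_mul, ← key s (hI s hs)
      (hN s (Finset.mem_union_left _ hs))]
  have e2 : ∑ s ∈ J, (n s : ℝ) * (c * s) ^ p = ∫ r in (0 : ℝ)..N,
      ∑ s ∈ J, (n s : ℝ) * indicator {r | r ≤ c * s} (fun r : ℝ => p * r ^ (p - 1)) r := by
    rw [intervalIntegral.integral_finsetSum fun s _ => (hint (c * s)).const_mul _]
    refine Finset.sum_congr rfl fun s hs => ?_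
    rw [intervalIntegral.integral_const_mul, ← key (c * s) (mul_pos hc (hJ s hs))
      (hN _ (Finset.mem_union_right _ (Finset.mem_image_of_mem _ hs)))]
  have e3 : ∀ (T : Finset ℝ) (k : ℝ → ℕ) (b : ℝ → ℝ) (r : ℝ),
      ∑ s ∈ T, (k s : ℝ) * indicator {r | r ≤ b s} (fun r : ℝ => p * r ^ (p - 1)) r =
        ((∑ s ∈ T with r ≤ b s, k s : ℕ) : ℝ) * (p * r ^ (p - 1)) := by
    intro T k b r
    rw [Finset.sum_filter, Nat.cast_sum, Finset.sum_mul]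
    refine Finset.sum_congr rfl fun s _ => ?_
    by_cases hrs : r ≤ b s <;> simp [hrs]
  rw [e1, e2]
  refine intervalIntegral.integral_mono_on_of_le_Ioo hN0 ?_ ?_ fun r hr => ?_
  · simpa only [Finset.sum_fn] using IntervalIntegrable.sum I fun s _ => (hint s).const_mul (m s : ℝ)
  · simpa only [Finset.sum_fn] using
      IntervalIntegrable.sum J fun s _ => (hint (c * s)).const_mul (n s : ℝ)
  · rw [e3 I m (fun s => s) r, e3 J n (fun s => c * s) r]
    have h0 : 0 ≤ p * r ^ (p - 1) := by have := hr.1; positivity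
    exact mul_le_mul_of_nonneg_right (by exact_mod_cast h r hr.1) h0

theorem Schatten.comp {p : ℝ} (hp : 1 ≤ p) {M : F →L[ℂ] F} (hM : Schatten p M)
    (A : F →L[ℂ] E) (B : E →L[ℂ] F) : Schatten p (A ∘L M ∘L B) := by
  obtain ⟨hMc, hMs⟩ := hM
  set K := A ∘L M ∘L B with hKdef
  have hKc : IsCompactOperator K := (hMc.comp_clm B).clm_comp A
  refine ⟨hKc, ?_⟩
  -- The added `1` makes `‖A‖ ‖B‖ < c` strict, as the counting lemma requires, and keeps `c`
  -- positive.
  set c := ‖A‖ * ‖B‖ + 1 with hcdef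
  have hc : 0 < c := by positivity
  set n : ℝ → ℕ := fun s =>
    Module.finrank ℂ (eigenspace (CFC.abs M : F →L[ℂ] F).toLinearMap (s : ℂ)) with hn
  set m : ℝ → ℕ := fun s =>
    Module.finrank ℂ (eigenspace (CFC.abs K : E →L[ℂ] E).toLinearMap (s : ℂ)) with hm
  change Summable fun s : Ioi (0 : ℝ) => (n s : ℝ) * (s : ℝ) ^ p at hMs
  change Summable fun s : Ioi (0 : ℝ) => (m s : ℝ) * (s : ℝ) ^ p
  have hMnn : ∀ s : Ioi (0 : ℝ), 0 ≤ (n s : ℝ) * (s : ℝ) ^ p := fun s => by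
    have : (0 : ℝ) < s := s.2
    positivity
  refine summable_of_sum_le (c := c ^ p * ∑' s : Ioi (0 : ℝ), (n s : ℝ) * (s : ℝ) ^ p)
    (fun s => by have : (0 : ℝ) < s := s.2; simp only [Pi.zero_apply]; positivity) fun I' => ?_
  rcases I'.eq_empty_or_nonempty with rfl | hne
  · rw [Finset.sum_empty]
    exact mul_nonneg (by positivity) (tsum_nonneg hMnn)
  obtain ⟨r₀, hr₀, hr₀I⟩ : ∃ r₀ : ℝ, 0 < r₀ ∧ ∀ s ∈ I', r₀ ≤ (s : ℝ) :=
    ⟨(I'.min' hne : Ioi (0 : ℝ)), (I'.min' hne).2, fun s hs => I'.min'_le s hs⟩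
  -- Each eigenvalue above `r₀ / c` contributes at least `(r₀ / c) ^ p` to a convergent sum.
  have hfin : {s : Ioi (0 : ℝ) | r₀ / c < s ∧ n s ≠ 0}.Finite := by
    have hpos : (0 : ℝ) < (r₀ / c) ^ p := by positivity
    have := hMs.tendsto_cofinite_zero.eventually_lt_const hpos
    refine this.subset ?_
    rintro s ⟨hs1, hs2⟩
    simp only [mem_compl_iff, mem_ofPred_eq, not_lt]
    have h1 : (1 : ℝ) ≤ n s := by exact_mod_cast Nat.one_le_iff_ne_zero.2 hs2
    calc (r₀ / c) ^ p ≤ (s : ℝ) ^ p := by gcongr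
      _ ≤ (n s : ℝ) * (s : ℝ) ^ p := by
        have : (0 : ℝ) < s := s.2
        exact le_mul_of_one_le_left (by positivity) h1
  let J' : Finset (Ioi (0 : ℝ)) := hfin.toFinset
  let I : Finset ℝ := I'.map (Function.Embedding.subtype _)
  let J : Finset ℝ := J'.map (Function.Embedding.subtype _)
  have hIpos : ∀ s ∈ I, 0 < s := by
    intro s hs
    obtain ⟨t, -, rfl⟩ := Finset.mem_map.1 hs
    exact t.2
  have hJpos : ∀ s ∈ J, 0 < s := by
    intro s hs
    obtain ⟨t, -, rfl⟩ := Finset.mem_map.1 hs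
    exact t.2
  have hle := sum_rpow_le_of_card_le hp hc I J m n hIpos hJpos fun r hr => by
    -- `J` contains only the eigenvalues of `|M|` above `r₀ / c`, so the threshold is raised to `max
    -- r r₀`; since `I` lies above `r₀`, no eigenvalue of `|K|` is lost.
    have hIr : ∀ s ∈ I.filter (r ≤ ·), max r r₀ ≤ s := fun s hs => by
      obtain ⟨hs1, hs2⟩ := Finset.mem_filter.1 hs
      obtain ⟨t, ht, rfl⟩ := Finset.mem_map.1 hs1
      exact max_le hs2 (hr₀I t ht)
    have := sum_finrank_eigenspace_le hMc hKc B (norm_nonneg A) (lt_add_one (‖A‖ * ‖B‖))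
      (lt_max_of_lt_left hr : 0 < max r r₀) (fun x => A.le_opNorm _) (I.filter (r ≤ ·))
      (J.filter (max r r₀ < c * ·)) hIr (fun s hs => hJpos s (Finset.mem_filter.1 hs).1) ?_
    · refine this.trans (Finset.sum_le_sum_of_subset fun s hs => ?_)
      obtain ⟨hs1, hs2⟩ := Finset.mem_filter.1 hs
      exact Finset.mem_filter.2 ⟨hs1, (le_max_left r r₀).trans hs2.le⟩
    · intro s hs hsJ
      rw [div_lt_iff₀' hc] at hs
      have hs0 : 0 < s := by
        have : 0 < c * s := (lt_max_of_lt_left hr).trans hs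
        exact (mul_pos_iff_of_pos_left hc).1 this
      have hsn : n s = 0 := by
        by_contra hns
        refine hsJ (Finset.mem_filter.2 ⟨Finset.mem_map.2 ⟨⟨s, hs0⟩, ?_, rfl⟩, hs⟩)
        rw [Set.Finite.mem_toFinset]
        exact ⟨(div_lt_iff₀' hc).2 ((le_max_right r r₀).trans_lt hs), hns⟩
      have : FiniteDimensional ℂ (eigenspace (CFC.abs M : F →L[ℂ] F).toLinearMap (s : ℂ)) :=
        ContinuousLinearMap.finite_dimensional_eigenspace (isCompactOperator_cfcAbs hMc) _
          (by exact_mod_cast hs0.ne')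
      exact Submodule.finrank_eq_zero.1 hsn
  rw [Finset.sum_map, Finset.sum_map] at hle
  refine hle.trans ?_
  calc ∑ s ∈ J', (n s : ℝ) * (c * (s : ℝ)) ^ p
      = c ^ p * ∑ s ∈ J', (n s : ℝ) * (s : ℝ) ^ p := by
        rw [Finset.mul_sum]
        refine Finset.sum_congr rfl fun s _ => ?_
        rw [Real.mul_rpow hc.le (le_of_lt s.2)]
        ring
    _ ≤ _ := by
        gcongr
        exact hMs.sum_le_tsum _ fun s _ => hMnn s

end SchattenIdeal

/-! ### The weight, its null sets, and test functions away from its zeros. -/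

section Weight

variable {H : Type*} [NormedAddCommGroup H] [InnerProductSpace ℂ H] {α : ℝ → ℝ}

/-- The set of interior points at which the weight is positive. -/
def posSet (α : ℝ → ℝ) : Set ℝ := {t | t ∈ Ioo (0 : ℝ) 1 ∧ 0 < α t}

theorem posSet_subset : posSet α ⊆ Ioo 0 1 := fun _ h => h.1

namespace IsWeight

variable (hα : IsWeight α)
include hα

theorem continuousOn : ContinuousOn α (Icc 0 1) := hα.contDiffOn.continuousOn

theorem continuousOn_derivWithin : ContinuousOn (derivWithin α (Icc 0 1)) (Icc 0 1) :=
  hα.contDiffOn.continuousOn_derivWithin (uniqueDiffOn_Icc zero_lt_one) (by norm_num)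

omit hα in
theorem derivWithin_eq {t : ℝ} (ht : t ∈ Ioo (0 : ℝ) 1) :
    derivWithin α (Icc 0 1) t = deriv α t :=
  derivWithin_of_mem_nhds (Icc_mem_nhds ht.1 ht.2)

theorem hasDerivAt {t : ℝ} (ht : t ∈ Ioo (0 : ℝ) 1) : HasDerivAt α (deriv α t) t :=
  ((hα.contDiffOn.contDiffAt (Icc_mem_nhds ht.1 ht.2)).differentiableAt (by norm_num)).hasDerivAt

theorem continuousOn_deriv : ContinuousOn (deriv α) (Ioo 0 1) :=
  (hα.continuousOn_derivWithin.mono Ioo_subset_Icc_self).congr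
    fun _ ht => (derivWithin_eq ht).symm

theorem isOpen_posSet : IsOpen (posSet α) :=
  (hα.continuousOn.mono Ioo_subset_Icc_self).isOpen_inter_preimage isOpen_Ioo isOpen_Ioi

theorem ae_pos : ∀ᵐ t ∂(volume.restrict (Ioo (0 : ℝ) 1)), 0 < α t := by
  rw [ae_restrict_iff' measurableSet_Ioo]
  have h := measure_eq_zero_iff_ae_notMem.1 hα.null_zeros
  filter_upwards [h] with t ht ht1
  have h0 := hα.nonneg t (Ioo_subset_Icc_self ht1)
  exact lt_of_le_of_ne h0 fun he => ht ⟨Ioo_subset_Icc_self ht1, he.symm⟩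

theorem ae_mem_posSet : ∀ᵐ t ∂(volume.restrict (Ioo (0 : ℝ) 1)), t ∈ posSet α := by
  filter_upwards [hα.ae_pos, ae_restrict_mem measurableSet_Ioo] with t h1 h2 using ⟨h2, h1⟩

theorem aemeasurable :
    AEMeasurable (fun t => ENNReal.ofReal (α t)) (volume.restrict (Ioo (0 : ℝ) 1)) :=
  ((hα.continuousOn.mono Ioo_subset_Icc_self).aemeasurable measurableSet_Ioo).ennreal_ofReal

theorem ae_iff {P : ℝ → Prop} :
    (∀ᵐ t ∂(weightMeasure α), P t) ↔ ∀ᵐ t ∂(volume.restrict (Ioo (0 : ℝ) 1)), P t := by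
  rw [weightMeasure, ae_withDensity_iff' hα.aemeasurable]
  refine Filter.eventually_congr ?_
  filter_upwards [hα.ae_pos] with t ht
  simp [ht]

theorem absolutelyContinuous : volume.restrict (Ioo (0 : ℝ) 1) ≪ weightMeasure α := by
  refine Measure.AbsolutelyContinuous.mk fun s _ hs => ?_
  rw [measure_eq_zero_iff_ae_notMem] at hs ⊢
  exact hα.ae_iff.1 hs

omit hα in
theorem weightMeasure_absolutelyContinuous :
    weightMeasure α ≪ volume.restrict (Ioo (0 : ℝ) 1) :=
  withDensity_absolutelyContinuous _ _

theorem exists_le : ∃ K, 0 < K ∧ ∀ t ∈ Icc (0 : ℝ) 1, α t ≤ K := by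
  obtain ⟨K, hK⟩ := isCompact_Icc.bddAbove_image hα.continuousOn
  exact ⟨max K 1, by positivity, fun t ht => (hK ⟨t, ht, rfl⟩).trans (le_max_left _ _)⟩

theorem isFiniteMeasure : IsFiniteMeasure (weightMeasure α) := by
  obtain ⟨K, -, hK⟩ := hα.exists_le
  refine isFiniteMeasure_withDensity (ne_of_lt ?_)
  calc ∫⁻ t in Ioo (0 : ℝ) 1, ENNReal.ofReal (α t) ≤ ∫⁻ t in Ioo (0 : ℝ) 1, ENNReal.ofReal K :=
        setLIntegral_mono measurable_const fun t ht =>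
          ENNReal.ofReal_le_ofReal (hK t (Ioo_subset_Icc_self ht))
    _ < (⊤ : ℝ≥0∞) := by simp

theorem integral_weightMeasure {G : Type*} [NormedAddCommGroup G] [NormedSpace ℝ G] (g : ℝ → G) :
    ∫ t, g t ∂(weightMeasure α) = ∫ t in Ioo (0 : ℝ) 1, α t • g t := by
  rw [weightMeasure, integral_withDensity_eq_integral_toReal_smul₀ hα.aemeasurable (by simp)]
  refine integral_congr_ae ?_
  filter_upwards [hα.ae_pos] with t ht
  rw [ENNReal.toReal_ofReal ht.le]

theorem integrable_weightMeasure_iff {G : Type*} [NormedAddCommGroup G] [NormedSpace ℝ G]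
    (g : ℝ → G) : Integrable g (weightMeasure α) ↔
      IntegrableOn (fun t => α t • g t) (Ioo (0 : ℝ) 1) := by
  rw [weightMeasure, integrable_withDensity_iff_integrable_smul₀' hα.aemeasurable (by simp),
    IntegrableOn]
  refine integrable_congr ?_
  filter_upwards [hα.ae_pos] with t ht
  rw [ENNReal.toReal_ofReal ht.le]

theorem memLp_of_continuousOn {G : Type*} [NormedAddCommGroup G] {F : ℝ → G} (hF : ContinuousOn F (Icc 0 1)) :
    MemLp F 2 (weightMeasure α) := by
  have := hα.isFiniteMeasure
  obtain ⟨K, hK⟩ := isCompact_Icc.exists_bound_of_continuousOn hF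
  refine MemLp.of_bound (C := K) ?_ ?_
  · exact ((hF.mono Ioo_subset_Icc_self).aestronglyMeasurable measurableSet_Ioo).mono_ac
      weightMeasure_absolutelyContinuous
  · rw [hα.ae_iff, ae_restrict_iff' measurableSet_Ioo]
    exact ae_of_all _ fun t ht => hK t (Ioo_subset_Icc_self ht)

/-- A product with a function that is continuous near the support of the other one. -/
theorem continuous_mul {φ h : ℝ → ℂ} (hφ : Continuous φ) (hs : tsupport φ ⊆ posSet α)
    (hh : ContinuousOn h (posSet α)) : Continuous fun t => h t * φ t := by
  refine continuous_of_tsupport fun t ht => ?_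
  have : t ∈ posSet α := hs (tsupport_mul_subset_right ht)
  exact (hh.continuousAt (hα.isOpen_posSet.mem_nhds this)).mul hφ.continuousAt

theorem continuousOn_logDeriv :
    ContinuousOn (fun t => ((deriv α t / (2 * α t) : ℝ) : ℂ)) (posSet α) := by
  refine Complex.continuous_ofReal.comp_continuousOn ?_
  refine (hα.continuousOn_deriv.mono posSet_subset).div
    (continuousOn_const.mul (hα.continuousOn.mono (posSet_subset.trans Ioo_subset_Icc_self))) ?_
  intro t ht
  have := ht.2
  positivity

/-- An element of `L²_α` is zero if it is orthogonal to all `φ f` with `φ` supported where the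
weight is positive. -/
theorem eq_zero_of_integral_eq_zero [CompleteSpace H] {D : Submodule ℂ H} (hD : Dense (D : Set H))
    (q : L2w H α)
    (h : ∀ φ : ℝ → ℂ, IsTestFunction φ → tsupport φ ⊆ posSet α → ∀ f ∈ D,
      ∫ t, ⟪φ t • f, q t⟫_ℂ ∂(weightMeasure α) = 0) : q = 0 := by
  have := hα.isFiniteMeasure
  have hq : Integrable q (weightMeasure α) := (Lp.memLp q).integrable (by norm_num)
  have hq' := (hα.integrable_weightMeasure_iff _).1 hq
  have key := hα.isOpen_posSet.ae_eq_zero_of_integral_contDiff_smul_eq_zero (μ := volume)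
    (f := fun t => α t • q t) (hq'.mono_set posSet_subset).locallyIntegrableOn ?_
  · refine Lp.ext ?_
    filter_upwards [hα.ae_iff.2 hα.ae_mem_posSet, hα.ae_iff.2 (ae_restrict_of_ae key),
      Lp.coeFn_zero H 2 (weightMeasure α)] with t h1 h2 h3
    rw [h3]
    exact (smul_eq_zero.1 (h2 h1)).resolve_left h1.2.ne'
  · intro g hg hgc hgs
    have hint : Integrable (fun t => g t • q t) (weightMeasure α) := by
      obtain ⟨K, hK⟩ := hgc.exists_bound_of_continuous hg.continuous
      exact hq.bdd_smul (𝕜 := ℝ) (φ := g) K hg.continuous.aestronglyMeasurable (ae_of_all _ hK)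
    have e1 : ∫ t, g t • α t • q t = ∫ t, g t • q t ∂(weightMeasure α) := by
      rw [hα.integral_weightMeasure, ← integral_indicator measurableSet_Ioo]
      refine integral_congr_ae (ae_of_all _ fun t => ?_)
      by_cases ht : t ∈ Ioo (0 : ℝ) 1
      · simp only [ht, indicator_of_mem]
        rw [smul_comm]
      · have : g t = 0 := image_eq_zero_of_notMem_tsupport fun h' => ht (hgs h').1
        simp [this, indicator_of_notMem ht]
    rw [e1]
    refine hD.eq_zero_of_inner_right ℂ fun f hf => ?_
    rw [← integral_inner hint]
    have hts : tsupport (fun t => (g t : ℂ)) ⊆ tsupport g :=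
      closure_mono fun t ht h0 => ht (by simp [h0])
    have := h (fun t => (g t : ℂ)) ⟨Complex.ofRealCLM.contDiff.comp hg,
      hgc.comp_left (g := ((↑) : ℝ → ℂ)) Complex.ofReal_zero,
      hts.trans (hgs.trans posSet_subset)⟩ (hts.trans hgs) f hf
    rw [← this]
    refine integral_congr_ae (ae_of_all _ fun t => ?_)
    simp only [inner_smul_left, Complex.conj_ofReal]
    rw [RCLike.real_smul_eq_coe_smul (K := ℂ), inner_smul_right]
    rfl

end IsWeight

end Weight

/-! ### Lagrange's identity and the adjoints of the minimal operators. -/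

section FormalExpression

variable {H : Type*} [NormedAddCommGroup H] [InnerProductSpace ℂ H] {α : ℝ → ℝ}

/-- `φ f ↦ ε (φ' + α' φ / (2 α)) f + φ (C f + ε i A_i(t) f)`; for `ε = 1` this is `l(φ f)` and for
`ε = -1` it is `l⁺(φ f)`. -/
def formalExpr (α : ℝ → ℝ) (ε : ℝ) (φ : ℝ → ℂ) (f c : H) (a : ℝ → H) (t : ℝ) : H :=
  ((ε : ℂ) * (deriv φ t + ((deriv α t / (2 * α t) : ℝ) : ℂ) * φ t)) • f +
    φ t • (c + ((ε : ℂ) * Complex.I) • a t)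

/-- The span of the pairs `(φ f, l(φ f))`, or `(φ f, l⁺(φ f))`. -/
def formalGraph (α : ℝ → ℝ) (D : Submodule ℂ H) (c : H → H) (a : H → ℝ → H) (ε : ℝ) :
    Submodule ℂ (L2w H α × L2w H α) :=
  Submodule.span ℂ {q | ∃ (φ : ℝ → ℂ) (f : H), IsTestFunction φ ∧ f ∈ D ∧
    (∀ᵐ t ∂(weightMeasure α), q.1 t = φ t • f) ∧
    (∀ᵐ t ∂(weightMeasure α), q.2 t = formalExpr α ε φ f (c f) (a f) t)}

/-- The symmetry and continuity of the coefficients `C` and `A_i(t)` on `D`. -/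
structure IsFormalCoefficient (D : Submodule ℂ H) (c : H → H) (a : H → ℝ → H) : Prop where
  dense : Dense (D : Set H)
  symm : ∀ f ∈ D, ∀ g ∈ D, ⟪c f, g⟫_ℂ = ⟪f, c g⟫_ℂ
  im_symm : ∀ f ∈ D, ∀ g ∈ D, ∀ t ∈ Icc (0 : ℝ) 1, ⟪a f t, g⟫_ℂ = ⟪f, a g t⟫_ℂ
  im_continuousOn : ∀ f ∈ D, ContinuousOn (a f) (Icc 0 1)

variable {D : Submodule ℂ H} {c : H → H} {a : H → ℝ → H}

theorem IsTestFunction.continuous {φ : ℝ → ℂ} (h : IsTestFunction φ) : Continuous φ :=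
  h.contDiff.continuous

theorem IsTestFunction.hasDerivAt {φ : ℝ → ℂ} (h : IsTestFunction φ) (t : ℝ) :
    HasDerivAt φ (deriv φ t) t :=
  (h.contDiff.differentiable (by simp) t).hasDerivAt

theorem IsTestFunction.continuous_deriv {φ : ℝ → ℂ} (h : IsTestFunction φ) :
    Continuous (deriv φ) :=
  h.contDiff.continuous_deriv (by simp)

theorem IsTestFunction.eq_zero {φ : ℝ → ℂ} (h : IsTestFunction φ) {t : ℝ}
    (ht : t ∉ Ioo (0 : ℝ) 1) : φ t = 0 :=
  image_eq_zero_of_notMem_tsupport fun h' => ht (h.tsupport_subset h')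

/-- `α' / (2 α)` may blow up at zeros of `α`; the support condition keeps `φ` away from them, so
that `l(φ f)` and `l⁺(φ f)` really belong to `L²_α`. -/
theorem continuousOn_formalExpr (hα : IsWeight α) {φ : ℝ → ℂ} (hφ : IsTestFunction φ)
    (hs : tsupport φ ⊆ posSet α) (ε : ℝ) (f k : H) {b : ℝ → H} (hb : ContinuousOn b (Icc 0 1)) :
    ContinuousOn (formalExpr α ε φ f k b) (Icc 0 1) := by
  have h1 := hα.continuous_mul hφ.continuous hs hα.continuousOn_logDeriv
  have h2 := hφ.continuous_deriv
  have h3 := hφ.continuous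
  unfold formalExpr
  exact ((continuous_const.mul (h2.add h1)).continuousOn.smul continuousOn_const).add
    (h3.continuousOn.smul (continuousOn_const.add (hb.const_smul _)))

/-- The element `φ f` of `L²_α`. -/
def testElement (hα : IsWeight α) {φ : ℝ → ℂ} (hφ : IsTestFunction φ) (f : H) : L2w H α :=
  (hα.memLp_of_continuousOn (F := fun t => φ t • f)
    (hφ.continuous.continuousOn.smul continuousOn_const)).toLp

/-- The element `l(φ f)`, or `l⁺(φ f)`, for `φ` supported where the weight is positive. -/
def testImage (hα : IsWeight α) {φ : ℝ → ℂ} (hφ : IsTestFunction φ) (hs : tsupport φ ⊆ posSet α)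
    (ε : ℝ) (f k : H) {b : ℝ → H} (hb : ContinuousOn b (Icc 0 1)) : L2w H α :=
  (hα.memLp_of_continuousOn (continuousOn_formalExpr hα hφ hs ε f k hb)).toLp

theorem testElement_ae (hα : IsWeight α) {φ : ℝ → ℂ} (hφ : IsTestFunction φ) (f : H) :
    ∀ᵐ t ∂(weightMeasure α), testElement hα hφ f t = φ t • f :=
  MemLp.coeFn_toLp _

theorem testImage_ae (hα : IsWeight α) {φ : ℝ → ℂ} (hφ : IsTestFunction φ)
    (hs : tsupport φ ⊆ posSet α) (ε : ℝ) (f k : H) {b : ℝ → H} (hb : ContinuousOn b (Icc 0 1)) :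
    ∀ᵐ t ∂(weightMeasure α), testImage hα hφ hs ε f k hb t = formalExpr α ε φ f k b t :=
  MemLp.coeFn_toLp _

/-- The integrand is the derivative of `α ψ̄ φ`, which vanishes at both ends. -/
theorem integral_deriv_mul_eq_zero (hα : IsWeight α) {φ ψ : ℝ → ℂ} (hφ : IsTestFunction φ)
    (hψ : IsTestFunction ψ) :
    ∫ t in Ioo (0 : ℝ) 1, (((deriv α t : ℝ) : ℂ) * (starRingEnd ℂ (ψ t) * φ t) +
      (α t : ℂ) * (starRingEnd ℂ (deriv ψ t) * φ t + starRingEnd ℂ (ψ t) * deriv φ t)) = 0 := by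
  have hd : ∀ t ∈ Ioo (0 : ℝ) 1, HasDerivAt (fun t => (α t : ℂ) * (starRingEnd ℂ (ψ t) * φ t))
      (((deriv α t : ℝ) : ℂ) * (starRingEnd ℂ (ψ t) * φ t) +
      (α t : ℂ) * (starRingEnd ℂ (deriv ψ t) * φ t + starRingEnd ℂ (ψ t) * deriv φ t)) t :=
    fun t ht => (hα.hasDerivAt ht).ofReal_comp.mul ((hψ.hasDerivAt t).star.mul (hφ.hasDerivAt t))
  have hc : ContinuousOn (fun t => (α t : ℂ) * (starRingEnd ℂ (ψ t) * φ t)) (Icc 0 1) :=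
    (Complex.continuous_ofReal.comp_continuousOn hα.continuousOn).mul
      ((Complex.continuous_conj.comp hψ.continuous).mul hφ.continuous).continuousOn
  have hi : IntervalIntegrable (fun t => ((deriv α t : ℝ) : ℂ) * (starRingEnd ℂ (ψ t) * φ t) +
      (α t : ℂ) * (starRingEnd ℂ (deriv ψ t) * φ t + starRingEnd ℂ (ψ t) * deriv φ t))
      volume 0 1 := by
    rw [intervalIntegrable_iff_integrableOn_Ioo_of_le zero_le_one]
    have hc' : ContinuousOn (fun t => ((derivWithin α (Icc 0 1) t : ℝ) : ℂ) *
        (starRingEnd ℂ (ψ t) * φ t) + (α t : ℂ) *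
        (starRingEnd ℂ (deriv ψ t) * φ t + starRingEnd ℂ (ψ t) * deriv φ t)) (Icc 0 1) := by
      have c1 := Complex.continuous_conj.comp hψ.continuous
      have c2 := Complex.continuous_conj.comp hψ.continuous_deriv
      exact ((Complex.continuous_ofReal.comp_continuousOn hα.continuousOn_derivWithin).mul
        (c1.mul hφ.continuous).continuousOn).add
        ((Complex.continuous_ofReal.comp_continuousOn hα.continuousOn).mul
        ((c2.mul hφ.continuous).add (c1.mul hφ.continuous_deriv)).continuousOn)
    refine ((hc'.integrableOn_Icc).mono_set Ioo_subset_Icc_self).congr_fun ?_ measurableSet_Ioo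
    intro t ht
    simp only [IsWeight.derivWithin_eq ht]
  have := intervalIntegral.integral_eq_sub_of_hasDerivAt_of_le zero_le_one hc hd hi
  rw [intervalIntegral.integral_of_le zero_le_one, integral_Ioc_eq_integral_Ioo] at this
  rw [this, hφ.eq_zero (t := 0) (by simp), hφ.eq_zero (t := 1) (by simp)]
  simp

/-- Lagrange's identity between `l` and `l⁺`: the `C` and `A_i` terms cancel by symmetry, and what
remains is `ε ⟨g, f⟩` times the derivative of `α ψ̄ φ`. Only `φ` needs support away from the zeros
of `α`; the pairs in the formal graph may come from any test function. -/
theorem inner_testElement_eq [CompleteSpace H] (hα : IsWeight α) (hc : IsFormalCoefficient D c a)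
    {ε : ℝ} {q : L2w H α × L2w H α} (hq : q ∈ formalGraph α D c a ε) {φ : ℝ → ℂ}
    (hφ : IsTestFunction φ) (hs : tsupport φ ⊆ posSet α) {f : H} (hf : f ∈ D) :
    ⟪q.2, testElement hα hφ f⟫_ℂ =
      ⟪q.1, testImage hα hφ hs (-ε) f (c f) (hc.im_continuousOn f hf)⟫_ℂ := by
  induction hq using Submodule.span_induction with
  | zero => simp
  | add x y _ _ hx hy => simp only [Prod.fst_add, Prod.snd_add, inner_add_left, hx, hy]
  | smul r x _ hx => simp only [Prod.smul_fst, Prod.smul_snd, inner_smul_left, hx]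
  | mem q hq =>
    obtain ⟨ψ, g, hψ, hg, hq1, hq2⟩ := hq
    rw [← sub_eq_zero, L2.inner_def, L2.inner_def,
      ← integral_sub (L2.integrable_inner _ _) (L2.integrable_inner _ _),
      hα.integral_weightMeasure]
    have hz := integral_deriv_mul_eq_zero hα hφ hψ
    rw [← mul_zero ((ε : ℂ) * ⟪g, f⟫_ℂ), ← hz, ← integral_const_mul]
    refine integral_congr_ae ?_
    filter_upwards [hα.ae_iff.1 hq1, hα.ae_iff.1 hq2, hα.ae_iff.1 (testElement_ae hα hφ f),
      hα.ae_iff.1 (testImage_ae hα hφ hs (-ε) f (c f) (hc.im_continuousOn f hf)),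
      hα.ae_mem_posSet] with t h1 h2 h3 h4 h5
    have ht := Ioo_subset_Icc_self h5.1
    have h0 : (α t : ℂ) ≠ 0 := by exact_mod_cast h5.2.ne'
    have hcs := hc.symm g hg f hf
    have has := hc.im_symm g hg f hf t ht
    rw [h1, h2, h3, h4]
    simp only [formalExpr, inner_smul_left, inner_smul_right, inner_add_left, inner_add_right,
      map_add, map_mul, Complex.conj_ofReal, Complex.conj_I, hcs, has, Complex.real_smul]
    push_cast
    field_simp
    ring

theorem testElement_mem (hα : IsWeight α) (hc : IsFormalCoefficient D c a) (ε : ℝ) {φ : ℝ → ℂ}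
    (hφ : IsTestFunction φ) (hs : tsupport φ ⊆ posSet α) {f : H} (hf : f ∈ D) :
    (testElement hα hφ f, testImage hα hφ hs ε f (c f) (hc.im_continuousOn f hf)) ∈
      formalGraph α D c a ε :=
  Submodule.subset_span ⟨φ, f, hφ, hf, testElement_ae hα hφ f, 
    testImage_ae hα hφ hs ε f (c f) (hc.im_continuousOn f hf)⟩

theorem eq_zero_of_inner_testElement [CompleteSpace H] (hα : IsWeight α) (hD : Dense (D : Set H))
    (q : L2w H α)
    (h : ∀ φ : ℝ → ℂ, ∀ hφ : IsTestFunction φ, tsupport φ ⊆ posSet α → ∀ f ∈ D,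
      ⟪testElement hα hφ f, q⟫_ℂ = 0) : q = 0 := by
  refine hα.eq_zero_of_integral_eq_zero hD q fun φ hφ hs f hf => ?_
  rw [← h φ hφ hs f hf, L2.inner_def]
  refine integral_congr_ae ?_
  filter_upwards [testElement_ae hα hφ f] with t ht
  rw [ht]

variable [CompleteSpace H]

/-- By Lagrange's identity the second component is orthogonal to a total set once the first is zero.
Hence `toLinearPMap` has exactly the formal graph as its graph. -/
theorem formalGraph_single_valued (hα : IsWeight α) (hc : IsFormalCoefficient D c a) {ε : ℝ}
    (q : L2w H α × L2w H α) (hq : q ∈ formalGraph α D c a ε) (h0 : q.1 = 0) : q.2 = 0 := by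
  refine eq_zero_of_inner_testElement hα hc.dense _ fun φ hφ hs f hf => ?_
  rw [inner_eq_zero_symm, inner_testElement_eq hα hc hq hφ hs hf, h0, inner_zero_left]

theorem graph_toLinearPMap_formalGraph (hα : IsWeight α) (hc : IsFormalCoefficient D c a)
    (ε : ℝ) : (formalGraph α D c a ε).toLinearPMap.graph = formalGraph α D c a ε :=
  Submodule.toLinearPMap_graph_eq _ fun q hq h0 => formalGraph_single_valued hα hc q hq h0

theorem formalGraph_le_graph_closure (hα : IsWeight α) (hc : IsFormalCoefficient D c a)
    (ε : ℝ) : formalGraph α D c a ε ≤ (formalGraph α D c a ε).toLinearPMap.closure.graph := by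
  conv_lhs => rw [← graph_toLinearPMap_formalGraph hα hc ε]
  exact LinearPMap.le_graph_of_le (LinearPMap.le_closure _)

theorem graph_closure_le_topologicalClosure (hα : IsWeight α) (hc : IsFormalCoefficient D c a)
    (ε : ℝ) : (formalGraph α D c a ε).toLinearPMap.closure.graph ≤
      (formalGraph α D c a ε).topologicalClosure := by
  by_cases h : (formalGraph α D c a ε).toLinearPMap.IsClosable
  · rw [← h.graph_closure_eq_closure_graph, graph_toLinearPMap_formalGraph hα hc ε]
  -- For a non-closable operator `closure` is by convention the operator itself, so closability need
  -- not be settled.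
  · rw [LinearPMap.closure_def' h, graph_toLinearPMap_formalGraph hα hc ε]
    exact Submodule.le_topologicalClosure _

theorem dense_domain_closure (hα : IsWeight α) (hc : IsFormalCoefficient D c a) (ε : ℝ) :
    Dense ((formalGraph α D c a ε).toLinearPMap.closure.domain : Set (L2w H α)) := by
  rw [Submodule.dense_iff_topologicalClosure_eq_top, Submodule.topologicalClosure_eq_top_iff,
    Submodule.eq_bot_iff]
  intro q hq
  refine eq_zero_of_inner_testElement hα hc.dense _ fun φ hφ hs f hf => ?_
  refine hq _ ?_
  exact LinearPMap.mem_domain_of_mem_graph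
    (formalGraph_le_graph_closure hα hc ε (testElement_mem hα hc ε hφ hs hf))

/-- Testing on the generators suffices because the defining identity of the adjoint is a closed
condition on the pair `q`. -/
theorem mem_graph_adjoint_closure_iff (hα : IsWeight α) (hc : IsFormalCoefficient D c a) (ε : ℝ)
    (u h : L2w H α) : (u, h) ∈ (formalGraph α D c a ε).toLinearPMap.closure.adjoint.graph ↔
      ∀ q ∈ formalGraph α D c a ε, ⟪q.2, u⟫_ℂ = ⟪q.1, h⟫_ℂ := by
  rw [LinearPMap.adjoint_graph_eq_graph_adjoint (dense_domain_closure hα hc ε),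
    Submodule.mem_adjoint_iff]
  constructor
  · intro hu q hq
    exact sub_eq_zero.1 (hu q.1 q.2 (formalGraph_le_graph_closure hα hc ε hq))
  · intro hu x y hxy
    rw [sub_eq_zero]
    have hcl : IsClosed {q : L2w H α × L2w H α | ⟪q.2, u⟫_ℂ = ⟪q.1, h⟫_ℂ} :=
      isClosed_eq (by fun_prop) (by fun_prop)
    have := closure_minimal (s := (formalGraph α D c a ε : Set (L2w H α × L2w H α))) hu hcl
    exact this (graph_closure_le_topologicalClosure hα hc ε hxy)

theorem testElement_mem_graph_adjoint (hα : IsWeight α) (hc : IsFormalCoefficient D c a) (ε : ℝ)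
    {φ : ℝ → ℂ} (hφ : IsTestFunction φ) (hs : tsupport φ ⊆ posSet α) {f : H} (hf : f ∈ D) :
    (testElement hα hφ f, testImage hα hφ hs (-ε) f (c f) (hc.im_continuousOn f hf)) ∈
      (formalGraph α D c a ε).toLinearPMap.closure.adjoint.graph :=
  (mem_graph_adjoint_closure_iff hα hc ε _ _).2 fun _ hq =>
    inner_testElement_eq hα hc hq hφ hs hf

end FormalExpression

/-! ### From `A(t)` to `C` and `A_i(t)`. -/

section Coefficient

variable {H : Type*} [NormedAddCommGroup H] [InnerProductSpace ℂ H] [CompleteSpace H] {α : ℝ → ℝ}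
  {D : Submodule ℂ H} {A Ar Ai : ℝ → H →ₗ.[ℂ] H} {C : H →ₗ.[ℂ] H}

omit [CompleteSpace H] in
theorem mem_graph_smul_id_add (z : ℂ) (T : H →ₗ.[ℂ] H) (f k : H) :
    (f, k) ∈ (z • everywhere (ContinuousLinearMap.id ℂ H) + T).graph ↔ (f, k - z • f) ∈ T.graph := by
  rw [LinearPMap.mem_graph_iff, LinearPMap.mem_graph_iff]
  constructor
  · rintro ⟨x, rfl, hx⟩
    refine ⟨⟨x, x.2.2⟩, rfl, ?_⟩
    have hx' : z • (x : H) + T ⟨x, x.2.2⟩ = k := hx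
    change T ⟨x, x.2.2⟩ = k - z • (x : H)
    rw [← hx']
    abel
  · rintro ⟨x, rfl, hx⟩
    refine ⟨⟨x, Submodule.mem_top, x.2⟩, rfl, ?_⟩
    change z • (x : H) + T x = k
    rw [hx]
    exact add_sub_cancel (z • (x : H)) k

omit [CompleteSpace H] in
theorem mem_graph_add_smul (z : ℂ) (S T : H →ₗ.[ℂ] H) {f k l : H} (hS : (f, k) ∈ S.graph)
    (hT : (f, l) ∈ T.graph) : (f, k + z • l) ∈ (S + z • T).graph := by
  simp only [LinearPMap.mem_graph_iff] at hS hT ⊢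
  obtain ⟨x, hx, rfl⟩ := hS
  obtain ⟨y, hy, rfl⟩ := hT
  obtain rfl : (x : H) = f := hx
  refine ⟨⟨x, x.2, ?_⟩, rfl, ?_⟩
  · have := y.2; rw [hy] at this; exact this
  · simp only [LinearPMap.add_apply, LinearPMap.smul_apply]
    congr 3
    exact Subtype.ext hy.symm

theorem inner_eq_of_isSelfAdjoint {T : H →ₗ.[ℂ] H} (hT : IsSelfAdjoint T) {f k g l : H}
    (hf : (f, k) ∈ T.graph) (hg : (g, l) ∈ T.graph) : ⟪k, g⟫_ℂ = ⟪f, l⟫_ℂ := by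
  have h1 : (g, l) ∈ T.adjoint.graph := by rwa [LinearPMap.isSelfAdjoint_def.1 hT]
  rw [LinearPMap.adjoint_graph_eq_graph_adjoint hT.dense_domain, Submodule.mem_adjoint_iff] at h1
  exact sub_eq_zero.1 (h1 f k hf)

namespace IsCoefficient

variable (hA : IsCoefficient α D A Ar Ai C)
include hA

theorem exists_re_eq : ∃ t ∈ Icc (0 : ℝ) 1,
    Ar t = ((deriv α t / (2 * α t) : ℝ) : ℂ) • everywhere (ContinuousLinearMap.id ℂ H) + C := by
  have : (volume.restrict (Ioo (0 : ℝ) 1)) ≠ 0 := by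
    rw [Ne, Measure.restrict_eq_zero]
    simp
  have := ae_neBot.2 this
  obtain ⟨t, h1, h2⟩ := (hA.re_eq.and (ae_restrict_mem measurableSet_Ioo)).exists
  exact ⟨t, Ioo_subset_Icc_self h2, h1⟩

theorem domain_eq : C.domain = D := by
  obtain ⟨t, ht, he⟩ := hA.exists_re_eq
  have h1 := hA.re_domain t ht
  rw [he] at h1
  rw [← h1]
  change C.domain = (⊤ : Submodule ℂ H) ⊓ C.domain
  rw [top_inf_eq]

/-- At one suitable `t`, `C` is the self-adjoint `A_r(t)` minus a real multiple of the identity, so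
it is symmetric. -/
theorem inner_graph_eq {f k g l : H} (hf : (f, k) ∈ C.graph) (hg : (g, l) ∈ C.graph) :
    ⟪k, g⟫_ℂ = ⟪f, l⟫_ℂ := by
  obtain ⟨t, ht, he⟩ := hA.exists_re_eq
  set z : ℝ := deriv α t / (2 * α t)
  have h1 : (f, k + (z : ℂ) • f) ∈ (Ar t).graph := by
    rw [he, mem_graph_smul_id_add]
    simpa using hf
  have h2 : (g, l + (z : ℂ) • g) ∈ (Ar t).graph := by
    rw [he, mem_graph_smul_id_add]
    simpa using hg
  have := inner_eq_of_isSelfAdjoint (hA.re_selfAdjoint t ht) h1 h2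
  simpa [inner_add_left, inner_add_right, inner_smul_left, inner_smul_right] using this

theorem exists_formalCoefficient : ∃ (c : H → H) (a : H → ℝ → H),
    (∀ f ∈ D, (f, c f) ∈ C.graph) ∧
    (∀ f ∈ D, ∀ t ∈ Icc (0 : ℝ) 1, (f, a f t) ∈ (Ai t).graph) ∧
    IsFormalCoefficient D c a := by
  have h1 : ∀ f, ∃ k, f ∈ D → (f, k) ∈ C.graph := fun f => by
    by_cases hf : f ∈ D
    · rw [← hA.domain_eq] at hf
      exact ⟨C ⟨f, hf⟩, fun _ => C.mem_graph ⟨f, hf⟩⟩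
    · exact ⟨0, fun h => absurd h hf⟩
  have h2 : ∀ f, ∃ a : ℝ → H, f ∈ D → ContinuousOn a (Icc 0 1) ∧
      ∀ t ∈ Icc (0 : ℝ) 1, (f, a t) ∈ (Ai t).graph := fun f => by
    by_cases hf : f ∈ D
    · obtain ⟨a, ha, hb⟩ := hA.im_contDiff f hf
      exact ⟨a, fun _ => ⟨ha.continuousOn, hb⟩⟩
    · exact ⟨0, fun h => absurd h hf⟩
  choose c hc using h1
  choose a ha using h2
  exact ⟨c, a, hc, fun f hf => (ha f hf).2, hA.dense,
    fun f hf g hg => hA.inner_graph_eq (hc f hf) (hc g hg),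
    fun f hf g hg t ht => inner_eq_of_isSelfAdjoint (hA.im_selfAdjoint t ht)
      ((ha f hf).2 t ht) ((ha g hg).2 t ht), fun f hf => (ha f hf).1⟩

variable {c : H → H} {a : H → ℝ → H} (hc : ∀ f ∈ D, (f, c f) ∈ C.graph)
  (ha : ∀ f ∈ D, ∀ t ∈ Icc (0 : ℝ) 1, (f, a f t) ∈ (Ai t).graph)
include hc ha

theorem ae_mem_graph : ∀ᵐ t ∂(volume.restrict (Ioo (0 : ℝ) 1)), ∀ f ∈ D,
    (f, ((deriv α t / (2 * α t) : ℝ) : ℂ) • f + c f + Complex.I • a f t) ∈ (A t).graph := by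
  filter_upwards [hA.re_eq, ae_restrict_mem measurableSet_Ioo] with t h1 h2 f hf
  have ht := Ioo_subset_Icc_self h2
  rw [hA.eq_re_add_im t ht]
  refine mem_graph_add_smul _ _ _ ?_ (ha f hf t ht)
  rw [h1, mem_graph_smul_id_add]
  simpa using hc f hf

/-- Symmetry of `C` and `A_i(t)` on `D` puts `D` inside the domain of `A(t)*` with the expected
value. That is enough, since the generators of `L₀⁺` use `A(t)*` on `D` only. -/
theorem ae_mem_graph_adjoint (hF : IsFormalCoefficient D c a) :
    ∀ᵐ t ∂(volume.restrict (Ioo (0 : ℝ) 1)), ∀ f ∈ D,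
    (f, ((deriv α t / (2 * α t) : ℝ) : ℂ) • f + c f - Complex.I • a f t) ∈
      (A t).adjoint.graph := by
  filter_upwards [hA.ae_mem_graph hc ha, ae_restrict_mem measurableSet_Ioo] with t h1 h2 f hf
  have ht := Ioo_subset_Icc_self h2
  have hdom : (A t).domain = D := by
    rw [hA.eq_re_add_im t ht]
    change (Ar t).domain ⊓ (Ai t).domain = D
    rw [hA.re_domain t ht, hA.im_domain t ht, inf_idem]
  rw [LinearPMap.adjoint_graph_eq_graph_adjoint (by rw [hdom]; exact hA.dense),
    Submodule.mem_adjoint_iff]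
  intro g b hgb
  have hg : g ∈ D := by
    rw [← hdom]
    exact LinearPMap.mem_domain_of_mem_graph hgb
  obtain rfl := LinearPMap.mem_graph_snd_inj _ hgb (h1 g hg) rfl
  have e1 := hF.symm g hg f hf
  have e2 := hF.im_symm g hg f hf t ht
  simp only [inner_add_left, inner_add_right, inner_sub_right, inner_smul_left, inner_smul_right,
    Complex.conj_ofReal, Complex.conj_I, e1, e2]
  ring

theorem preGraph_eq (hα : IsWeight α) :
    preGraph α D (fun φ => deriv φ) A = formalGraph α D c a 1 := by
  unfold preGraph formalGraph
  congr 1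
  ext q
  constructor
  · rintro ⟨φ, f, b, hφ, hf, hb, h1, h2⟩
    refine ⟨φ, f, hφ, hf, h1, ?_⟩
    filter_upwards [h2, hα.ae_iff.2 hb, hα.ae_iff.2 (hA.ae_mem_graph hc ha)] with t e1 e2 e3
    rw [e1, LinearPMap.mem_graph_snd_inj _ e2 (e3 f hf) rfl, formalExpr]
    simp only [Complex.ofReal_one]
    module
  · rintro ⟨φ, f, hφ, hf, h1, h2⟩
    refine ⟨φ, f, fun t => ((deriv α t / (2 * α t) : ℝ) : ℂ) • f + c f + Complex.I • a f t, hφ, hf,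
      ?_, h1, ?_⟩
    · filter_upwards [hA.ae_mem_graph hc ha] with t e using e f hf
    · filter_upwards [h2] with t e1
      rw [e1, formalExpr]
      simp only [Complex.ofReal_one]
      module

/-- The product rule in `-(α φ)' / α` gives `-(α' / α) φ - φ'`; the real part of `A(t)*` returns
half of the first term, which leaves the expression with `ε = -1`. -/
theorem preGraph_plus_eq (hα : IsWeight α) (hF : IsFormalCoefficient D c a) :
    preGraph α D (fun φ t => -(deriv (fun s => (α s : ℂ) * φ s) t / (α t : ℂ)))
      (fun t => (A t).adjoint) = formalGraph α D c a (-1) := by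
  have key : ∀ φ : ℝ → ℂ, IsTestFunction φ → ∀ f : H, ∀ t ∈ posSet α,
      -(deriv (fun s => (α s : ℂ) * φ s) t / (α t : ℂ)) • f +
        φ t • (((deriv α t / (2 * α t) : ℝ) : ℂ) • f + c f - Complex.I • a f t) =
      formalExpr α (-1) φ f (c f) (a f) t := by
    intro φ hφ f t ht
    have h0 : (α t : ℂ) ≠ 0 := by exact_mod_cast ht.2.ne'
    have hd : deriv (fun s => (α s : ℂ) * φ s) t =
        ((deriv α t : ℝ) : ℂ) * φ t + (α t : ℂ) * deriv φ t :=
      ((hα.hasDerivAt ht.1).ofReal_comp.mul (hφ.hasDerivAt t)).deriv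
    have h1 : deriv (fun s => (α s : ℂ) * φ s) t / (α t : ℂ) =
        2 * ((deriv α t / (2 * α t) : ℝ) : ℂ) * φ t + deriv φ t := by
      rw [hd]
      push_cast
      field_simp
    rw [h1, formalExpr]
    push_cast
    module
  unfold preGraph formalGraph
  congr 1
  ext q
  constructor
  · rintro ⟨φ, f, b, hφ, hf, hb, h1, h2⟩
    refine ⟨φ, f, hφ, hf, h1, ?_⟩
    filter_upwards [h2, hα.ae_iff.2 hb, hα.ae_iff.2 (hA.ae_mem_graph_adjoint hc ha hF),
      hα.ae_iff.2 hα.ae_mem_posSet] with t e1 e2 e3 e4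
    rw [e1, LinearPMap.mem_graph_snd_inj _ e2 (e3 f hf) rfl, key φ hφ f t e4]
  · rintro ⟨φ, f, hφ, hf, h1, h2⟩
    refine ⟨φ, f, fun t => ((deriv α t / (2 * α t) : ℝ) : ℂ) • f + c f - Complex.I • a f t, hφ, hf,
      ?_, h1, ?_⟩
    · filter_upwards [hA.ae_mem_graph_adjoint hc ha hF] with t e using e f hf
    · filter_upwards [h2, hα.ae_iff.2 hα.ae_mem_posSet] with t e1 e2
      rw [e1, key φ hφ f t e2]

theorem maximalOp_eq (hα : IsWeight α) (hF : IsFormalCoefficient D c a) :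
    maximalOp α D A = (formalGraph α D c a (-1)).toLinearPMap.closure.adjoint := by
  rw [maximalOp, minimalOpPlus, hA.preGraph_plus_eq hc ha hα hF]

theorem maximalOpPlus_eq (hα : IsWeight α) :
    maximalOpPlus α D A = (formalGraph α D c a 1).toLinearPMap.closure.adjoint := by
  rw [maximalOpPlus, minimalOp, hA.preGraph_eq hc ha hα]

end IsCoefficient

end Coefficient

/-! ### Integration by parts for vector-valued primitives. -/

section IntegrationByParts

variable {H : Type*} [NormedAddCommGroup H] [InnerProductSpace ℂ H] [CompleteSpace H]

omit [InnerProductSpace ℂ H] [CompleteSpace H] in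
theorem continuousOn_of_primitive [NormedSpace ℝ H] {y g : ℝ → H} (hg : IntegrableOn g (Ioo 0 1))
    (hy : ∀ t ∈ Icc (0 : ℝ) 1, y t = y 0 + ∫ s in (0 : ℝ)..t, g s) :
    ContinuousOn y (Icc 0 1) := by
  have hi : IntegrableOn g (uIcc 0 1) := by
    rwa [uIcc_of_le zero_le_one, integrableOn_Icc_iff_integrableOn_Ioo]
  have := intervalIntegral.continuousOn_primitive_interval (μ := volume) hi
  rw [uIcc_of_le zero_le_one] at this
  exact (continuousOn_const.add this).congr hy

omit [CompleteSpace H] in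
theorem integrableOn_inner_of_continuousOn {p g : ℝ → H} (hp : ContinuousOn p (Icc 0 1))
    (hg : IntegrableOn g (Ioo 0 1)) : IntegrableOn (fun t => ⟪p t, g t⟫_ℂ) (Ioo 0 1) := by
  obtain ⟨K, hK⟩ := isCompact_Icc.exists_bound_of_continuousOn hp
  refine (hg.norm.const_mul K).mono' ?_ ?_
  · exact ((hp.mono Ioo_subset_Icc_self).aestronglyMeasurable
      measurableSet_Ioo).inner hg.aestronglyMeasurable
  · rw [ae_restrict_iff' measurableSet_Ioo]
    exact ae_of_all _ fun t ht => (norm_inner_le_norm _ _).trans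
      (mul_le_mul_of_nonneg_right (hK t (Ioo_subset_Icc_self ht)) (norm_nonneg _))

/-- Fubini on the triangle `s ≤ t`: `y t - y 0` is the integral of `g` and `p τ - p s` that of `p'`,
so no almost everywhere derivative of `y` is needed. -/
theorem integral_inner_primitive {p p' y g : ℝ → H}
    (hp : ∀ t ∈ Icc (0 : ℝ) 1, HasDerivWithinAt p (p' t) (Icc 0 1) t)
    (hp' : ContinuousOn p' (Icc 0 1)) (hg : IntegrableOn g (Ioo 0 1))
    (hy : ∀ t ∈ Icc (0 : ℝ) 1, y t = y 0 + ∫ s in (0 : ℝ)..t, g s) {τ : ℝ}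
    (hτ : τ ∈ Icc (0 : ℝ) 1) :
    ∫ t in Ioo 0 τ, (⟪p' t, y t⟫_ℂ + ⟪p t, g t⟫_ℂ) = ⟪p τ, y τ⟫_ℂ - ⟪p 0, y 0⟫_ℂ := by
  have hsub : Icc 0 τ ⊆ Icc 0 1 := Icc_subset_Icc_right hτ.2
  have hpc : ContinuousOn p (Icc 0 1) := fun t ht => (hp t ht).continuousWithinAt
  have hyc := continuousOn_of_primitive hg hy
  have hgτ : IntegrableOn g (Ioc 0 τ) :=
    integrableOn_Ioc_iff_integrableOn_Ioo (by simp) |>.2 (hg.mono_set (Ioo_subset_Ioo_right hτ.2))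
  have hp'τ : IntegrableOn p' (Ioc 0 τ) :=
    (hp'.mono hsub).integrableOn_Icc.mono_set Ioc_subset_Icc_self
  have ftc : ∀ s ∈ Icc 0 τ, ∫ t in Ioc s τ, p' t = p τ - p s := by
    intro s hs
    rw [← intervalIntegral.integral_of_le hs.2]
    refine intervalIntegral.integral_eq_sub_of_hasDerivAt_of_le hs.2
      (hpc.mono (Icc_subset_Icc hs.1 hτ.2)) (fun t ht => ?_) ?_
    · exact (hp t ⟨hs.1.trans ht.1.le, ht.2.le.trans hτ.2⟩).hasDerivAt
        (Icc_mem_nhds (hs.1.trans_lt ht.1) (ht.2.trans_le hτ.2))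
    · rw [intervalIntegrable_iff_integrableOn_Ioc_of_le hs.2]
      exact hp'τ.mono_set (Ioc_subset_Ioc_left hs.1)
  have i1 : IntegrableOn (fun t => ⟪p' t, y t⟫_ℂ) (Ioc 0 τ) :=
    ((hp'.inner hyc).mono hsub).integrableOn_Icc.mono_set Ioc_subset_Icc_self
  have i2 : IntegrableOn (fun t => ⟪p t, g t⟫_ℂ) (Ioc 0 τ) :=
    (integrableOn_Ioc_iff_integrableOn_Ioo (by simp)).2
      ((integrableOn_inner_of_continuousOn hpc hg).mono_set (Ioo_subset_Ioo_right hτ.2))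
  let μ := volume.restrict (Ioc 0 τ)
  let f : ℝ → ℝ → ℂ := fun t s =>
    indicator {q : ℝ × ℝ | q.2 ≤ q.1} (fun q => ⟪p' q.1, g q.2⟫_ℂ) (t, s)
  have hf : Integrable (Function.uncurry f) (μ.prod μ) := by
    have h1 : Integrable (fun q : ℝ × ℝ => ⟪p' q.1, g q.2⟫_ℂ) (μ.prod μ) := by
      refine (hp'τ.norm.mul_prod hgτ.norm).mono' ?_ (ae_of_all _ fun q => norm_inner_le_norm _ _)
      exact hp'τ.aestronglyMeasurable.comp_fst.inner hgτ.aestronglyMeasurable.comp_snd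
    exact h1.indicator (measurableSet_le measurable_snd measurable_fst)
  have swap := integral_integral_swap hf
  have e1 : ∫ t in Ioc 0 τ, ∫ s in Ioc 0 τ, f t s = ∫ t in Ioc 0 τ, ⟪p' t, y t - y 0⟫_ℂ := by
    refine setIntegral_congr_fun measurableSet_Ioc fun t ht => ?_
    have hf1 : ∀ s, f t s = indicator (Iic t) (fun s => ⟪p' t, g s⟫_ℂ) s := fun s => rfl
    simp_rw [hf1]
    have hint : IntegrableOn g (Ioc 0 t) := hgτ.mono_set (Ioc_subset_Ioc_right ht.2)
    rw [setIntegral_indicator measurableSet_Iic, Ioc_inter_Iic, min_eq_right ht.2,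
      integral_inner hint, hy t (hsub (Ioc_subset_Icc_self ht)), add_sub_cancel_left,
      intervalIntegral.integral_of_le ht.1.le]
  have e2 : ∫ s in Ioc 0 τ, ∫ t in Ioc 0 τ, f t s = ∫ s in Ioc 0 τ, ⟪p τ - p s, g s⟫_ℂ := by
    refine setIntegral_congr_fun measurableSet_Ioc fun s hs => ?_
    have hf1 : ∀ t, f t s = indicator (Ici s) (fun t => ⟪p' t, g s⟫_ℂ) t := fun t => rfl
    simp_rw [hf1]
    have hset : Ioc 0 τ ∩ Ici s = Icc s τ := by
      ext t
      simp only [mem_inter_iff, mem_Ioc, mem_Ici, mem_Icc]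
      exact ⟨fun h => ⟨h.2, h.1.2⟩, fun h => ⟨⟨hs.1.trans_le h.1, h.2⟩, h.1⟩⟩
    have hint : IntegrableOn p' (Ioc s τ) := hp'τ.mono_set (Ioc_subset_Ioc_left hs.1.le)
    rw [setIntegral_indicator measurableSet_Ici, hset, integral_Icc_eq_integral_Ioc,
      ← ftc s (Ioc_subset_Icc_self hs)]
    have h3 := integral_inner (𝕜 := ℂ) hint (g s)
    have h4 := congrArg (starRingEnd ℂ) h3
    rw [← integral_conj] at h4
    simpa only [inner_conj_symm] using h4
  rw [e1, e2] at swap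
  have e3 : ∫ t in Ioc 0 τ, ⟪p' t, y t - y 0⟫_ℂ =
      (∫ t in Ioc 0 τ, ⟪p' t, y t⟫_ℂ) - ⟪p τ - p 0, y 0⟫_ℂ := by
    simp_rw [inner_sub_right]
    rw [integral_sub i1 (hp'τ.inner_const (y 0)), ← ftc 0 ⟨le_rfl, hτ.1⟩]
    congr 1
    have h4 := congrArg (starRingEnd ℂ) (integral_inner (𝕜 := ℂ) hp'τ (y 0))
    rw [← integral_conj] at h4
    simpa only [inner_conj_symm, inner_sub_left] using h4
  have e4 : ∫ s in Ioc 0 τ, ⟪p τ - p s, g s⟫_ℂ =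
      ⟪p τ, y τ - y 0⟫_ℂ - ∫ s in Ioc 0 τ, ⟪p s, g s⟫_ℂ := by
    simp_rw [inner_sub_left]
    rw [integral_sub (hgτ.const_inner (p τ)) i2, integral_inner hgτ, hy τ hτ,
      intervalIntegral.integral_of_le hτ.1, inner_sub_right, inner_add_right]
    ring
  rw [e3, e4] at swap
  rw [← integral_Ioc_eq_integral_Ioo, integral_add i1 i2]
  simp only [inner_sub_left, inner_sub_right] at swap
  linear_combination swap

end IntegrationByParts

/-! ### The inclusion for `C^{1/2}` forces `D = H`. -/

section Boundedness

variable {H : Type*} [NormedAddCommGroup H] [InnerProductSpace ℂ H] [CompleteSpace H] {α : ℝ → ℝ}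
  {D : Submodule ℂ H} {c : H → H} {a : H → ℝ → H}

/-- The common domain of two operators, with the norm of the values of both. -/
def jointGraph {E : Type*} [NormedAddCommGroup E] [InnerProductSpace ℂ E] (S T : E →ₗ.[ℂ] E) :
    Submodule ℂ (E × E × E) :=
  S.graph.comap ((LinearMap.fst ℂ E (E × E)).prod
      ((LinearMap.fst ℂ E E).comp (LinearMap.snd ℂ E (E × E)))) ⊓
    T.graph.comap ((LinearMap.fst ℂ E (E × E)).prod
      ((LinearMap.snd ℂ E E).comp (LinearMap.snd ℂ E (E × E))))

theorem isClosed_jointGraph {E : Type*} [NormedAddCommGroup E] [InnerProductSpace ℂ E]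
    {S T : E →ₗ.[ℂ] E} (hS : S.IsClosed) (hT : T.IsClosed) :
    IsClosed (jointGraph S T : Set (E × E × E)) := by
  have h1 : IsClosed {q : E × E × E | (q.1, q.2.1) ∈ S.graph} :=
    IsClosed.preimage (f := fun q : E × E × E => (q.1, q.2.1)) (by fun_prop) hS
  have h2 : IsClosed {q : E × E × E | (q.1, q.2.2) ∈ T.graph} :=
    IsClosed.preimage (f := fun q : E × E × E => (q.1, q.2.2)) (by fun_prop) hT
  exact h1.inter h2

omit [CompleteSpace H] in
/-- The function `α^{-1/2} ψ' f`, for `ψ` supported where `α` is positive. -/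
theorem continuousOn_sqrt_inv_deriv (hα : IsWeight α) {ψ : ℝ → ℂ} (hψ : IsTestFunction ψ)
    (hs : tsupport ψ ⊆ posSet α) (f : H) :
    ContinuousOn (fun t => (((√(α t))⁻¹ : ℝ) * deriv ψ t : ℂ) • f) (Icc 0 1) := by
  have h1 : ContinuousOn (fun t => (((√(α t))⁻¹ : ℝ) : ℂ)) (posSet α) := by
    refine Complex.continuous_ofReal.comp_continuousOn ?_
    refine ContinuousOn.inv₀ (Real.continuous_sqrt.comp_continuousOn
      (hα.continuousOn.mono (posSet_subset.trans Ioo_subset_Icc_self))) fun t ht => ?_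
    exact (Real.sqrt_pos.2 ht.2).ne'
  exact ((hα.continuous_mul hψ.continuous_deriv
    (tsupport_deriv_subset.trans hs) h1).continuousOn).smul continuousOn_const

/-- The oscillating test function `e^{i n t} χ(t)`. -/
def oscillating (χ : ℝ → ℝ) (n : ℕ) (t : ℝ) : ℂ := Complex.exp (Complex.I * n * t) * χ t

theorem norm_exp_I_mul (n : ℕ) (t : ℝ) : ‖Complex.exp (Complex.I * n * t)‖ = 1 := by
  have : Complex.I * n * t = ((n * t : ℝ) : ℂ) * Complex.I := by push_cast; ring
  rw [this, Complex.norm_exp_ofReal_mul_I]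

theorem tsupport_oscillating_subset (χ : ℝ → ℝ) (n : ℕ) :
    tsupport (oscillating χ n) ⊆ tsupport χ :=
  closure_mono fun t ht h0 => ht (by simp [oscillating, h0])

theorem isTestFunction_oscillating {χ : ℝ → ℝ} (h1 : ContDiff ℝ ∞ χ) (h2 : HasCompactSupport χ)
    (h3 : tsupport χ ⊆ Ioo 0 1) (n : ℕ) : IsTestFunction (oscillating χ n) where
  contDiff := by
    refine ContDiff.mul (ContDiff.cexp ?_) (Complex.ofRealCLM.contDiff.comp h1)
    exact contDiff_const.mul Complex.ofRealCLM.contDiff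
  hasCompactSupport := HasCompactSupport.mono h2 fun t ht h0 => ht (by simp [oscillating, h0])
  tsupport_subset := (tsupport_oscillating_subset χ n).trans h3

theorem deriv_oscillating {χ : ℝ → ℝ} (h1 : ContDiff ℝ ∞ χ) (n : ℕ) (t : ℝ) :
    deriv (oscillating χ n) t =
      Complex.exp (Complex.I * n * t) * (Complex.I * n * χ t + (deriv χ t : ℝ)) := by
  have e1 : HasDerivAt (fun t : ℝ => Complex.I * n * (t : ℂ)) (Complex.I * n * 1) t :=
    (Complex.ofRealCLM.hasDerivAt (x := t)).const_mul _
  have e2 : HasDerivAt χ (deriv χ t) t := (h1.differentiable (by simp) t).hasDerivAt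
  have := (e1.cexp.mul e2.ofReal_comp).deriv
  rw [show oscillating χ n = fun t : ℝ => Complex.exp (Complex.I * n * t) * (χ t : ℂ) from rfl]
  refine Eq.trans this ?_
  ring

omit [CompleteSpace H] in
theorem formalExpr_oscillating {χ : ℝ → ℝ} (h1 : ContDiff ℝ ∞ χ) (n : ℕ) (ε : ℝ) (f k : H)
    (b : ℝ → H) (t : ℝ) : formalExpr α ε (oscillating χ n) f k b t =
      Complex.exp (Complex.I * n * t) • (formalExpr α ε (oscillating χ 0) f k b t +
        (ε * Complex.I * n * χ t) • f) := by
  simp only [formalExpr, deriv_oscillating h1, oscillating]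
  simp only [Nat.cast_zero, mul_zero, zero_mul, Complex.exp_zero, zero_add, one_mul]
  module

omit [CompleteSpace H] in
theorem norm_formalExpr_oscillating_le {χ : ℝ → ℝ} (h1 : ContDiff ℝ ∞ χ)
    (hχ : ∀ t, χ t ∈ Icc (0 : ℝ) 1) (n : ℕ) {ε : ℝ} (hε : |ε| = 1) (f k : H)
    (b : ℝ → H) (t : ℝ) : ‖formalExpr α ε (oscillating χ n) f k b t‖ ≤
      ‖formalExpr α ε (oscillating χ 0) f k b t‖ + n * ‖f‖ := by
  rw [formalExpr_oscillating h1, norm_smul, norm_exp_I_mul, one_mul]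
  refine (norm_add_le _ _).trans ?_
  gcongr
  rw [norm_smul]
  gcongr
  rw [norm_mul, norm_mul, norm_mul, Complex.norm_I, Complex.norm_real, Complex.norm_real,
    Real.norm_eq_abs, hε, Complex.norm_natCast, Real.norm_eq_abs, abs_of_nonneg (hχ t).1]
  have := mul_le_mul_of_nonneg_left (hχ t).2 (Nat.cast_nonneg (α := ℝ) n)
  linarith

theorem IsWeight.exists_bump (hα : IsWeight α) : ∃ χ : ℝ → ℝ, ContDiff ℝ ∞ χ ∧
    HasCompactSupport χ ∧ tsupport χ ⊆ posSet α ∧ (∀ t, χ t ∈ Icc (0 : ℝ) 1) ∧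
      0 < ∫ t in Ioo (0 : ℝ) 1, √(α t) * χ t ^ 2 := by
  have : (volume.restrict (Ioo (0 : ℝ) 1)) ≠ 0 := by
    rw [Ne, Measure.restrict_eq_zero]
    simp
  have := ae_neBot.2 this
  obtain ⟨t₀, ht₀⟩ := hα.ae_mem_posSet.exists
  obtain ⟨χ, h1, h2, h3, h4, h5⟩ := exists_contDiff_tsupport_subset (n := ⊤)
    (hα.isOpen_posSet.mem_nhds ht₀)
  refine ⟨χ, h3, h2, h1, fun t => h4 ⟨t, rfl⟩, ?_⟩
  have hc : ContinuousOn (fun t => √(α t) * χ t ^ 2) (Icc 0 1) :=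
    (Real.continuous_sqrt.comp_continuousOn hα.continuousOn).mul
      (h3.continuous.pow 2).continuousOn
  rw [← integral_Ioc_eq_integral_Ioo, ← intervalIntegral.integral_of_le zero_le_one]
  refine intervalIntegral.integral_pos zero_lt_one hc (fun t _ => by positivity)
    ⟨t₀, Ioo_subset_Icc_self ht₀.1, ?_⟩
  rw [h5]
  have := Real.sqrt_pos.2 ht₀.2
  positivity

variable {A Ar Ai : ℝ → H →ₗ.[ℂ] H} {C S : H →ₗ.[ℂ] H}

/-- The functional `u ↦ ∫ ψ' ⟨S e, √α u⟩` is bounded by `sup |ψ| ‖e‖ ‖(√α S u)'‖`. -/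
theorem exists_bound_inner_sqrt_inv_deriv (hα : IsWeight α) (hS : IsSelfAdjoint S)
    (hSW : MapsIntoW12w α D A S) {u : L2w H α}
    (hu : u ∈ (maximalOp α D A).domain ⊓ (maximalOpPlus α D A).domain) :
    ∃ K : ℝ, ∀ (ψ : ℝ → ℂ) (hψ : IsTestFunction ψ) (hs : tsupport ψ ⊆ posSet α) (e k : H),
      (e, k) ∈ S.graph → (∀ t, ‖ψ t‖ ≤ 1) → ‖e‖ ≤ 1 →
      ‖⟪(hα.memLp_of_continuousOn (continuousOn_sqrt_inv_deriv hα hψ hs k)).toLp, u⟫_ℂ‖ ≤ K := by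
  obtain ⟨w, ⟨v, ⟨g, hg, hv⟩, hvw⟩, hw⟩ := hSW u hu
  have hgi : IntegrableOn g (Ioo 0 1) := hg.integrable (by norm_num)
  refine ⟨∫ t in Ioo (0 : ℝ) 1, ‖g t‖, fun ψ hψ hs e k hek hψ1 he => ?_⟩
  have hpd : ∀ t ∈ Icc (0 : ℝ) 1,
      HasDerivWithinAt (fun t => ψ t • e) (deriv ψ t • e) (Icc 0 1) t :=
    fun t _ => ((hψ.hasDerivAt t).smul_const e).hasDerivWithinAt
  have hpc : ContinuousOn (fun t => deriv ψ t • e) (Icc 0 1) :=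
    hψ.continuous_deriv.continuousOn.smul continuousOn_const
  have hpc0 : ContinuousOn (fun t => ψ t • e) (Icc 0 1) :=
    hψ.continuous.continuousOn.smul continuousOn_const
  have ibp := integral_inner_primitive hpd hpc hgi hv ⟨zero_le_one, le_rfl⟩
  have hvi : IntegrableOn v (Ioo 0 1) :=
    (continuousOn_of_primitive hgi hv).integrableOn_Icc.mono_set Ioo_subset_Icc_self
  rw [integral_add (integrableOn_inner_of_continuousOn hpc hvi)
    (integrableOn_inner_of_continuousOn hpc0 hgi), hψ.eq_zero (t := 0) (by simp),
    hψ.eq_zero (t := 1) (by simp), zero_smul, inner_zero_left, inner_zero_left, sub_zero] at ibp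
  -- With weight `α · α^{-1/2} = √α`, self-adjointness moves `S` from `e` to `u(t)`, and `√α S u` is
  -- the function `v` with integrable derivative `g`; integration by parts then removes the
  -- derivative from `ψ`.
  have e1 : ⟪(hα.memLp_of_continuousOn (continuousOn_sqrt_inv_deriv hα hψ hs k)).toLp, u⟫_ℂ =
      ∫ t in Ioo (0 : ℝ) 1, ⟪deriv ψ t • e, v t⟫_ℂ := by
    rw [L2.inner_def, hα.integral_weightMeasure]
    refine integral_congr_ae ?_
    filter_upwards [hα.ae_iff.1 (MemLp.coeFn_toLp
      (hα.memLp_of_continuousOn (continuousOn_sqrt_inv_deriv hα hψ hs k))), hα.ae_iff.1 hvw,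
      hα.ae_iff.1 hw, hα.ae_pos] with t h1 h2 h3 h4
    have h5 : ((√(α t) : ℝ) : ℂ) ≠ 0 := by exact_mod_cast (Real.sqrt_pos.2 h4).ne'
    have h6 : ((α t : ℝ) : ℂ) = ((√(α t) : ℝ) : ℂ) * ((√(α t) : ℝ) : ℂ) := by
      exact_mod_cast (Real.mul_self_sqrt h4.le).symm
    rw [h1, h2, Complex.real_smul]
    simp only [inner_smul_left, inner_smul_right, map_mul, Complex.conj_ofReal]
    rw [inner_eq_of_isSelfAdjoint hS hek h3, h6]
    push_cast
    field_simp
  rw [e1, eq_neg_of_add_eq_zero_left ibp, norm_neg]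
  refine (norm_integral_le_integral_norm _).trans (integral_mono_of_nonneg
    (ae_of_all _ fun _ => norm_nonneg _) hgi.norm (ae_of_all _ fun t => ?_))
  refine (norm_inner_le_norm _ _).trans (mul_le_of_le_one_left (norm_nonneg _) ?_)
  rw [norm_smul]
  exact mul_le_one₀ (hψ1 t) (norm_nonneg _) he

omit [CompleteSpace H] in
-- The phases of `ψ' = e^{int} (i n χ + χ')` and of `e^{int} χ` cancel after conjugation, which
-- leaves a leading term linear in `n`.
theorem integral_oscillating_identity (hα : IsWeight α) {χ : ℝ → ℝ} (h1 : ContDiff ℝ ∞ χ)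
    (h2 : HasCompactSupport χ) (h3 : tsupport χ ⊆ posSet α) (n : ℕ) (f k : H) :
    ⟪(hα.memLp_of_continuousOn (continuousOn_sqrt_inv_deriv hα
        (isTestFunction_oscillating h1 h2 (h3.trans posSet_subset) n)
        ((tsupport_oscillating_subset χ n).trans h3) k)).toLp,
      testElement hα (isTestFunction_oscillating h1 h2 (h3.trans posSet_subset) n) f⟫_ℂ =
    (-(Complex.I * n) * ((∫ t in Ioo (0 : ℝ) 1, √(α t) * χ t ^ 2 : ℝ) : ℂ) +
      ((∫ t in Ioo (0 : ℝ) 1, √(α t) * (deriv χ t * χ t) : ℝ) : ℂ)) * ⟪k, f⟫_ℂ := by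
  have hsq : ContinuousOn (fun t => √(α t)) (Icc 0 1) :=
    Real.continuous_sqrt.comp_continuousOn hα.continuousOn
  have i1 : IntegrableOn (fun t => ((√(α t) * χ t ^ 2 : ℝ) : ℂ)) (Ioo 0 1) :=
    ((hsq.mul (h1.continuous.pow 2).continuousOn).integrableOn_Icc.mono_set
      Ioo_subset_Icc_self).ofReal
  have i2 : IntegrableOn (fun t => ((√(α t) * (deriv χ t * χ t) : ℝ) : ℂ)) (Ioo 0 1) :=
    ((hsq.mul ((h1.continuous_deriv (by simp)).mul h1.continuous).continuousOn).integrableOn_Icc.mono_set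
      Ioo_subset_Icc_self).ofReal
  rw [← integral_complex_ofReal, ← integral_complex_ofReal]
  rw [← integral_const_mul, ← integral_add (i1.const_mul _) i2]
  rw [← integral_mul_const, L2.inner_def, hα.integral_weightMeasure]
  refine integral_congr_ae ?_
  filter_upwards [hα.ae_iff.1 (MemLp.coeFn_toLp
      (hα.memLp_of_continuousOn (continuousOn_sqrt_inv_deriv hα
        (isTestFunction_oscillating h1 h2 (h3.trans posSet_subset) n)
        ((tsupport_oscillating_subset χ n).trans h3) k))), hα.ae_iff.1 (testElement_ae hα
        (isTestFunction_oscillating h1 h2 (h3.trans posSet_subset) n) f), hα.ae_pos]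
    with t e1 e2 h4
  have h5 : ((√(α t) : ℝ) : ℂ) ≠ 0 := by exact_mod_cast (Real.sqrt_pos.2 h4).ne'
  have h6 : ((α t : ℝ) : ℂ) = ((√(α t) : ℝ) : ℂ) * ((√(α t) : ℝ) : ℂ) := by
    exact_mod_cast (Real.mul_self_sqrt h4.le).symm
  have h7 : starRingEnd ℂ (Complex.exp (Complex.I * n * t)) * Complex.exp (Complex.I * n * t) = 1 := by
    rw [Complex.conj_mul', norm_exp_I_mul]
    norm_num
  rw [e1, e2, Complex.real_smul, deriv_oscillating h1, oscillating]
  simp only [inner_smul_left, inner_smul_right, map_mul, map_add, Complex.conj_ofReal, Complex.conj_I,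
    map_natCast, h6]
  push_cast
  field_simp
  linear_combination (-(Complex.I * n) * χ t + (deriv χ t : ℝ)) * χ t * ⟪k, f⟫_ℂ * h7

/-- The uniform boundedness principle on the complete space `D(L) ∩ D(L⁺)` with the joint graph
norm, tested on oscillating functions. Both sides grow linearly in `n`, and comparing the
coefficients of `n` removes the dependence on `C f` and `A_i(t) f`. -/
theorem exists_norm_le_of_mapsIntoW12w (hα : IsWeight α) (hA : IsCoefficient α D A Ar Ai C)
    (hS : IsSelfAdjoint S) (hSW : MapsIntoW12w α D A S) :
    ∃ K : ℝ, ∀ e k, (e, k) ∈ S.graph → ∀ f ∈ D, ‖e‖ ≤ 1 → ‖⟪k, f⟫_ℂ‖ ≤ K * ‖f‖ := by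
  obtain ⟨c, a, hc, ha, hF⟩ := hA.exists_formalCoefficient
  have hfin := hα.isFiniteMeasure
  set L := maximalOp α D A with hL
  set L' := maximalOpPlus α D A with hL'
  have hLe := hA.maximalOp_eq hc ha hα hF
  have hLe' := hA.maximalOpPlus_eq hc ha hα
  have hLc : L.IsClosed := by
    rw [hL, hLe]
    exact LinearPMap.adjoint_isClosed (dense_domain_closure hα hF _)
  have hLc' : L'.IsClosed := by
    rw [hL', hLe']
    exact LinearPMap.adjoint_isClosed (dense_domain_closure hα hF _)
  let X := jointGraph L L'
  have hX : CompleteSpace X := (isClosed_jointGraph hLc hLc').completeSpace_coe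
  let ι := {q : (ℝ → ℂ) × H × H // (IsTestFunction q.1 ∧ tsupport q.1 ⊆ posSet α) ∧
    q.2 ∈ S.graph ∧ (∀ t, ‖q.1 t‖ ≤ 1) ∧ ‖q.2.1‖ ≤ 1}
  let κ : ι → L2w H α := fun i => (hα.memLp_of_continuousOn
    (continuousOn_sqrt_inv_deriv hα i.2.1.1 i.2.1.2 i.1.2.2)).toLp
  let Λ : ι → X →L[ℂ] ℂ := fun i =>
    (innerSL ℂ (κ i)).comp ((ContinuousLinearMap.fst ℂ _ _).comp X.subtypeL)
  obtain ⟨K, hK⟩ : ∃ K, ∀ i, ‖Λ i‖ ≤ K := by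
    refine banach_steinhaus fun x => ?_
    obtain ⟨⟨u, p, q⟩, hx⟩ := x
    obtain ⟨K, hK⟩ := exists_bound_inner_sqrt_inv_deriv hα hS hSW (u := u)
      ⟨LinearPMap.mem_domain_of_mem_graph hx.1, LinearPMap.mem_domain_of_mem_graph hx.2⟩
    exact ⟨K, fun i => hK i.1.1 i.2.1.1 i.2.1.2 i.1.2.1 i.1.2.2 i.2.2.1 i.2.2.2.1 i.2.2.2.2⟩
  obtain ⟨χ, h1, h2, h3, h4, h5⟩ := hα.exists_bump
  set I0 := ∫ t in Ioo (0 : ℝ) 1, √(α t) * χ t ^ 2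
  set I1 := ∫ t in Ioo (0 : ℝ) 1, √(α t) * (deriv χ t * χ t)
  -- The square root of the total mass converts pointwise bounds into `L²_α` bounds.
  set m : ℝ := measureUnivNNReal (weightMeasure α) ^ (2 : ℝ≥0∞).toReal⁻¹ with hm
  have hm0 : 0 ≤ m := by positivity
  have hK0 : 0 ≤ max K 0 := le_max_right _ _
  refine ⟨max K 0 * m / I0, fun e k hek f hf he => ?_⟩
  have hosc := isTestFunction_oscillating h1 h2 (h3.trans posSet_subset)
  have hoss := fun n => (tsupport_oscillating_subset χ n).trans h3
  have hosn : ∀ n t, ‖oscillating χ n t‖ ≤ 1 := fun n t => by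
    rw [oscillating, norm_mul, norm_exp_I_mul, one_mul, Complex.norm_real, Real.norm_eq_abs,
      abs_of_nonneg (h4 t).1]
    exact (h4 t).2
  have hbd : ∀ ε : ℝ, ∃ b, 0 ≤ b ∧ ∀ t ∈ Icc (0 : ℝ) 1,
      ‖formalExpr α ε (oscillating χ 0) f (c f) (a f) t‖ ≤ b := fun ε => by
    obtain ⟨b, hb⟩ := isCompact_Icc.exists_bound_of_continuousOn
      (continuousOn_formalExpr hα (hosc 0) (hoss 0) ε f (c f) (hF.im_continuousOn f hf))
    exact ⟨max b 0, le_max_right _ _, fun t ht => (hb t ht).trans (le_max_left _ _)⟩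
  -- `L` is the adjoint of the operator with `ε = -1`, so it acts on test elements by the expression
  -- with sign `-(-1)`; the syntactic form is kept to match `testElement_mem_graph_adjoint`.
  obtain ⟨b, hb0, hb⟩ := hbd (-(-1))
  obtain ⟨b', hb0', hb'⟩ := hbd (-1)
  have key : ∀ n : ℕ, (n * I0 - |I1|) * ‖⟪k, f⟫_ℂ‖ ≤
      max K 0 * (m * ((b + b' + ‖f‖) + n * ‖f‖)) := by
    intro n
    let i : ι := ⟨(oscillating χ n, e, k), ⟨hosc n, hoss n⟩, hek, hosn n, he⟩
    have m1 := testElement_mem_graph_adjoint hα hF (-1) (hosc n) (hoss n) hf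
    have m2 := testElement_mem_graph_adjoint hα hF 1 (hosc n) (hoss n) hf
    rw [← hLe] at m1
    rw [← hLe'] at m2
    let x : X := ⟨(_, _, _), m1, m2⟩
    have hval : Λ i x = (-(Complex.I * n) * (I0 : ℂ) + (I1 : ℂ)) * ⟪k, f⟫_ℂ :=
      integral_oscillating_identity hα h1 h2 h3 n f k
    have hx : ‖x‖ ≤ m * ((b + b' + ‖f‖) + n * ‖f‖) := by
      have hn : 0 ≤ n * ‖f‖ := by positivity
      have hf0 := norm_nonneg f
      refine norm_prod_le_iff.2 ⟨?_, norm_prod_le_iff.2 ⟨?_, ?_⟩⟩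
      · refine Lp.norm_le_of_ae_bound (by positivity) ?_
        filter_upwards [testElement_ae hα (hosc n) f] with t ht
        change ‖testElement hα (hosc n) f t‖ ≤ _
        rw [ht, norm_smul]
        have := mul_le_of_le_one_left (norm_nonneg f) (hosn n t)
        linarith
      · refine Lp.norm_le_of_ae_bound (by positivity) ?_
        filter_upwards [testImage_ae hα (hosc n) (hoss n) (-(-1)) f (c f)
          (hF.im_continuousOn f hf), hα.ae_iff.2 hα.ae_mem_posSet] with t ht ht1
        change ‖testImage hα (hosc n) (hoss n) (-(-1)) f (c f) (hF.im_continuousOn f hf) t‖ ≤ _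
        rw [ht]
        have e1 := norm_formalExpr_oscillating_le (α := α) h1 h4 n (ε := -(-1)) (by simp) f (c f)
          (a f) t
        have e2 := hb t (Ioo_subset_Icc_self ht1.1)
        linarith
      · refine Lp.norm_le_of_ae_bound (by positivity) ?_
        filter_upwards [testImage_ae hα (hosc n) (hoss n) (-1) f (c f)
          (hF.im_continuousOn f hf), hα.ae_iff.2 hα.ae_mem_posSet] with t ht ht1
        change ‖testImage hα (hosc n) (hoss n) (-1) f (c f) (hF.im_continuousOn f hf) t‖ ≤ _
        rw [ht]
        have e1 := norm_formalExpr_oscillating_le (α := α) h1 h4 n (ε := -1) (by simp) f (c f)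
          (a f) t
        have e2 := hb' t (Ioo_subset_Icc_self ht1.1)
        linarith
    have hle : ‖Λ i x‖ ≤ max K 0 * (m * ((b + b' + ‖f‖) + n * ‖f‖)) :=
      ((Λ i).le_opNorm x).trans (mul_le_mul ((hK i).trans (le_max_left _ _)) hx (norm_nonneg _) hK0)
    rw [hval, norm_mul] at hle
    refine le_trans ?_ hle
    gcongr
    have e3 : ‖-(Complex.I * n) * (I0 : ℂ)‖ = n * I0 := by
      rw [norm_mul, norm_neg, norm_mul, Complex.norm_I, Complex.norm_natCast, Complex.norm_real,
        Real.norm_eq_abs, abs_of_pos h5, one_mul]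
    have e4 : ‖(I1 : ℂ)‖ = |I1| := by rw [Complex.norm_real, Real.norm_eq_abs]
    have := norm_sub_le_norm_add (-(Complex.I * n) * (I0 : ℂ)) (I1 : ℂ)
    rwa [e3, e4] at this
  rw [div_mul_eq_mul_div, le_div_iff₀ h5]
  -- If the bound failed, the coefficient of `n` on the left of `key` would exceed the one on the
  -- right, which is impossible for large `n`.
  by_contra hlt
  push Not at hlt
  obtain ⟨n, hn⟩ := exists_nat_gt ((max K 0 * (m * (b + b' + ‖f‖)) + |I1| * ‖⟪k, f⟫_ℂ‖) /
    (‖⟪k, f⟫_ℂ‖ * I0 - max K 0 * m * ‖f‖))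
  rw [div_lt_iff₀ (sub_pos.2 hlt)] at hn
  have := key n
  nlinarith

/-- By density the bound holds for all `f ∈ H`, so every `f` lies in the domain of `S* = S`. Then `C
= S S` is defined everywhere, and its domain is `D`. -/
theorem IsPosSqrt.domain_eq_top (hα : IsWeight α) (hA : IsCoefficient α D A Ar Ai C)
    (hS : IsPosSqrt S C) (hSW : MapsIntoW12w α D A S) : D = ⊤ := by
  obtain ⟨K, hK⟩ := exists_norm_le_of_mapsIntoW12w hα hA hS.selfAdjoint hSW
  have hK1 : ∀ e k, (e, k) ∈ S.graph → ‖e‖ ≤ 1 → ∀ f : H, ‖⟪k, f⟫_ℂ‖ ≤ K * ‖f‖ := by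
    intro e k hek he f
    have hcl : IsClosed {f : H | ‖⟪k, f⟫_ℂ‖ ≤ K * ‖f‖} := isClosed_le (by fun_prop) (by fun_prop)
    exact closure_minimal (s := (D : Set H)) (fun f hf => hK e k hek f hf he) hcl (hA.dense f)
  have hSt : ∀ f : H, f ∈ S.domain := by
    intro f
    rw [← LinearPMap.isSelfAdjoint_def.1 hS.selfAdjoint, LinearPMap.mem_adjoint_domain_iff]
    refine AddMonoidHomClass.continuous_of_bound _ (K * ‖f‖) fun x => ?_
    change ‖⟪f, S x⟫_ℂ‖ ≤ K * ‖f‖ * ‖x‖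
    rw [norm_inner_symm]
    rcases eq_or_ne x 0 with rfl | hx
    · simp
    have hx0 : ‖(x : H)‖ ≠ 0 := by simpa using hx
    have h1 : ((‖(x : H)‖⁻¹ : ℂ) • (x : H), (‖(x : H)‖⁻¹ : ℂ) • S x) ∈ S.graph :=
      Submodule.smul_mem S.graph (‖(x : H)‖⁻¹ : ℂ) (S.mem_graph x)
    have h2 := hK1 _ _ h1 (by rw [norm_smul, norm_inv, Complex.norm_real, norm_norm,
      inv_mul_cancel₀ hx0]) f
    rw [inner_smul_left, norm_mul, RCLike.norm_conj, norm_inv, Complex.norm_real, norm_norm,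
      inv_mul_le_iff₀ (by positivity)] at h2
    change ‖⟪S x, f⟫_ℂ‖ ≤ K * ‖f‖ * ‖(x : H)‖
    linarith
  rw [← hA.domain_eq, Submodule.eq_top_iff']
  intro x
  exact LinearPMap.mem_domain_of_mem_graph ((hS.sq x _).2
    ⟨S ⟨x, hSt x⟩, S.mem_graph ⟨x, hSt x⟩, S.mem_graph ⟨S ⟨x, hSt x⟩, hSt _⟩⟩)

end Boundedness

/-! ### Bounded coefficients and the unitary evolution. -/

section Evolution

variable {H : Type*} [NormedAddCommGroup H] [InnerProductSpace ℂ H] [CompleteSpace H] {α : ℝ → ℝ}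
  {D : Submodule ℂ H} {A Ar Ai : ℝ → H →ₗ.[ℂ] H} {C : H →ₗ.[ℂ] H}

omit [CompleteSpace H] in
theorem exists_linearMap_of_domain_eq_top {T : H →ₗ.[ℂ] H} (hT : T.domain = ⊤) :
    ∃ B : H →ₗ[ℂ] H, ∀ x, (x, B x) ∈ T.graph := by
  have h : ∀ x, x ∈ T.domain := fun x => by rw [hT]; exact Submodule.mem_top
  exact ⟨T.toFun.comp (LinearMap.id.codRestrict T.domain h), fun x => T.mem_graph ⟨x, h x⟩⟩

/-- Everywhere defined coefficients: a bounded `C ≥ 0` and symmetric `B(t) = A_i(t)` that commute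
with `C`. -/
structure IsBoundedCoefficient (Cb : H →L[ℂ] H) (B : ℝ → H →ₗ[ℂ] H) : Prop where
  symm : IsSelfAdjoint Cb
  im_symm : ∀ t ∈ Icc (0 : ℝ) 1, ∀ f g, ⟪B t f, g⟫_ℂ = ⟪f, B t g⟫_ℂ
  im_continuousOn : ∀ f, ContinuousOn (fun t => B t f) (Icc 0 1)
  comm : ∀ t ∈ Icc (0 : ℝ) 1, ∀ f, Cb (B t f) = B t (Cb f)

theorem IsBoundedCoefficient.isFormalCoefficient {Cb : H →L[ℂ] H} {B : ℝ → H →ₗ[ℂ] H}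
    (h : IsBoundedCoefficient Cb B) :
    IsFormalCoefficient (⊤ : Submodule ℂ H) Cb (fun f t => B t f) where
  dense := dense_univ
  symm f _ g _ := by
    rw [← ContinuousLinearMap.adjoint_inner_right, h.symm.adjoint_eq]
  im_symm f _ g _ t ht := h.im_symm t ht f g
  im_continuousOn f _ := h.im_continuousOn f

/-- Hellinger–Toeplitz makes the everywhere defined symmetric `C` bounded. `A_i(t)` commutes with
`A_r(t)`, which differs from `C` by a scalar for almost every `t`; strong continuity of `A_i`
extends the commutation to all `t`. -/
theorem IsCoefficient.exists_isBoundedCoefficient (hA : IsCoefficient α ⊤ A Ar Ai C) :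
    ∃ (Cb : H →L[ℂ] H) (B : ℝ → H →ₗ[ℂ] H), (∀ f, (f, Cb f) ∈ C.graph) ∧
      (∀ t ∈ Icc (0 : ℝ) 1, ∀ f, (f, B t f) ∈ (Ai t).graph) ∧ IsBoundedCoefficient Cb B := by
  obtain ⟨Cl, hCl⟩ := exists_linearMap_of_domain_eq_top hA.domain_eq
  have hCs : Cl.IsSymmetric := fun f g => hA.inner_graph_eq (hCl f) (hCl g)
  let Cb : H →L[ℂ] H := ⟨Cl, hCs.continuous⟩
  have hB : ∀ t, ∃ B : H →ₗ[ℂ] H, t ∈ Icc (0 : ℝ) 1 → ∀ f, (f, B f) ∈ (Ai t).graph := fun t => by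
    by_cases ht : t ∈ Icc (0 : ℝ) 1
    · obtain ⟨B, hB⟩ := exists_linearMap_of_domain_eq_top (hA.im_domain t ht)
      exact ⟨B, fun _ => hB⟩
    · exact ⟨0, fun h => absurd h ht⟩
  choose B hB using hB
  have hBc : ∀ f, ContinuousOn (fun t => B t f) (Icc 0 1) := fun f => by
    obtain ⟨a, ha, hb⟩ := hA.im_contDiff f Submodule.mem_top
    exact ha.continuousOn.congr fun t ht =>
      LinearPMap.mem_graph_snd_inj _ (hB t ht f) (hb t ht) rfl
  refine ⟨Cb, B, hCl, hB, ?_, fun t ht f g => inner_eq_of_isSelfAdjoint (hA.im_selfAdjoint t ht)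
    (hB t ht f) (hB t ht g), hBc, fun t ht f => ?_⟩
  · exact ContinuousLinearMap.isSelfAdjoint_iff_isSymmetric.2 hCs
  · have hae : ∀ᵐ t ∂(volume.restrict (Ioo (0 : ℝ) 1)), Cb (B t f) = B t (Cb f) := by
      filter_upwards [hA.re_eq, ae_restrict_mem measurableSet_Ioo] with t h1 h2
      have ht := Ioo_subset_Icc_self h2
      set z : ℂ := ((deriv α t / (2 * α t) : ℝ) : ℂ)
      have hr : ∀ x, (x, Cb x + z • x) ∈ (Ar t).graph := fun x => by
        rw [h1, mem_graph_smul_id_add, add_sub_cancel_right]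
        exact hCl x
      obtain ⟨y, hy1, hy2⟩ := (hA.commutes t ht f (Cb (B t f) + z • B t f)).1
        ⟨B t f, hB t ht f, hr _⟩
      obtain rfl : y = Cb f + z • f := LinearPMap.mem_graph_snd_inj _ hy1 (hr f) rfl
      have := LinearPMap.mem_graph_snd_inj _ hy2 (hB t ht _) rfl
      rw [map_add, map_smul] at this
      exact add_right_cancel this
    have hae' : (fun t => Cb (B t f)) =ᵐ[volume.restrict (Icc (0 : ℝ) 1)] fun t => B t (Cb f) := by
      rw [← restrict_Ioo_eq_restrict_Icc]
      exact hae
    exact Measure.eqOn_Icc_of_ae_eq volume zero_ne_one hae' (Cb.continuous.comp_continuousOn (hBc f))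
      (hBc (Cb f)) ht

/-- `-i A_i(t)` is skew-symmetric, so the inner product of two solutions has zero derivative. -/
theorem inner_eq_of_solutions {Cb : H →L[ℂ] H} {B : ℝ → H →ₗ[ℂ] H}
    (hB : IsBoundedCoefficient Cb B) {z w : ℝ → H}
    (hz : ∀ t ∈ Icc (0 : ℝ) 1, HasDerivWithinAt z (-(Complex.I • B t (z t))) (Icc 0 1) t)
    (hw : ∀ t ∈ Icc (0 : ℝ) 1, HasDerivWithinAt w (-(Complex.I • B t (w t))) (Icc 0 1) t)
    {s t : ℝ} (hs : s ∈ Icc (0 : ℝ) 1) (ht : t ∈ Icc (0 : ℝ) 1) :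
    ⟪z t, w t⟫_ℂ = ⟪z s, w s⟫_ℂ := by
  have hd : ∀ t ∈ Icc (0 : ℝ) 1, HasDerivWithinAt (fun t => ⟪z t, w t⟫_ℂ) 0 (Icc 0 1) t := by
    intro t ht
    have := (hz t ht).inner ℂ (hw t ht)
    have e : ⟪z t, -(Complex.I • B t (w t))⟫_ℂ + ⟪-(Complex.I • B t (z t)), w t⟫_ℂ = 0 := by
      rw [inner_neg_left, inner_neg_right, inner_smul_left, inner_smul_right, hB.im_symm t ht,
        Complex.conj_I]
      ring
    rwa [e] at this
  have hconst := constant_of_derivWithin_zero (fun t ht => (hd t ht).differentiableWithinAt)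
    fun t ht => (hd t (Ico_subset_Icc_self ht)).derivWithin
      (uniqueDiffOn_Icc zero_lt_one t (Ico_subset_Icc_self ht))
  rw [hconst t ht, hconst s hs]

theorem solutions_eq {Cb : H →L[ℂ] H} {B : ℝ → H →ₗ[ℂ] H}
    (hB : IsBoundedCoefficient Cb B) {z w : ℝ → H}
    (hz : ∀ t ∈ Icc (0 : ℝ) 1, HasDerivWithinAt z (-(Complex.I • B t (z t))) (Icc 0 1) t)
    (hw : ∀ t ∈ Icc (0 : ℝ) 1, HasDerivWithinAt w (-(Complex.I • B t (w t))) (Icc 0 1) t)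
    {s t : ℝ} (hs : s ∈ Icc (0 : ℝ) 1) (ht : t ∈ Icc (0 : ℝ) 1) (h : z s = w s) : z t = w t := by
  have hd : ∀ t ∈ Icc (0 : ℝ) 1, HasDerivWithinAt (fun t => z t - w t)
      (-(Complex.I • B t (z t - w t))) (Icc 0 1) t := by
    intro t ht
    convert! (hz t ht).sub (hw t ht) using 1
    rw [map_sub, smul_sub]
    abel
  have := inner_eq_of_solutions hB hd hd hs ht
  rw [h, sub_self, inner_zero_left] at this
  exact sub_eq_zero.1 (inner_self_eq_zero.1 this)

omit [CompleteSpace H] in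
theorem continuousOn_apply_of_isometry {V : ℝ → H →L[ℂ] H} {s : Set ℝ}
    (h1 : ∀ t ∈ s, ∀ x, ‖V t x‖ = ‖x‖) (h2 : ∀ x, ContinuousOn (fun t => V t x) s) {h : ℝ → H}
    (hh : ContinuousOn h s) : ContinuousOn (fun t => V t (h t)) s := by
  intro t ht
  have e1 : Filter.Tendsto (fun r => V r (h r - h t)) (nhdsWithin t s) (nhds 0) := by
    rw [tendsto_zero_iff_norm_tendsto_zero]
    have : Filter.Tendsto (fun r => ‖h r - h t‖) (nhdsWithin t s) (nhds 0) := by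
      rw [← tendsto_iff_norm_sub_tendsto_zero]
      exact hh t ht
    refine this.congr' ?_
    filter_upwards [self_mem_nhdsWithin] with r hr using (h1 r hr _).symm
  have e2 := e1.add (h2 (h t) t ht)
  simp only [map_sub, sub_add_cancel, zero_add] at e2
  exact e2

/-- The properties of the evolution operators of a bounded coefficient that commutes with `C`. -/
structure IsUnitaryEvolution (Cb : H →L[ℂ] H) (B : ℝ → H →ₗ[ℂ] H) (U : ℝ → ℝ → H →L[ℂ] H) :
    Prop where
  initial : ∀ s ∈ Icc (0 : ℝ) 1, ∀ f, U s s f = f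
  norm_eq : ∀ s ∈ Icc (0 : ℝ) 1, ∀ t ∈ Icc (0 : ℝ) 1, ∀ f, ‖U t s f‖ = ‖f‖
  inner_eq : ∀ s ∈ Icc (0 : ℝ) 1, ∀ t ∈ Icc (0 : ℝ) 1, ∀ f g, ⟪U t s f, U t s g⟫_ℂ = ⟪f, g⟫_ℂ
  comp : ∀ r ∈ Icc (0 : ℝ) 1, ∀ s ∈ Icc (0 : ℝ) 1, ∀ t ∈ Icc (0 : ℝ) 1, ∀ f,
    U t s (U s r f) = U t r f
  comm : ∀ s ∈ Icc (0 : ℝ) 1, ∀ t ∈ Icc (0 : ℝ) 1, ∀ f, Cb (U t s f) = U t s (Cb f)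
  hasDeriv : ∀ s ∈ Icc (0 : ℝ) 1, ∀ t ∈ Icc (0 : ℝ) 1, ∀ f,
    HasDerivWithinAt (fun r => U r s f) (-(Complex.I • B t (U t s f))) (Icc 0 1) t

theorem IsEvolution.isUnitaryEvolution {Cb : H →L[ℂ] H} {B : ℝ → H →ₗ[ℂ] H}
    (hB : IsBoundedCoefficient Cb B) (hBA : ∀ t ∈ Icc (0 : ℝ) 1, ∀ f, (f, B t f) ∈ (Ai t).graph)
    {U : ℝ → ℝ → H →L[ℂ] H} (hU : IsEvolution ⊤ Ai U) : IsUnitaryEvolution Cb B U := by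
  have h0 : ∀ s ∈ Icc (0 : ℝ) 1, ∀ f, U s s f = f := fun s hs f => by rw [hU.initial s hs]; rfl
  have hd : ∀ s ∈ Icc (0 : ℝ) 1, ∀ t ∈ Icc (0 : ℝ) 1, ∀ f,
      HasDerivWithinAt (fun r => U r s f) (-(Complex.I • B t (U t s f))) (Icc 0 1) t := by
    intro s hs t ht f
    obtain ⟨y, hy1, hy2⟩ := hU.equation s hs t ht f Submodule.mem_top
    rwa [LinearPMap.mem_graph_snd_inj _ hy1 (hBA t ht _) rfl] at hy2
  have hi : ∀ s ∈ Icc (0 : ℝ) 1, ∀ t ∈ Icc (0 : ℝ) 1, ∀ f g,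
      ⟪U t s f, U t s g⟫_ℂ = ⟪f, g⟫_ℂ := fun s hs t ht f g => by
    rw [inner_eq_of_solutions hB (fun r hr => hd s hs r hr f) (fun r hr => hd s hs r hr g) hs ht,
      h0 s hs, h0 s hs]
  refine ⟨h0, fun s hs t ht f => ?_, hi, fun r hr s hs t ht f => ?_, fun s hs t ht f => ?_, hd⟩
  · rw [@norm_eq_sqrt_re_inner ℂ, hi s hs t ht, ← @norm_eq_sqrt_re_inner ℂ]
  · exact solutions_eq hB (fun t ht => hd s hs t ht (U s r f)) (fun t ht => hd r hr t ht f) hs ht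
      (h0 s hs _)
  -- `C U(t, s) f` and `U(t, s) C f` solve the same equation and agree at `t = s`.
  · refine solutions_eq (z := fun t => Cb (U t s f)) hB (fun t ht => ?_)
      (fun t ht => hd s hs t ht (Cb f)) hs ht (by simp only [h0 s hs])
    have := (Cb.restrictScalars ℝ).hasFDerivAt.comp_hasDerivWithinAt t (hd s hs t ht f)
    convert! this using 1
    rw [← hB.comm t ht]
    simp

namespace IsUnitaryEvolution

variable {Cb : H →L[ℂ] H} {B : ℝ → H →ₗ[ℂ] H} {U : ℝ → ℝ → H →L[ℂ] H}
  (hU : IsUnitaryEvolution Cb B U)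
include hU

omit [CompleteSpace H] in
theorem continuousOn_fst {s : ℝ} (hs : s ∈ Icc (0 : ℝ) 1) {h : ℝ → H}
    (hh : ContinuousOn h (Icc 0 1)) : ContinuousOn (fun t => U t s (h t)) (Icc 0 1) :=
  continuousOn_apply_of_isometry (fun t ht => hU.norm_eq s hs t ht)
    (fun x t ht => (hU.hasDeriv s hs t ht x).continuousWithinAt) hh

omit [CompleteSpace H] in
theorem continuousOn_snd {s : ℝ} (hs : s ∈ Icc (0 : ℝ) 1) {h : ℝ → H}
    (hh : ContinuousOn h (Icc 0 1)) : ContinuousOn (fun t => U s t (h t)) (Icc 0 1) := by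
  refine continuousOn_apply_of_isometry (fun t ht => hU.norm_eq t ht s hs) (fun x t ht => ?_) hh
  rw [ContinuousWithinAt, tendsto_iff_norm_sub_tendsto_zero]
  have h1 := tendsto_iff_norm_sub_tendsto_zero.1 (hU.hasDeriv t ht t ht x).continuousWithinAt
  refine h1.congr' ?_
  filter_upwards [self_mem_nhdsWithin] with r hr
  rw [hU.initial t ht, ← hU.norm_eq r hr s hs, map_sub, hU.comp t ht r hr s hs, norm_sub_rev]

omit [CompleteSpace H] in
theorem inner_swap {s t : ℝ} (hs : s ∈ Icc (0 : ℝ) 1) (ht : t ∈ Icc (0 : ℝ) 1) (f g : H) :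
    ⟪U s t f, g⟫_ℂ = ⟪f, U t s g⟫_ℂ := by
  rw [← hU.inner_eq s hs t ht, hU.comp t ht s hs t ht, hU.initial t ht]

omit [CompleteSpace H] in
-- Since `U(s, r) f - U(s, t) f = -U(s, r) (U(r, t) f - f)`, the derivative in the second variable
-- follows from the one in the first, using only isometry and strong continuity.
theorem hasDeriv_snd {s t : ℝ} (hs : s ∈ Icc (0 : ℝ) 1) (ht : t ∈ Icc (0 : ℝ) 1) (f : H) :
    HasDerivWithinAt (fun r => U s r f) (Complex.I • U s t (B t f)) (Icc 0 1) t := by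
  have h1 := hasDerivWithinAt_iff_tendsto.1 (hU.hasDeriv t ht t ht f)
  have h2 := tendsto_iff_norm_sub_tendsto_zero.1
    (hU.continuousOn_snd hs (continuousOn_const (c := Complex.I • B t f)) t ht)
  rw [hU.initial t ht] at h1
  rw [hasDerivWithinAt_iff_tendsto]
  have h3 := h1.add h2
  rw [add_zero] at h3
  refine squeeze_zero' (Filter.Eventually.of_forall fun r => by positivity) ?_ h3
  filter_upwards [self_mem_nhdsWithin] with r hr
  have e1 : U s r f - U s t f - (r - t) • (Complex.I • U s t (B t f)) =
      -U s r (U r t f - f - (r - t) • -(Complex.I • B t f)) +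
        (r - t) • (U s r (Complex.I • B t f) - U s t (Complex.I • B t f)) := by
    rw [map_sub, map_sub, hU.comp t ht r hr s hs, ContinuousLinearMap.map_smul_of_tower, map_neg,
      map_smul (U s t)]
    module
  have e2 := norm_add_le (-U s r (U r t f - f - (r - t) • -(Complex.I • B t f)))
    ((r - t) • (U s r (Complex.I • B t f) - U s t (Complex.I • B t f)))
  rw [← e1, norm_neg, hU.norm_eq r hr s hs, norm_smul] at e2
  have e3 : ‖r - t‖⁻¹ * ‖r - t‖ ≤ 1 := inv_mul_le_one
  have e4 := mul_le_mul_of_nonneg_left e2 (inv_nonneg.2 (norm_nonneg (r - t)))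
  refine e4.trans ?_
  rw [mul_add, ← mul_assoc]
  exact add_le_add_right (mul_le_of_le_one_left (norm_nonneg _) e3) _

end IsUnitaryEvolution

end Evolution

/-! ### From the weak equation to a differential equation for `y = U(0, t) √α u`. -/

section WeakEquation

variable {H : Type*} [NormedAddCommGroup H] [InnerProductSpace ℂ H] {α : ℝ → ℝ}

theorem IsWeight.continuousOn_sqrt (hα : IsWeight α) : ContinuousOn (fun t => √(α t)) (Icc 0 1) :=
  Real.continuous_sqrt.comp_continuousOn hα.continuousOn

/-- A scalar function is zero if it is orthogonal to all `√α φ`, with `φ` supported where the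
weight is positive. -/
theorem IsWeight.ae_eq_zero_of_integral_sqrt_mul (hα : IsWeight α) {s : ℝ → ℂ}
    (hs : IntegrableOn s (Ioo 0 1))
    (h : ∀ φ : ℝ → ℂ, IsTestFunction φ → tsupport φ ⊆ posSet α →
      ∫ t in Ioo (0 : ℝ) 1, starRingEnd ℂ (φ t) * (√(α t) * s t) = 0) :
    ∀ᵐ t ∂(volume.restrict (Ioo (0 : ℝ) 1)), s t = 0 := by
  have hi : IntegrableOn (fun t => (√(α t) : ℂ) * s t) (Ioo 0 1) := by
    obtain ⟨K, hK⟩ := isCompact_Icc.exists_bound_of_continuousOn hα.continuousOn_sqrt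
    refine Integrable.bdd_mul (c := K) hs ?_ ?_
    · exact ((Complex.continuous_ofReal.comp_continuousOn hα.continuousOn_sqrt).mono
        Ioo_subset_Icc_self).aestronglyMeasurable measurableSet_Ioo
    · rw [ae_restrict_iff' measurableSet_Ioo]
      refine ae_of_all _ fun t ht => ?_
      rw [Complex.norm_real]
      exact hK t (Ioo_subset_Icc_self ht)
  have key := hα.isOpen_posSet.ae_eq_zero_of_integral_contDiff_smul_eq_zero (μ := volume)
    (f := fun t => (√(α t) : ℂ) * s t) (hi.mono_set posSet_subset).locallyIntegrableOn ?_
  · filter_upwards [ae_restrict_of_ae key, hα.ae_mem_posSet] with t h1 h2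
    refine (mul_eq_zero.1 (h1 h2)).resolve_left ?_
    exact_mod_cast (Real.sqrt_pos.2 h2.2).ne'
  · intro g hg hgc hgs
    have hts : tsupport (fun t => (g t : ℂ)) ⊆ tsupport g :=
      closure_mono fun t ht h0 => ht (by simp [h0])
    rw [← h (fun t => (g t : ℂ)) ⟨Complex.ofRealCLM.contDiff.comp hg,
      hgc.comp_left (g := ((↑) : ℝ → ℂ)) Complex.ofReal_zero,
      hts.trans (hgs.trans posSet_subset)⟩ (hts.trans hgs), ← integral_indicator measurableSet_Ioo]
    refine integral_congr_ae (ae_of_all _ fun t => ?_)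
    by_cases ht : t ∈ Ioo (0 : ℝ) 1
    · simp [ht]
    · have : g t = 0 := image_eq_zero_of_notMem_tsupport fun h' => ht (hgs h').1
      simp [this, indicator_of_notMem ht]

/-- `√α φ` is continuously differentiable for `φ` supported where the weight is positive. -/
theorem IsWeight.hasDerivAt_sqrt_mul (hα : IsWeight α) {φ : ℝ → ℂ} (hφ : IsTestFunction φ)
    (hs : tsupport φ ⊆ posSet α) (t : ℝ) :
    HasDerivAt (fun t => (√(α t) : ℂ) * φ t)
      ((√(α t) : ℂ) * (deriv φ t + ((deriv α t / (2 * α t) : ℝ) : ℂ) * φ t)) t := by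
  by_cases ht : t ∈ tsupport φ
  · have hp := hs ht
    have h1 := (((hα.hasDerivAt hp.1).sqrt hp.2.ne').ofReal_comp).mul (hφ.hasDerivAt t)
    convert! h1 using 1
    have h2 : √(α t) ≠ 0 := (Real.sqrt_pos.2 hp.2).ne'
    have h3 : √(α t) * (deriv α t / (2 * α t)) = deriv α t / (2 * √(α t)) := by
      nth_rewrite 2 [← Real.mul_self_sqrt hp.2.le]
      field_simp
    rw [← h3]
    push_cast
    ring
  · have h0 : φ =ᶠ[nhds t] 0 := notMem_tsupport_iff_eventuallyEq.1 ht
    have hz : (fun t => (√(α t) : ℂ) * φ t) =ᶠ[nhds t] fun _ => 0 := by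
      filter_upwards [h0] with r hr
      simp [hr]
    have h1 : φ t = 0 := h0.eq_of_nhds
    have h2 : deriv φ t = 0 := by rw [h0.deriv_eq]; simp
    rw [h1, h2]
    simpa using (hasDerivAt_const t (0 : ℂ)).congr_of_eventuallyEq hz

variable [CompleteSpace H] [TopologicalSpace.SeparableSpace H]
  {Cb : H →L[ℂ] H} {B : ℝ → H →ₗ[ℂ] H} {U : ℝ → ℝ → H →L[ℂ] H}

omit [CompleteSpace H] [TopologicalSpace.SeparableSpace H] in
theorem IsWeight.integrableOn_sqrt_smul (hα : IsWeight α) (h : L2w H α) :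
    IntegrableOn (fun t => (√(α t) : ℂ) • h t) (Ioo 0 1) := by
  have hfin : IsFiniteMeasure (volume.restrict (Ioo (0 : ℝ) 1)) := inferInstance
  have hm : AEStronglyMeasurable (fun t => (√(α t) : ℂ) • h t) (volume.restrict (Ioo (0 : ℝ) 1)) :=
    (((Complex.continuous_ofReal.comp_continuousOn hα.continuousOn_sqrt).mono
        Ioo_subset_Icc_self).aestronglyMeasurable measurableSet_Ioo).smul
      ((Lp.aestronglyMeasurable h).mono_ac hα.absolutelyContinuous)
  have h2 : Integrable (fun t => ‖h t‖ ^ 2) (weightMeasure α) :=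
    (memLp_two_iff_integrable_sq_norm (Lp.aestronglyMeasurable h)).1 (Lp.memLp h)
  rw [hα.integrable_weightMeasure_iff] at h2
  refine MemLp.integrable (q := 2) (by norm_num) ((memLp_two_iff_integrable_sq_norm hm).2 ?_)
  refine Integrable.congr h2 ?_
  filter_upwards [hα.ae_pos] with t ht
  rw [norm_smul, Complex.norm_real, mul_pow, Real.norm_eq_abs, sq_abs, Real.sq_sqrt ht.le,
    smul_eq_mul]

/-- The weak form of `L u = h` on `φ f`, added to integration by parts of `y` against `√α φ U(0, t)
f`, cancels the `A_i` terms and those with `α'`. This leaves `y' = -C y + U(0, t) √α h` against each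
fixed `f`. -/
theorem ae_eq_of_mem_graph_maximalOp (hα : IsWeight α) (hB : IsBoundedCoefficient Cb B)
    (hU : IsUnitaryEvolution Cb B U) {u h : L2w H α}
    (huh : (u, h) ∈ (formalGraph α (⊤ : Submodule ℂ H) Cb (fun f t => B t f) (-1)
      ).toLinearPMap.closure.adjoint.graph)
    {v g : ℝ → H} (hvu : Represents α v u) (hg : IntegrableOn g (Ioo 0 1))
    (hy : ∀ t ∈ Icc (0 : ℝ) 1, U 0 t (v t) = U 0 0 (v 0) + ∫ s in (0 : ℝ)..t, g s) :
    ∀ᵐ t ∂(volume.restrict (Ioo (0 : ℝ) 1)),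
      g t = -Cb (U 0 t (v t)) + U 0 t ((√(α t) : ℂ) • h t) := by
  have hF := hB.isFormalCoefficient
  have h01 : (0 : ℝ) ∈ Icc (0 : ℝ) 1 := ⟨le_rfl, zero_le_one⟩
  set y : ℝ → H := fun t => U 0 t (v t) with hydef
  have hyc : ContinuousOn y (Icc 0 1) := continuousOn_of_primitive hg hy
  have hyi : IntegrableOn y (Ioo 0 1) := hyc.integrableOn_Icc.mono_set Ioo_subset_Icc_self
  have hhi := hα.integrableOn_sqrt_smul h
  rw [mem_graph_adjoint_closure_iff hα hF] at huh
  have key : ∀ f : H, ∀ᵐ t ∂(volume.restrict (Ioo (0 : ℝ) 1)),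
      ⟪U 0 t f, g t + Cb (y t)⟫_ℂ - ⟪f, (√(α t) : ℂ) • h t⟫_ℂ = 0 := by
    intro f
    have hUf : ContinuousOn (fun t => U 0 t f) (Icc 0 1) :=
      hU.continuousOn_snd h01 continuousOn_const
    have hCy : IntegrableOn (fun t => Cb (y t)) (Ioo 0 1) :=
      (Cb.continuous.comp_continuousOn hyc).integrableOn_Icc.mono_set Ioo_subset_Icc_self
    refine hα.ae_eq_zero_of_integral_sqrt_mul
      ((integrableOn_inner_of_continuousOn hUf (hg.add hCy)).sub (hhi.const_inner f))
      fun φ hφ hs => ?_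
    have hd := hα.hasDerivAt_sqrt_mul hφ hs
    set ψ : ℝ → ℂ := fun t => (√(α t) : ℂ) * φ t with hψ
    set ψ' : ℝ → ℂ := fun t =>
      (√(α t) : ℂ) * (deriv φ t + ((deriv α t / (2 * α t) : ℝ) : ℂ) * φ t) with hψ'
    have hψc : ContinuousOn ψ (Icc 0 1) := fun t _ => (hd t).continuousAt.continuousWithinAt
    have hψ'c : ContinuousOn ψ' (Icc 0 1) :=
      (Complex.continuous_ofReal.comp_continuousOn hα.continuousOn_sqrt).mul
        (hφ.continuous_deriv.add
          (hα.continuous_mul hφ.continuous hs hα.continuousOn_logDeriv)).continuousOn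
    have hUB : ContinuousOn (fun t => Complex.I • U 0 t (B t f)) (Icc 0 1) :=
      (hU.continuousOn_snd h01 (hB.im_continuousOn f)).const_smul _
    have hpd : ∀ t ∈ Icc (0 : ℝ) 1, HasDerivWithinAt (fun t => ψ t • U 0 t f)
        (ψ t • (Complex.I • U 0 t (B t f)) + ψ' t • U 0 t f) (Icc 0 1) t := fun t ht =>
      (hd t).hasDerivWithinAt.smul (hU.hasDeriv_snd h01 ht f)
    have hp'c := (hψc.smul hUB).add (hψ'c.smul hUf)
    have hpc := hψc.smul hUf
    have ibp := integral_inner_primitive hpd hp'c hg hy ⟨zero_le_one, le_rfl⟩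
    have z0 : ψ 0 = 0 := by simp [hψ, hφ.eq_zero (t := 0) (by simp)]
    have z1 : ψ 1 = 0 := by simp [hψ, hφ.eq_zero (t := 1) (by simp)]
    rw [z0, z1, zero_smul, zero_smul, inner_zero_left, inner_zero_left, sub_zero] at ibp
    have hp'i := integrableOn_inner_of_continuousOn hp'c hyi
    have hpi := integrableOn_inner_of_continuousOn hpc hg
    have weak := sub_eq_zero.2 (huh _ (testElement_mem hα hF (-1) hφ hs (f := f) Submodule.mem_top))
    rw [L2.inner_def, L2.inner_def,
      ← integral_sub (L2.integrable_inner _ _) (L2.integrable_inner _ _),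
      hα.integral_weightMeasure] at weak
    have weak_int : IntegrableOn (fun t => α t • (⟪testImage hα hφ hs (-1) f (Cb f)
        (hF.im_continuousOn f Submodule.mem_top) t, u t⟫_ℂ - ⟪testElement hα hφ f t, h t⟫_ℂ))
        (Ioo 0 1) :=
      (hα.integrable_weightMeasure_iff _).1
        ((L2.integrable_inner _ _).sub (L2.integrable_inner _ _))
    have tot := congrArg₂ (· + ·) ibp weak
    simp only [add_zero] at tot
    refine Eq.trans (Eq.symm ?_) tot
    erw [← integral_add (hp'i.add hpi) weak_int]
    refine integral_congr_ae ?_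
    filter_upwards [hα.ae_iff.1 (testImage_ae hα hφ hs (-1) f (Cb f)
        (hF.im_continuousOn f Submodule.mem_top)), hα.ae_iff.1 (testElement_ae hα hφ f),
        hα.ae_iff.1 hvu, hα.ae_mem_posSet] with t e1 e2 e3 e4
    have ht := Ioo_subset_Icc_self e4.1
    have h5 : ((√(α t) : ℝ) : ℂ) ≠ 0 := by exact_mod_cast (Real.sqrt_pos.2 e4.2).ne'
    have h6 : ((α t : ℝ) : ℂ) = ((√(α t) : ℝ) : ℂ) * ((√(α t) : ℝ) : ℂ) := by
      exact_mod_cast (Real.mul_self_sqrt e4.2.le).symm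
    have hin : ∀ w : H, ⟪w, u t⟫_ℂ * (√(α t) : ℂ) = ⟪U 0 t w, y t⟫_ℂ := fun w => by
      rw [hydef, hU.inner_eq t ht 0 h01, e3, inner_smul_right, mul_comm]
    have hC : ⟪U 0 t f, Cb (y t)⟫_ℂ = ⟪U 0 t (Cb f), y t⟫_ℂ := by
      rw [← hU.comm t ht 0 h01, ← ContinuousLinearMap.adjoint_inner_left, hB.symm.adjoint_eq]
    have hexp : (√(α t) : ℂ) * ⟪formalExpr α (-1) φ f (Cb f) (fun t => B t f) t, u t⟫_ℂ =
        ⟪U 0 t (formalExpr α (-1) φ f (Cb f) (fun t => B t f) t), y t⟫_ℂ := by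
      rw [← hin, mul_comm]
    simp only [Pi.add_apply, Pi.smul_apply']
    rw [e1, e2, Complex.real_smul, h6, mul_sub, mul_assoc, hexp]
    simp only [formalExpr, hψ, hψ', map_add, map_smul, inner_add_left, inner_add_right,
      inner_smul_left, inner_smul_right, map_mul, Complex.conj_ofReal, Complex.conj_I, hC]
    push_cast
    ring
  -- The exceptional null set depends on `f`; separability provides a common one for a dense
  -- sequence, hence for all `f`.
  have hall := ae_all_iff.2 fun n => key (TopologicalSpace.denseSeq H n)
  filter_upwards [hall, ae_restrict_mem measurableSet_Ioo] with t h1 h2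
  have ht := Ioo_subset_Icc_self h2
  have h3 : g t + Cb (y t) - U 0 t ((√(α t) : ℂ) • h t) = 0 := by
    have h4 : ∀ f : H, ⟪U 0 t f, g t + Cb (y t)⟫_ℂ - ⟪f, (√(α t) : ℂ) • h t⟫_ℂ = 0 := by
      intro f
      have hcl : IsClosed {f : H | ⟪U 0 t f, g t + Cb (y t)⟫_ℂ - ⟪f, (√(α t) : ℂ) • h t⟫_ℂ = 0} :=
        isClosed_eq (by fun_prop) continuous_const
      refine closure_minimal (s := range (TopologicalSpace.denseSeq H)) ?_ hcl
        (TopologicalSpace.denseRange_denseSeq H f)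
      rintro _ ⟨n, rfl⟩
      exact h1 n
    refine ext_inner_left ℂ fun w => ?_
    have h5 := h4 (U t 0 w)
    rw [hU.comp 0 h01 t ht 0 h01, hU.initial 0 h01, hU.inner_swap ht h01] at h5
    rw [inner_sub_right, h5, inner_zero_right]
  rw [eq_comm, neg_add_eq_iff_eq_add, eq_comm, add_comm]
  exact sub_eq_zero.1 h3

end WeakEquation

/-! ### The group `e^{tP}` and Duhamel's formula. -/

section Exponential

variable {H : Type*} [NormedAddCommGroup H] [InnerProductSpace ℂ H] [CompleteSpace H]

/-- The group `e^{t P}` generated by a bounded operator. -/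
def expFamily (P : H →L[ℂ] H) (t : ℝ) : H →L[ℂ] H := NormedSpace.exp (t • P)

theorem expFamily_zero (P : H →L[ℂ] H) : expFamily P 0 = 1 := by
  rw [expFamily, zero_smul, NormedSpace.exp_zero]

theorem hasDerivAt_expFamily (P : H →L[ℂ] H) (t : ℝ) (x : H) :
    HasDerivAt (fun t => expFamily P t x) (P (expFamily P t x)) t := by
  have h := hasDerivAt_exp_smul_const' (𝕂 := ℝ) P t
  exact ((ContinuousLinearMap.apply ℂ H x).restrictScalars ℝ).hasFDerivAt.comp_hasDerivAt t h

theorem continuous_expFamily (P : H →L[ℂ] H) (x : H) : Continuous fun t => expFamily P t x :=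
  continuous_iff_continuousAt.2 fun t => (hasDerivAt_expFamily P t x).continuousAt

theorem expFamily_mul_neg (P : H →L[ℂ] H) (t : ℝ) : expFamily P t * expFamily (-P) t = 1 := by
  let _ : NormedAlgebra ℚ (H →L[ℂ] H) := .restrictScalars ℚ ℂ (H →L[ℂ] H)
  rw [expFamily, expFamily, smul_neg, ← NormedSpace.exp_add_of_commute, add_neg_cancel,
    NormedSpace.exp_zero]
  exact (Commute.refl _).neg_right

theorem expFamily_neg_mul (P : H →L[ℂ] H) (t : ℝ) : expFamily (-P) t * expFamily P t = 1 := by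
  simpa using expFamily_mul_neg (-P) t

theorem star_expFamily (P : H →L[ℂ] H) (t : ℝ) : star (expFamily P t) = expFamily (star P) t := by
  rw [expFamily, expFamily, NormedSpace.star_exp, star_smul, star_trivial]

theorem commute_expFamily {P Q : H →L[ℂ] H} (h : Commute Q P) (t : ℝ) :
    Commute Q (expFamily P t) :=
  (h.smul_right t).exp_right

theorem exists_norm_expFamily_apply_le (P : H →L[ℂ] H) :
    ∃ K, 0 ≤ K ∧ ∀ t ∈ Icc (0 : ℝ) 1, ∀ x, ‖expFamily P t x‖ ≤ K * ‖x‖ := by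
  have hc : Continuous (expFamily P) :=
    continuous_iff_continuousAt.2 fun t => (hasDerivAt_exp_smul_const' (𝕂 := ℝ) P t).continuousAt
  obtain ⟨K, hK⟩ := isCompact_Icc.exists_bound_of_continuousOn (s := Icc (0 : ℝ) 1) hc.continuousOn
  exact ⟨max K 0, le_max_right _ _, fun t ht x => (ContinuousLinearMap.le_opNorm _ _).trans
    (mul_le_mul_of_nonneg_right ((hK t ht).trans (le_max_left _ _)) (norm_nonneg _))⟩

/-- Duhamel's formula for `y' = P y + k`, tested against the adjoint group. -/
theorem inner_expFamily_duhamel (P : H →L[ℂ] H) {y g k : ℝ → H} (hg : IntegrableOn g (Ioo 0 1))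
    (hy : ∀ t ∈ Icc (0 : ℝ) 1, y t = y 0 + ∫ s in (0 : ℝ)..t, g s)
    (hgk : ∀ᵐ t ∂(volume.restrict (Ioo (0 : ℝ) 1)), g t = P (y t) + k t)
    {τ : ℝ} (hτ : τ ∈ Icc (0 : ℝ) 1) (x : H) :
    ⟪expFamily (-star P) τ x, y τ⟫_ℂ - ⟪x, y 0⟫_ℂ =
      ∫ t in Ioo 0 τ, ⟪expFamily (-star P) t x, k t⟫_ℂ := by
  have ibp := integral_inner_primitive
    (fun t _ => (hasDerivAt_expFamily (-star P) t x).hasDerivWithinAt)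
    (((-star P).continuous.comp (continuous_expFamily (-star P) x)).continuousOn) hg hy hτ
  have e0 : expFamily (-star P) 0 x = x := by rw [expFamily_zero]; rfl
  rw [e0] at ibp
  rw [← ibp]
  refine integral_congr_ae ?_
  filter_upwards [ae_restrict_of_ae_restrict_of_subset (Ioo_subset_Ioo_right hτ.2) hgk] with t ht
  have e1 : ⟪(-star P) (expFamily (-star P) t x), y t⟫_ℂ =
      -⟪expFamily (-star P) t x, P (y t)⟫_ℂ := by
    rw [neg_apply, inner_neg_left, ContinuousLinearMap.star_eq_adjoint,
      ContinuousLinearMap.adjoint_inner_left]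
  rw [ht, inner_add_right, e1]
  ring

/-- A solution of `y' = P y` is `e^{t P} y(0)`. -/
theorem eq_expFamily_apply (P : H →L[ℂ] H) {y g : ℝ → H} (hg : IntegrableOn g (Ioo 0 1))
    (hy : ∀ t ∈ Icc (0 : ℝ) 1, y t = y 0 + ∫ s in (0 : ℝ)..t, g s)
    (hgk : ∀ᵐ t ∂(volume.restrict (Ioo (0 : ℝ) 1)), g t = P (y t))
    {τ : ℝ} (hτ : τ ∈ Icc (0 : ℝ) 1) : y τ = expFamily P τ (y 0) := by
  refine ext_inner_left ℂ fun z => ?_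
  -- Testing with `e^{τ P*} z` undoes the factor `e^{-τ P*}` and leaves `⟨z, y(τ)⟩`.
  have h := inner_expFamily_duhamel P (k := 0) hg hy (by simpa using hgk) hτ
    (expFamily (star P) τ z)
  have e1 : expFamily (-star P) τ (expFamily (star P) τ z) = z := by
    rw [← mul_apply_eq_comp, expFamily_neg_mul]
    rfl
  rw [e1, ← star_expFamily, ContinuousLinearMap.star_eq_adjoint,
    ContinuousLinearMap.adjoint_inner_left] at h
  simpa [sub_eq_zero] using h

end Exponential

/-! ### Lifting vectors of `H` to homogeneous solutions in `L²_α`. -/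

section Lift

variable {H : Type*} [NormedAddCommGroup H] [InnerProductSpace ℂ H] [CompleteSpace H] {α : ℝ → ℝ}
  {Cb : H →L[ℂ] H} {B : ℝ → H →ₗ[ℂ] H} {U : ℝ → ℝ → H →L[ℂ] H}

omit [InnerProductSpace ℂ H] [CompleteSpace H] in
theorem memLp_sqrt_inv_smul [NormedSpace ℂ H] (hα : IsWeight α) {F : ℝ → H}
    (hF : ContinuousOn F (Icc 0 1)) :
    MemLp (fun t => ((√(α t))⁻¹ : ℂ) • F t) 2 (weightMeasure α) := by
  have hm : AEStronglyMeasurable (fun t => ((√(α t))⁻¹ : ℂ) • F t)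
      (volume.restrict (Ioo (0 : ℝ) 1)) :=
    ((((Complex.continuous_ofReal.comp_continuousOn hα.continuousOn_sqrt).mono
        Ioo_subset_Icc_self).aemeasurable measurableSet_Ioo).inv.aestronglyMeasurable).smul
      ((hF.mono Ioo_subset_Icc_self).aestronglyMeasurable measurableSet_Ioo)
  rw [memLp_two_iff_integrable_sq_norm (hm.mono_ac IsWeight.weightMeasure_absolutelyContinuous),
    hα.integrable_weightMeasure_iff]
  refine (((hF.norm.pow 2).integrableOn_Icc.mono_set Ioo_subset_Icc_self).congr ?_)
  filter_upwards [hα.ae_pos] with t ht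
  rw [norm_smul, norm_inv, Complex.norm_real, mul_pow, inv_pow, Real.norm_eq_abs, sq_abs,
    Real.sq_sqrt ht.le, smul_eq_mul, mul_inv_cancel_left₀ ht.ne']
  rfl

/-- `x ↦ α^{-1/2} U(t, 0) e^{t P} x`. -/
theorem exists_lift (hα : IsWeight α) (hU : IsUnitaryEvolution Cb B U) (P : H →L[ℂ] H) :
    ∃ J : H →L[ℂ] L2w H α, ∀ x, ∀ᵐ t ∂(weightMeasure α),
      J x t = ((√(α t))⁻¹ : ℂ) • U t 0 (expFamily P t x) := by
  have h01 : (0 : ℝ) ∈ Icc (0 : ℝ) 1 := ⟨le_rfl, zero_le_one⟩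
  have hmem : ∀ x, MemLp (fun t => ((√(α t))⁻¹ : ℂ) • U t 0 (expFamily P t x)) 2
      (weightMeasure α) := fun x =>
    memLp_sqrt_inv_smul hα (hU.continuousOn_fst h01 (continuous_expFamily P x).continuousOn)
  let Jl : H →ₗ[ℂ] L2w H α :=
    { toFun := fun x => (hmem x).toLp
      map_add' := fun x y => by
        rw [← MemLp.toLp_add]
        congr 1
        ext t
        simp
      map_smul' := fun r x => by
        rw [RingHom.id_apply, ← MemLp.toLp_const_smul]
        congr 1
        ext t
        simp [smul_comm r] }
  have hJ : ∀ x, ∀ᵐ t ∂(weightMeasure α),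
      Jl x t = ((√(α t))⁻¹ : ℂ) • U t 0 (expFamily P t x) := fun x => (hmem x).coeFn_toLp
  obtain ⟨K, hK0, hK⟩ := exists_norm_expFamily_apply_le P
  refine ⟨Jl.mkContinuous K fun x => ?_, hJ⟩
  -- The weight cancels `α^{-1}` and `U(t, 0)` is isometric.
  have h1 : ‖Jl x‖ ^ 2 = ∫ t in Ioo (0 : ℝ) 1, ‖expFamily P t x‖ ^ 2 := by
    have h2 : ((‖Jl x‖ ^ 2 : ℝ) : ℂ) = ⟪Jl x, Jl x⟫_ℂ := by
      rw [inner_self_eq_norm_sq_to_K]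
      push_cast
      rfl
    refine Complex.ofReal_injective ?_
    rw [h2, L2.inner_def, hα.integral_weightMeasure, ← integral_complex_ofReal]
    refine integral_congr_ae ?_
    filter_upwards [hα.ae_iff.1 (hJ x), hα.ae_pos, ae_restrict_mem measurableSet_Ioo] with t e1 e2 e3
    have h6 : (((√(α t) : ℝ) : ℂ)) * ((√(α t) : ℝ) : ℂ) = ((α t : ℝ) : ℂ) := by
      exact_mod_cast Real.mul_self_sqrt e2.le
    have h7 : ((√(α t) : ℝ) : ℂ) ≠ 0 := by exact_mod_cast (Real.sqrt_pos.2 e2).ne'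
    rw [e1, inner_smul_left, inner_smul_right, hU.inner_eq 0 h01 t (Ioo_subset_Icc_self e3),
      inner_self_eq_norm_sq_to_K, Complex.real_smul, ← h6]
    simp only [map_inv₀, Complex.conj_ofReal]
    push_cast
    field_simp
    rfl
  refine (sq_le_sq₀ (norm_nonneg _) (by positivity)).1 ?_
  rw [h1]
  calc ∫ t in Ioo (0 : ℝ) 1, ‖expFamily P t x‖ ^ 2
      ≤ ∫ t in Ioo (0 : ℝ) 1, (K * ‖x‖) ^ 2 := by
        refine setIntegral_mono_on ?_ (integrableOn_const (by simp)) measurableSet_Ioo fun t ht => ?_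
        · exact ((continuous_expFamily P x).norm.pow 2).continuousOn.integrableOn_Icc.mono_set
            Ioo_subset_Icc_self
        · have := hK t (Ioo_subset_Icc_self ht) x
          gcongr
    _ = (K * ‖x‖) ^ 2 := by simp

/-- With `-P*` in place of `P` this identifies the adjoint of the lift as `q ↦ ∫ e^{-tP} U(0, t) √α
q dt`, the Duhamel integral. -/
theorem inner_lift (hα : IsWeight α) (hU : IsUnitaryEvolution Cb B U) {P : H →L[ℂ] H}
    {J : H →L[ℂ] L2w H α} (hJ : ∀ x, ∀ᵐ t ∂(weightMeasure α),
      J x t = ((√(α t))⁻¹ : ℂ) • U t 0 (expFamily P t x)) (x : H) (q : L2w H α) :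
    ⟪J x, q⟫_ℂ =
      ∫ t in Ioo (0 : ℝ) 1, ⟪expFamily P t x, U 0 t ((√(α t) : ℂ) • q t)⟫_ℂ := by
  have h01 : (0 : ℝ) ∈ Icc (0 : ℝ) 1 := ⟨le_rfl, zero_le_one⟩
  rw [L2.inner_def, hα.integral_weightMeasure]
  refine integral_congr_ae ?_
  filter_upwards [hα.ae_iff.1 (hJ x), hα.ae_pos, ae_restrict_mem measurableSet_Ioo] with t e1 e2 e3
  have h6 : (((√(α t) : ℝ) : ℂ)) * ((√(α t) : ℝ) : ℂ) = ((α t : ℝ) : ℂ) := by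
    exact_mod_cast Real.mul_self_sqrt e2.le
  have h7 : ((√(α t) : ℝ) : ℂ) ≠ 0 := by exact_mod_cast (Real.sqrt_pos.2 e2).ne'
  rw [e1, ← hU.inner_swap (Ioo_subset_Icc_self e3) h01, inner_smul_left, inner_smul_right,
    Complex.real_smul, ← h6]
  simp only [map_inv₀, Complex.conj_ofReal]
  field_simp

end Lift

/-! ### The boundary value problem and the difference of the resolvents. -/

section Resolvent

variable {H : Type*} [NormedAddCommGroup H] [InnerProductSpace ℂ H] [CompleteSpace H]
  [TopologicalSpace.SeparableSpace H] {α : ℝ → ℝ}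
  {A Ar Ai : ℝ → H →ₗ.[ℂ] H} {C : H →ₗ.[ℂ] H}
  {Cb : H →L[ℂ] H} {B : ℝ → H →ₗ[ℂ] H} {U : ℝ → ℝ → H →L[ℂ] H}

theorem resolvent_spec {E : Type*} [NormedAddCommGroup E] [InnerProductSpace ℂ E] {T : E →ₗ.[ℂ] E}
    {lam : ℂ} (h : lam ∈ resolventSet T) : IsResolventAt T lam (resolvent T lam) := by
  rw [resolvent, dif_pos h]
  exact h.choose_spec

/-- The boundary value problem solved by the functions `U(0, t) √α (R_λ(L_W) q)(t)`. -/
theorem exists_solution_of_resolvent (hα : IsWeight α) (hA : IsCoefficient α ⊤ A Ar Ai C)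
    (hC : ∀ f, (f, Cb f) ∈ C.graph) (hBA : ∀ t ∈ Icc (0 : ℝ) 1, ∀ f, (f, B t f) ∈ (Ai t).graph)
    (hB : IsBoundedCoefficient Cb B) (hU : IsUnitaryEvolution Cb B U) {W : H →L[ℂ] H} {lam : ℂ}
    {R : L2w H α →L[ℂ] L2w H α} (hR : IsResolventAt (extensionOp α ⊤ A U W) lam R)
    (q : L2w H α) :
    ∃ y g : ℝ → H, IntegrableOn g (Ioo 0 1) ∧
      (∀ t ∈ Icc (0 : ℝ) 1, y t = y 0 + ∫ s in (0 : ℝ)..t, g s) ∧ y 1 = W (y 0) ∧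
      (∀ᵐ t ∂(weightMeasure α), R q t = ((√(α t))⁻¹ : ℂ) • U t 0 (y t)) ∧
      ∀ᵐ t ∂(volume.restrict (Ioo (0 : ℝ) 1)),
        g t = (lam • (1 : H →L[ℂ] H) - Cb) (y t) + U 0 t ((√(α t) : ℂ) • q t) := by
  have h01 : (0 : ℝ) ∈ Icc (0 : ℝ) 1 := ⟨le_rfl, zero_le_one⟩
  have h11 : (1 : ℝ) ∈ Icc (0 : ℝ) 1 := ⟨zero_le_one, le_rfl⟩
  obtain ⟨hdom, hRq⟩ := hR.1 q
  obtain ⟨⟨-, v, ⟨g, hg, hy⟩, hvu, hbc⟩, hdom2⟩ := id hdom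
  have hgi : IntegrableOn g (Ioo 0 1) := hg.integrable (by norm_num)
  have hgraph : (R q, lam • R q + q) ∈ (maximalOp α ⊤ A).graph := by
    have : (maximalOp α ⊤ A) ⟨R q, hdom2⟩ = lam • R q + q := by
      rw [← sub_eq_iff_eq_add']
      exact hRq
    rw [← this]
    exact LinearPMap.mem_graph _ ⟨R q, hdom2⟩
  rw [hA.maximalOp_eq (fun f _ => hC f) (fun f _ t ht => hBA t ht f) hα
    hB.isFormalCoefficient] at hgraph
  have hode := ae_eq_of_mem_graph_maximalOp hα hB hU hgraph hvu hgi hy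
  refine ⟨fun t => U 0 t (v t), g, hgi, hy, ?_, ?_, ?_⟩
  · simp only [hbc]
    rw [hU.comp 0 h01 1 h11 0 h01, hU.initial 0 h01, hU.initial 0 h01]
  · rw [hα.ae_iff]
    filter_upwards [hα.ae_iff.1 hvu, hα.ae_pos, ae_restrict_mem measurableSet_Ioo] with t e1 e2 e3
    have h7 : ((√(α t) : ℝ) : ℂ) ≠ 0 := by exact_mod_cast (Real.sqrt_pos.2 e2).ne'
    have ht := Ioo_subset_Icc_self e3
    rw [hU.comp t ht 0 h01 t ht, hU.initial t ht, e1, smul_smul, inv_mul_cancel₀ h7, one_smul]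
  · filter_upwards [hode, hα.ae_iff.1 hvu, hα.ae_iff.1 (Lp.coeFn_add (lam • R q) q),
      hα.ae_iff.1 (Lp.coeFn_smul lam (R q))] with t e1 e2 e3 e4
    rw [e1, e3, Pi.add_apply, e4, Pi.smul_apply, smul_add, map_add, smul_comm, ← e2]
    simp only [map_smul, sub_apply, smul_apply,
      one_apply_eq_self]
    abel

omit [TopologicalSpace.SeparableSpace H] in
/-- `1 - e^{-P} W` is normal, hence invertible as soon as it is onto. -/
theorem isUnit_of_surjective_expFamily {P W : H →L[ℂ] H} (hW : W ∈ unitary (H →L[ℂ] H))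
    (hP : Commute (star P) P) (hWP : Commute W P) (hWP' : Commute W (star P))
    (h : Function.Surjective (expFamily (-P) 1 * W - 1 : H →L[ℂ] H)) :
    IsUnit (expFamily (-P) 1 * W - 1) := by
  set E := expFamily (-P) 1 with hE
  have hEs : star E = expFamily (-star P) 1 := by rw [hE, star_expFamily, star_neg]
  have c1 : Commute W E := commute_expFamily hWP.neg_right 1
  have c2 : Commute W (star E) := by
    rw [hEs]
    exact commute_expFamily hWP'.neg_right 1
  have c3 : Commute (star E) E := by
    have h1 : Commute (expFamily (-star P) 1) (-P) :=
      (commute_expFamily hP.symm.neg_right 1).symm.neg_right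
    rw [hEs]
    exact commute_expFamily h1 1
  have c4 : Commute (star W) W := by
    rw [commute_iff_eq, Unitary.star_mul_self_of_mem hW, Unitary.mul_star_self_of_mem hW]
  have c5 : Commute (star (E * W)) (E * W) := by
    rw [star_mul]
    have c6 : Commute (star W) E := by simpa using c2.star_star
    exact ((c6.mul_right c4).mul_left (c3.mul_right c2.symm))
  set N := E * W - 1 with hN
  have hn : IsStarNormal N := ⟨by
    rw [hN, star_sub, star_one]
    exact (c5.sub_right (Commute.one_right _)).sub_left
      ((Commute.one_left _).sub_right (Commute.one_left _))⟩
  -- The kernel of a normal operator is the orthogonal complement of its range, so a surjective one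
  -- is injective.
  have hker : LinearMap.ker (N : H →ₗ[ℂ] H) = ⊥ := by
    have h1 := ContinuousLinearMap.IsStarNormal.orthogonal_range hn
    have h2 : N.range = ⊤ := LinearMap.range_eq_top.2 h
    rw [h2, Submodule.top_orthogonal_eq_bot] at h1
    exact h1.symm
  exact ContinuousLinearMap.isUnit_iff_bijective.2 ⟨LinearMap.ker_eq_bot.1 hker, h⟩

/-- The dependence on `W` enters only through `(E W - 1)⁻¹`, placed between the fixed operators `J`
and `G`; because `G J = 1`, passing between `H` and `L²_α` loses nothing. -/
theorem schatten_resolvent_sub_iff {H : Type*} [NormedAddCommGroup H] [InnerProductSpace ℂ H]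
    [CompleteSpace H] [TopologicalSpace.SeparableSpace H]
    {A Ar Ai : ℝ → H →ₗ.[ℂ] H} {C : H →ₗ.[ℂ] H}
    {Cb : H →L[ℂ] H} {B : ℝ → H →ₗ[ℂ] H} {U : ℝ → ℝ → H →L[ℂ] H} (hα : IsWeight α)
    (hA : IsCoefficient α ⊤ A Ar Ai C)
    (hC : ∀ f, (f, Cb f) ∈ C.graph) (hBA : ∀ t ∈ Icc (0 : ℝ) 1, ∀ f, (f, B t f) ∈ (Ai t).graph)
    (hB : IsBoundedCoefficient Cb B) (hU : IsUnitaryEvolution Cb B U) {W₁ W₂ : H →L[ℂ] H}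
    (hW₁ : W₁ ∈ unitary (H →L[ℂ] H)) (hW₂ : W₂ ∈ unitary (H →L[ℂ] H))
    (hC₁ : Commute W₁ Cb) (hC₂ : Commute W₂ Cb) {lam : ℂ} {R₁ R₂ : L2w H α →L[ℂ] L2w H α}
    (hR₁ : IsResolventAt (extensionOp α ⊤ A U W₁) lam R₁)
    (hR₂ : IsResolventAt (extensionOp α ⊤ A U W₂) lam R₂) {p : ℝ} (hp : 1 ≤ p) :
    Schatten p (R₁ - R₂) ↔ Schatten p (W₁ - W₂) := by
  set P : H →L[ℂ] H := lam • (1 : H →L[ℂ] H) - Cb with hPdef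
  have hPs : star P = (starRingEnd ℂ lam) • (1 : H →L[ℂ] H) - Cb := by
    rw [hPdef, star_sub, star_smul, star_one, hB.symm.star_eq]
    rfl
  have hsc : ∀ (W : H →L[ℂ] H) (z : ℂ), Commute W Cb → Commute W (z • (1 : H →L[ℂ] H) - Cb) :=
    fun W z h => ((Commute.one_right W).smul_right z).sub_right h
  have hP : Commute (star P) P := by
    refine hsc _ _ ?_
    rw [hPs]
    exact (hsc _ _ (Commute.refl Cb)).symm
  obtain ⟨J, hJ⟩ := exists_lift hα hU P
  obtain ⟨J', hJ'⟩ := exists_lift hα hU (-star P)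
  set G : L2w H α →L[ℂ] H := J'.adjoint with hG
  -- The factors `e^{-tP}` and `e^{tP}` cancel pointwise, and the interval has length one.
  have hGJ : G ∘L J = 1 := by
    ext z
    refine ext_inner_left ℂ fun x => ?_
    rw [ContinuousLinearMap.comp_apply, hG, ContinuousLinearMap.adjoint_inner_right,
      inner_lift hα hU hJ' x (J z)]
    have h01 : (0 : ℝ) ∈ Icc (0 : ℝ) 1 := ⟨le_rfl, zero_le_one⟩
    have : ∫ t in Ioo (0 : ℝ) 1, ⟪expFamily (-star P) t x, U 0 t ((√(α t) : ℂ) • J z t)⟫_ℂ =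
        ∫ t in Ioo (0 : ℝ) 1, ⟪x, z⟫_ℂ := by
      refine integral_congr_ae ?_
      filter_upwards [hα.ae_iff.1 (hJ z), hα.ae_pos, ae_restrict_mem measurableSet_Ioo]
        with t e1 e2 e3
      have h7 : ((√(α t) : ℝ) : ℂ) ≠ 0 := by exact_mod_cast (Real.sqrt_pos.2 e2).ne'
      have ht := Ioo_subset_Icc_self e3
      rw [e1, smul_smul, mul_inv_cancel₀ h7, one_smul, hU.comp 0 h01 t ht 0 h01,
        hU.initial 0 h01, ← star_neg, ← star_expFamily, ContinuousLinearMap.star_eq_adjoint,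
        ContinuousLinearMap.adjoint_inner_left, ← mul_apply_eq_comp, expFamily_neg_mul]
      rfl
    rw [this]
    simp
  set E := expFamily (-P) 1 with hE
  -- Duhamel at `τ = 1` reads `e^{-P} y(1) - y(0) = G q`; the boundary condition replaces `y(1)` by
  -- `W y(0)`.
  have hbv : ∀ {W : H →L[ℂ] H} {y g : ℝ → H} (q : L2w H α), IntegrableOn g (Ioo 0 1) →
      (∀ t ∈ Icc (0 : ℝ) 1, y t = y 0 + ∫ s in (0 : ℝ)..t, g s) → y 1 = W (y 0) →
      (∀ᵐ t ∂(volume.restrict (Ioo (0 : ℝ) 1)), g t = P (y t) + U 0 t ((√(α t) : ℂ) • q t)) →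
      (E * W - 1 : H →L[ℂ] H) (y 0) = G q := by
    intro W y g q hg hy h1 hode
    refine ext_inner_left ℂ fun x => ?_
    have h2 := inner_expFamily_duhamel P hg hy hode ⟨zero_le_one, le_rfl⟩ x
    rw [← inner_lift hα hU hJ', h1, ← star_neg, ← star_expFamily,
      ContinuousLinearMap.star_eq_adjoint, ContinuousLinearMap.adjoint_inner_left] at h2
    rw [hG, ContinuousLinearMap.adjoint_inner_right, ← h2, ← inner_sub_right]
    rfl
  have hsol : ∀ {W : H →L[ℂ] H} {R : L2w H α →L[ℂ] L2w H α},
      IsResolventAt (extensionOp α ⊤ A U W) lam R → W ∈ unitary (H →L[ℂ] H) → Commute W Cb →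
      IsUnit (E * W - 1) := by
    intro W R hR hW hWC
    refine isUnit_of_surjective_expFamily hW hP (hsc _ _ hWC) (by rw [hPs]; exact hsc _ _ hWC) ?_
    intro z
    -- With right-hand side `J z` the boundary equation is `(E W - 1) y(0) = G J z = z`.
    obtain ⟨y, g, hg, hy, h1, -, hode⟩ := exists_solution_of_resolvent hα hA hC hBA hB hU hR (J z)
    refine ⟨y 0, (hbv (J z) hg hy h1 hode).trans ?_⟩
    exact congrArg (fun T : H →L[ℂ] H => T z) hGJ
  obtain ⟨Q₁, hQ₁⟩ := hsol hR₁ hW₁ hC₁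
  obtain ⟨Q₂, hQ₂⟩ := hsol hR₂ hW₂ hC₂
  have hdiff : R₁ - R₂ = J ∘L ((↑Q₁⁻¹ - ↑Q₂⁻¹ : H →L[ℂ] H) ∘L G) := by
    ext1 q
    obtain ⟨y₁, g₁, hg₁, hy₁, h₁, hu₁, ho₁⟩ :=
      exists_solution_of_resolvent hα hA hC hBA hB hU hR₁ q
    obtain ⟨y₂, g₂, hg₂, hy₂, h₂, hu₂, ho₂⟩ :=
      exists_solution_of_resolvent hα hA hC hBA hB hU hR₂ q
    have inv : ∀ {Q : (H →L[ℂ] H)ˣ} {W : H →L[ℂ] H} {x : H}, (Q : H →L[ℂ] H) = E * W - 1 →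
        (E * W - 1 : H →L[ℂ] H) x = G q → x = (↑Q⁻¹ : H →L[ℂ] H) (G q) := by
      intro Q W x h3 h4
      rw [← h4, ← h3, ← mul_apply_eq_comp, Units.inv_mul]
      rfl
    have e₁ := inv hQ₁ (hbv q hg₁ hy₁ h₁ ho₁)
    have e₂ := inv hQ₂ (hbv q hg₂ hy₂ h₂ ho₂)
    have ii : ∀ {g : ℝ → H}, IntegrableOn g (Ioo 0 1) → ∀ t ∈ Icc (0 : ℝ) 1,
        IntervalIntegrable g volume 0 t := fun hg t ht => by
      rw [intervalIntegrable_iff_integrableOn_Ioo_of_le ht.1]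
      exact hg.mono_set (Ioo_subset_Ioo_right ht.2)
    -- The inhomogeneous terms coincide, so the difference solves `y' = P y` and is determined by
    -- its initial value.
    have hyd : ∀ t ∈ Icc (0 : ℝ) 1, y₁ t - y₂ t = expFamily P t (y₁ 0 - y₂ 0) := by
      intro t ht
      refine eq_expFamily_apply P (y := fun t => y₁ t - y₂ t) (g := fun t => g₁ t - g₂ t)
        (hg₁.sub hg₂) (fun s hs => ?_) ?_ ht
      · rw [intervalIntegral.integral_sub (ii hg₁ s hs) (ii hg₂ s hs)]
        rw [hy₁ s hs, hy₂ s hs]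
        abel
      · filter_upwards [ho₁, ho₂] with s k1 k2
        rw [k1, k2, map_sub]
        abel
    have hval : (J ∘L ((↑Q₁⁻¹ - ↑Q₂⁻¹ : H →L[ℂ] H) ∘L G)) q = J (y₁ 0 - y₂ 0) := by
      rw [e₁, e₂]
      rfl
    rw [hval]
    refine Lp.ext ?_
    filter_upwards [hu₁, hu₂, hJ (y₁ 0 - y₂ 0), Lp.coeFn_sub (R₁ q) (R₂ q),
      hα.ae_iff.2 (ae_restrict_mem measurableSet_Ioo)] with t k1 k2 k3 k4 k5
    change (R₁ q - R₂ q : L2w H α) t = _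
    rw [k4, Pi.sub_apply, k1, k2, k3, ← hyd t (Ioo_subset_Icc_self k5), map_sub, smul_sub]
  have hEinv : expFamily P 1 * E = 1 := expFamily_mul_neg P 1
  have hQsub : (Q₂ : H →L[ℂ] H) - Q₁ = -(E * (W₁ - W₂)) := by
    rw [hQ₁, hQ₂]
    noncomm_ring
  have hXsub : (↑Q₁⁻¹ - ↑Q₂⁻¹ : H →L[ℂ] H) = ↑Q₁⁻¹ * (Q₂ - Q₁) * ↑Q₂⁻¹ := by
    rw [mul_sub, sub_mul, mul_assoc, Units.mul_inv, Units.inv_mul, mul_one, one_mul]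
  constructor
  · intro h
    have e1 : W₁ - W₂ = -(expFamily P 1 *
        ((Q₁ : H →L[ℂ] H) * (↑Q₁⁻¹ - ↑Q₂⁻¹ : H →L[ℂ] H) * (Q₂ : H →L[ℂ] H))) := by
      rw [hXsub, mul_assoc, mul_assoc, Units.inv_mul, mul_one, Units.mul_inv_cancel_left, hQsub,
        mul_neg, neg_neg, ← mul_assoc, hEinv, one_mul]
    -- `G` on the left and `J` on the right strip the outer factors from `R₁ - R₂`.
    have e2 : W₁ - W₂ = ((-(expFamily P 1 * (Q₁ : H →L[ℂ] H))) ∘L G) ∘L (R₁ - R₂) ∘L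
        (J ∘L (Q₂ : H →L[ℂ] H)) := by
      rw [e1, hdiff]
      ext1 x
      have hz : ∀ z, G (J z) = z := fun z => congrArg (fun T : H →L[ℂ] H => T z) hGJ
      simp only [ContinuousLinearMap.comp_apply, hz]
      rfl
    rw [e2]
    exact h.comp hp _ _
  · intro h
    have e2 : R₁ - R₂ = (J ∘L (-((↑Q₁⁻¹ : H →L[ℂ] H) * E))) ∘L (W₁ - W₂) ∘L
        ((↑Q₂⁻¹ : H →L[ℂ] H) ∘L G) := by
      rw [hdiff, hXsub, hQsub]
      ext1 x
      simp only [ContinuousLinearMap.comp_apply, mul_apply_eq_comp, neg_apply, map_neg]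
    rw [e2]
    exact h.comp hp _ _

omit [CompleteSpace H] [TopologicalSpace.SeparableSpace H] in
theorem commute_of_commutes (hC : ∀ f, (f, Cb f) ∈ C.graph) {W : H →L[ℂ] H}
    (h : Commutes C (everywhere W)) : Commute W Cb := by
  have hW : ∀ x, (x, W x) ∈ (everywhere W).graph := fun x =>
    (everywhere W).mem_graph ⟨x, Submodule.mem_top⟩
  ext x
  obtain ⟨y, h1, h2⟩ := (h x (Cb (W x))).1 ⟨W x, hW x, hC _⟩
  obtain rfl := LinearPMap.mem_graph_snd_inj _ h1 (hC x) rfl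
  exact (LinearPMap.mem_graph_snd_inj _ h2 (hW _) rfl).symm

end Resolvent

end NormalExt
end

theorem corollary3 {H : Type*} [NormedAddCommGroup H] [InnerProductSpace ℂ H] [CompleteSpace H]
    [TopologicalSpace.SeparableSpace H]
    (α : ℝ → ℝ) (hα : NormalExt.IsWeight α)
    (D : Submodule ℂ H) (A Ar Ai : ℝ → H →ₗ.[ℂ] H) (C : H →ₗ.[ℂ] H)
    (hA : NormalExt.IsCoefficient α D A Ar Ai C)
    (S : H →ₗ.[ℂ] H) (hS : NormalExt.IsPosSqrt S C)
    (hSW : NormalExt.MapsIntoW12w α D A S)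
    (U : ℝ → ℝ → H →L[ℂ] H) (hU : NormalExt.IsEvolution D Ai U)
    (W₁ W₂ : H →L[ℂ] H)
    (hW₁ : W₁ ∈ unitary (H →L[ℂ] H)) (hW₂ : W₂ ∈ unitary (H →L[ℂ] H))
    (hC₁ : NormalExt.Commutes C (NormalExt.everywhere W₁))
    (hC₂ : NormalExt.Commutes C (NormalExt.everywhere W₂))
    (hL₁ : NormalExt.IsNormalExtension (NormalExt.minimalOp α D A)
      (NormalExt.extensionOp α D A U W₁))
    (hL₂ : NormalExt.IsNormalExtension (NormalExt.minimalOp α D A)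
      (NormalExt.extensionOp α D A U W₂))
    (lam : ℂ)
    (hlam : lam ∈ NormalExt.resolventSet (NormalExt.extensionOp α D A U W₁) ∩
      NormalExt.resolventSet (NormalExt.extensionOp α D A U W₂))
    (p : ℝ) (hp : 1 ≤ p) :
    NormalExt.Schatten p
        (NormalExt.resolvent (NormalExt.extensionOp α D A U W₁) lam -
          NormalExt.resolvent (NormalExt.extensionOp α D A U W₂) lam) ↔
      NormalExt.Schatten p (W₁ - W₂) := by
  -- From here on every coefficient is everywhere defined, so the unbounded setting reduces to the
  -- bounded one.
  obtain rfl : D = ⊤ := hS.domain_eq_top hα hA hSW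
  obtain ⟨Cb, B, hC, hBA, hB⟩ := hA.exists_isBoundedCoefficient
  exact NormalExt.schatten_resolvent_sub_iff hα hA hC hBA hB (hU.isUnitaryEvolution hB hBA)
    hW₁ hW₂ (NormalExt.commute_of_commutes hC hC₁) (NormalExt.commute_of_commutes hC hC₂)
    (NormalExt.resolvent_spec hlam.1) (NormalExt.resolvent_spec hlam.2) hp
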